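/- Let $d\ge 1$ and $k\ge 2$ be integers. \textbf{Networks.} Let $\sigma_2(x)=\max\{0,x\}^2$, applied componentwise. For $L\ge 2$ let $\Phi^{d_1,d_2}(L,W,S,B)$ be the set of maps $\mathbb{R}^{d_1}\to\mathbb{R}^{d_2}$ of the form $$\big(W^{(L)}\sigma_2(\cdot)+b^{(L)}\big)\circ\cdots\circ\big(W^{(2)}\sigma_2(\cdot)+b^{(2)}\big)\circ\big(W^{(1)}\,\cdot\,+b^{(1)}\big)$$ with $W^{(1)}\in\mathbb{R}^{W\times d_1}$, $W^{(l)}\in\mathbb{R}^{W\times W}$ for $1<l<L$, $W^{(L)}\in\mathbb{R}^{d_2\times W}$, $b^{(l)}\in\mathbb{R}^W$ for $l<L$, $b^{(L)}\in\mathbb{R}^{d_2}$, having in total at most $S$ nonzero entries, all of absolute value at most $B$. \textbf{Objective.} For a velocity field $g:\mathbb{R}^d\times\mathbb{R}\to\mathbb{R}^d$, let $X_g(x,\cdot)$ be the solution on $[0,1]$ of $\frac{d}{dt}X_g(x,t)=g(X_g(x,t),t)$, $X_g(x,0)=x$, and set $$R_x(g)=\int_0^1\big|\nabla_x g(X_g(x,t),t)\,g(X_g(x,t),t)+\partial_t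 g(X_g(x,t),t)\big|^2\,dt,\qquad R(g)=\int_{[0,1]^d}R_x(g)\,dx,$$ $$J_{\rm W}(g)=W_2\big(\rho,X_g(\cdot,1)_\sharp\pi\big)^2+R(g),$$ where $W_2$ is the Wasserstein distance of order $2$ on $\mathbb{R}^d$ with the Euclidean norm and $\sharp$ denotes push-forward. \textbf{Theorem.} There is a constant $C_{d,k}$ depending only on $d,k$, and for all $L_1>1$, $L_2>0$ there are constants $C'_{d,k,L_1,L_2}$ and $C_{d,k,L_1,L_2}$ depending only on $d,k,L_1,L_2$, such that the following holds. Let $\rho,\pi$ be probability measures on $[0,1]^d$ with Lebesgue densities $p_\rho,p_\pi\in C^k([0,1]^d)$ such that for $p\in\{p_\rho,p_\pi\}$ $$\|p\|_{C^k([0,1]^d)}=\sup_{n\le k}\,\sup_{x\in[0,1]^d}\|D^np(x)\|\le L_1,\qquad \inf_{x\in[0,1]^d}p(x)\ge L_2$$ (operator norms of the Fréchet derivatives with respect to the Euclidean norm). Then for every $\varepsilon\in(0,1]$ there are $L,W,S,B$ with $$L\le C_{d,k},\quad W\le C'_{d,k,L_1,L_2}\,\varepsilon^{-\frac{d+1}{k-1}},\quad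 S\le C'_{d,k,L_1,L_2}\,\varepsilon^{-\frac{d+1}{k-1}},\quad B\le C'_{d,k,L_1,L_2}\,\varepsilon^{-\frac1{k-1}}$$ and a ReLU$^2$ network $g\in\Phi^{d+1,d}(L,W,S,B)$ such that for every $x\in[0,1]^d$ the solution $X_g(x,\cdot)$ exists on $[0,1]$ and is unique, and $$J_{\rm W}(g)\le C_{d,k,L_1,L_2}\,\varepsilon^2,$$ and also, pointwise, $W_2\big(\rho,X_g(\cdot,1)_\sharp\pi\big)^2+R_x(g)\le C_{d,k,L_1,L_2}\,\varepsilon^2$ for every $x\in[0,1]^d$. -/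

import Mathlib

open MeasureTheory Set
open scoped ENNReal Matrix

noncomputable section

/-- The closed unit cube `[0,1]^d` in Euclidean space. -/
def unitCube (d : ℕ) : Set (EuclideanSpace ℝ (Fin d)) :=
  {x | ∀ i, x i ∈ Icc (0 : ℝ) 1}

/-- The `C^k(S)` norm: supremum over `n ≤ k` and `x ∈ S` of the operator norm of the `n`-th
Fréchet derivative (taken within `S`, so that `S` may be a closed cube). -/
def ckNorm {E F : Type*} [NormedAddCommGroup E] [NormedSpace ℝ E]
    [NormedAddCommGroup F] [NormedSpace ℝ F] (k : ℕ) (f : E → F) (S : Set E) : ℝ≥0∞ :=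
  ⨆ n : ℕ, ⨆ _ : n ≤ k, ⨆ x : E, ⨆ _ : x ∈ S, ‖iteratedFDerivWithin ℝ n f S x‖ₑ

/-- `μ` is a measure on `[0,1]^d` with a Lebesgue density `p ∈ C^k([0,1]^d)` such that
`‖p‖_{C^k([0,1]^d)} ≤ L₁` and `p ≥ L₂` on `[0,1]^d`. -/
def HasRegularDensity (d k : ℕ) (L₁ L₂ : ℝ) (μ : Measure (EuclideanSpace ℝ (Fin d))) : Prop :=
  ∃ p : EuclideanSpace ℝ (Fin d) → ℝ,
    ContDiffOn ℝ k p (unitCube d) ∧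
    ckNorm k p (unitCube d) ≤ ENNReal.ofReal L₁ ∧
    (∀ x ∈ unitCube d, L₂ ≤ p x) ∧
    μ = (volume.restrict (unitCube d)).withDensity (fun x => ENNReal.ofReal (p x))

/-- Wasserstein distance of order `p` (with values in `[0, ∞]`). -/
def wassersteinDist {X : Type*} [PseudoEMetricSpace X] [MeasurableSpace X] (p : ℝ)
    (μ ν : Measure X) : ℝ≥0∞ :=
  (⨅ γ : Measure (X × X), ⨅ _ : γ.map Prod.fst = μ ∧ γ.map Prod.snd = ν,
    ∫⁻ z, edist z.1 z.2 ^ p ∂γ) ^ (1 / p)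

/-- `γ` solves `γ' = f(γ, t)` on `[0,1]` with `γ(0) = x`. -/
def IsTrajectory {d : ℕ} (f : EuclideanSpace ℝ (Fin d) → ℝ → EuclideanSpace ℝ (Fin d))
    (x : EuclideanSpace ℝ (Fin d)) (γ : ℝ → EuclideanSpace ℝ (Fin d)) : Prop :=
  γ 0 = x ∧ ∀ t ∈ Icc (0 : ℝ) 1, HasDerivWithinAt γ (f (γ t) t) (Icc 0 1) t

/-- Existence and uniqueness on `[0,1]` of the trajectory of `f` started at `x`. -/
def HasUniqueTrajectory {d : ℕ}
    (f : EuclideanSpace ℝ (Fin d) → ℝ → EuclideanSpace ℝ (Fin d))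
    (x : EuclideanSpace ℝ (Fin d)) : Prop :=
  ∃ γ, IsTrajectory f x γ ∧ ∀ γ', IsTrajectory f x γ' → EqOn γ' γ (Icc 0 1)

open Classical in
/-- The flow map `X_f(x, t)`, `t ∈ [0,1]`; meaningful at those `x` with
`HasUniqueTrajectory f x`. -/
def flowMap {d : ℕ} (f : EuclideanSpace ℝ (Fin d) → ℝ → EuclideanSpace ℝ (Fin d))
    (x : EuclideanSpace ℝ (Fin d)) (t : ℝ) : EuclideanSpace ℝ (Fin d) :=
  if h : ∃ γ, IsTrajectory f x γ then h.choose t else x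

/-- The Lagrangian acceleration `(∇_x f(x,t)) f(x,t) + ∂_t f(x,t)`. -/
def acceleration {d : ℕ} (f : EuclideanSpace ℝ (Fin d) → ℝ → EuclideanSpace ℝ (Fin d))
    (x : EuclideanSpace ℝ (Fin d)) (t : ℝ) : EuclideanSpace ℝ (Fin d) :=
  fderiv ℝ (fun y => f y t) x (f x t) + deriv (fun s => f x s) t

/-- The squared acceleration integrated along the trajectory started at `x`. -/
def pathRegularizer {d : ℕ} (f : EuclideanSpace ℝ (Fin d) → ℝ → EuclideanSpace ℝ (Fin d))
    (x : EuclideanSpace ℝ (Fin d)) : ℝ≥0∞ :=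
  ∫⁻ t in Icc (0 : ℝ) 1, ‖acceleration f (flowMap f x t) t‖ₑ ^ 2

/-- The regularizer `R(f)`: the path regularizer integrated over `[0,1]^d`. -/
def regularizer {d : ℕ} (f : EuclideanSpace ℝ (Fin d) → ℝ → EuclideanSpace ℝ (Fin d)) : ℝ≥0∞ :=
  ∫⁻ x in unitCube d, pathRegularizer f x

/-- `W₂(ρ, X_f(·,1)_♯ π)²`. -/
def wassersteinLoss {d : ℕ} (ρ π : Measure (EuclideanSpace ℝ (Fin d)))
    (f : EuclideanSpace ℝ (Fin d) → ℝ → EuclideanSpace ℝ (Fin d)) : ℝ≥0∞ :=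
  wassersteinDist 2 ρ (π.map (fun x => flowMap f x 1)) ^ 2

/-- The objective `J_W(f) = W₂(ρ, X_f(·,1)_♯ π)² + R(f)`. -/
def objectiveW {d : ℕ} (ρ π : Measure (EuclideanSpace ℝ (Fin d)))
    (f : EuclideanSpace ℝ (Fin d) → ℝ → EuclideanSpace ℝ (Fin d)) : ℝ≥0∞ :=
  wassersteinLoss ρ π f + regularizer f

/-- The activation `σ₂(x) = max{0,x}²`, applied componentwise. -/
def reluSq {ι : Type*} (v : ι → ℝ) : ι → ℝ := fun i => (max 0 (v i)) ^ 2

/-- An affine layer `z ↦ A z + b` with `n` inputs and `m` outputs. -/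
structure AffineLayer (n m : ℕ) where
  weight : Matrix (Fin m) (Fin n) ℝ
  bias : Fin m → ℝ

namespace AffineLayer

variable {n m : ℕ}

def apply (A : AffineLayer n m) (z : Fin n → ℝ) : Fin m → ℝ := A.weight *ᵥ z + A.bias

open Classical in
/-- The number of nonzero entries of weight matrix and bias. -/
def numNonzero (A : AffineLayer n m) : ℕ :=
  (Finset.univ.filter fun ij : Fin m × Fin n => A.weight ij.1 ij.2 ≠ 0).card +
    (Finset.univ.filter fun i : Fin m => A.bias i ≠ 0).card

/-- All entries of weight matrix and bias are at most `B` in absolute value. -/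
def BoundedBy (A : AffineLayer n m) (B : ℝ) : Prop :=
  (∀ i j, |A.weight i j| ≤ B) ∧ ∀ i, |A.bias i| ≤ B

end AffineLayer

/-- The parameters of a feedforward network of width `W` from `ℝ^{d₁}` to `ℝ^{d₂}`: an input
layer, a list of hidden layers (in the order of application) and an output layer. -/
structure ReLUSqNetwork (d₁ d₂ W : ℕ) where
  input : AffineLayer d₁ W
  hidden : List (AffineLayer W W)
  output : AffineLayer W d₂

namespace ReLUSqNetwork

variable {d₁ d₂ W : ℕ}

/-- The number of affine layers. -/
def depth (N : ReLUSqNetwork d₁ d₂ W) : ℕ := N.hidden.length + 2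

/-- The function computed by the network. -/
def eval (N : ReLUSqNetwork d₁ d₂ W) (x : Fin d₁ → ℝ) : Fin d₂ → ℝ :=
  N.output.apply (reluSq (N.hidden.foldl (fun z A => A.apply (reluSq z)) (N.input.apply x)))

/-- The total number of nonzero parameters. -/
def numNonzero (N : ReLUSqNetwork d₁ d₂ W) : ℕ :=
  N.input.numNonzero + (N.hidden.map AffineLayer.numNonzero).sum + N.output.numNonzero

/-- All parameters are at most `B` in absolute value. -/
def BoundedBy (N : ReLUSqNetwork d₁ d₂ W) (B : ℝ) : Prop :=
  N.input.BoundedBy B ∧ (∀ A ∈ N.hidden, A.BoundedBy B) ∧ N.output.BoundedBy B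

end ReLUSqNetwork

/-- The class `Φ^{d₁,d₂}(L, W, S, B)` of (functions computed by) ReLU² networks of depth `L`,
width `W`, sparsity `S` and weight bound `B`. -/
def reluSqClass (d₁ d₂ L W S : ℕ) (B : ℝ) : Set ((Fin d₁ → ℝ) → (Fin d₂ → ℝ)) :=
  {φ | ∃ N : ReLUSqNetwork d₁ d₂ W,
    N.depth = L ∧ N.numNonzero ≤ S ∧ N.BoundedBy B ∧ N.eval = φ}

/-- The velocity field `(x, t) ↦ φ(x₁, …, x_d, t)`. -/
def toVelocity {d : ℕ} (φ : (Fin (d + 1) → ℝ) → (Fin d → ℝ)) :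
    EuclideanSpace ℝ (Fin d) → ℝ → EuclideanSpace ℝ (Fin d) :=
  fun x t => WithLp.toLp 2 (φ (Fin.snoc (α := fun _ => ℝ) (WithLp.ofLp x) t))

end

/-!
Transport `π` to `ρ` through the uniform measure. The Knothe–Rosenblatt maps of the two densities
are `C^k`, triangular and monotone, with all constants controlled by `d`, `k` and the bounds on the
densities; let `G₀` and `G₁` be their inverses. For `t ∈ [0,1]` the interpolation
`(1 - t) G₀ + t G₁` is again triangular and monotone, hence a `C^k` diffeomorphism of the cube, and
the velocity field moving `(1 - t) G₀ u + t G₁ u` with velocity `G₁ u - G₀ u` transports `π` to `ρ`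
along straight lines: its acceleration vanishes, and it is tangent to the faces of the cube.

On a grid of mesh `1 / N` with `N ∼ ε ^ (-1 / (k - 1))`, the Taylor polynomials of the field, glued
by a partition of unity of quadratic splines, approximate it to order `ε` in `C^1`. Each summand is
a product of affine functions and splines, which a balanced tree of multiplications
`4 x y = (x + y)² - (x - y)²` computes exactly with `σ₂`. Before the approximation the field is
pushed inwards by a multiple of `ε`, so that the trajectories of the network stay in the cube.
Grönwall's inequality then bounds the distance of the two flows, hence the Wasserstein loss, and
`C^1` closeness to a field without acceleration bounds the regularizer.
-/

noncomputable section

open scoped NNReal Topology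
open Filter Metric

universe u

section UniformSmoothness

variable {I J E F G H : Type*} [NormedAddCommGroup E] [NormedSpace ℝ E]
  [NormedAddCommGroup F] [NormedSpace ℝ F] [NormedAddCommGroup G] [NormedSpace ℝ G]
  [NormedAddCommGroup H] [NormedSpace ℝ H] {n : ℕ}

lemma exists_norm_iteratedFDerivWithin_le_of_isCompact {g : F → G} {t K : Set F}
    (hg : ContDiffOn ℝ n g t) (ht : UniqueDiffOn ℝ t) (hK : IsCompact K) (hKt : K ⊆ t) :
    ∃ C : ℝ, ∀ m ≤ n, ∀ y ∈ K, ‖iteratedFDerivWithin ℝ m g t y‖ ≤ C := by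
  have bound_of_order (m : ℕ) (hm : m ∈ Finset.range (n + 1)) :
      ∃ C : ℝ, ∀ y ∈ K, ‖iteratedFDerivWithin ℝ m g t y‖ ≤ C :=
    hK.exists_bound_of_continuousOn ((hg.continuousOn_iteratedFDerivWithin
      (by exact_mod_cast Finset.mem_range_succ_iff.1 hm) ht).mono hKt)
  choose! C hC using bound_of_order
  refine ⟨∑ m ∈ Finset.range (n + 1), |C m|, fun m hm y hy => ?_⟩
  have hm' := Finset.mem_range_succ_iff.2 hm
  exact ((hC m hm' y hy).trans (le_abs_self _)).trans
    (Finset.single_le_sum (f := fun m => |C m|) (fun _ _ => abs_nonneg _) hm')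

/-- `f` is `C^n` on `s` and the operator norms of its derivatives of order at most `n` are bounded
by `C` on `s`. -/
structure CkBoundedOn (n : ℕ) (C : ℝ) (f : E → F) (s : Set E) : Prop where
  contDiffOn : ContDiffOn ℝ n f s
  norm_iteratedFDerivWithin_le : ∀ m ≤ n, ∀ x ∈ s, ‖iteratedFDerivWithin ℝ m f s x‖ ≤ C

namespace CkBoundedOn

variable {C : ℝ} {f : E → F} {s : Set E} {x y : E}

lemma norm_le (hf : CkBoundedOn n C f s) (hx : x ∈ s) : ‖f x‖ ≤ C := by
  simpa using hf.norm_iteratedFDerivWithin_le 0 n.zero_le x hx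

lemma hasFDerivWithinAt (hf : CkBoundedOn n C f s) (hn : 1 ≤ n) (hx : x ∈ s) :
    HasFDerivWithinAt f (fderivWithin ℝ f s x) s x :=
  (hf.contDiffOn.differentiableOn (by norm_cast; omega) x hx).hasFDerivWithinAt

lemma norm_fderivWithin_le (hf : CkBoundedOn n C f s) (hn : 1 ≤ n) (hs : UniqueDiffOn ℝ s)
    (hx : x ∈ s) : ‖fderivWithin ℝ f s x‖ ≤ C := by
  rw [← norm_iteratedFDerivWithin_one f (hs x hx)]
  exact hf.norm_iteratedFDerivWithin_le 1 hn x hx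

lemma norm_sub_le (hf : CkBoundedOn n C f s) (hn : 1 ≤ n) (hs : UniqueDiffOn ℝ s)
    (hconv : Convex ℝ s) (hx : x ∈ s) (hy : y ∈ s) : ‖f x - f y‖ ≤ C * ‖x - y‖ :=
  hconv.norm_image_sub_le_of_norm_hasFDerivWithin_le
    (fun _ hz => hf.hasFDerivWithinAt hn hz) (fun _ hz => hf.norm_fderivWithin_le hn hs hz) hy hx

lemma lipschitzOnWith (hf : CkBoundedOn n C f s) (hn : 1 ≤ n) (hs : UniqueDiffOn ℝ s)
    (hconv : Convex ℝ s) : LipschitzOnWith C.toNNReal f s :=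
  hconv.lipschitzOnWith_of_nnnorm_hasFDerivWithin_le (fun _ hx => hf.hasFDerivWithinAt hn hx)
    fun _ hx => NNReal.le_toNNReal_of_coe_le (hf.norm_fderivWithin_le hn hs hx)

lemma comp_continuousLinearMap (hf : CkBoundedOn n C f s) (hs : UniqueDiffOn ℝ s) (g : G →L[ℝ] E)
    (hs' : UniqueDiffOn ℝ (g ⁻¹' s)) :
    CkBoundedOn n (C * max 1 ‖g‖ ^ n) (f ∘ g) (g ⁻¹' s) := by
  refine ⟨hf.contDiffOn.comp_continuousLinearMap g, fun m hm x hx => ?_⟩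
  rw [g.iteratedFDerivWithin_comp_right hf.contDiffOn hs hs' hx (by exact_mod_cast hm)]
  refine (ContinuousMultilinearMap.norm_compContinuousLinearMap_le _ _).trans ?_
  rw [Finset.prod_const, Finset.card_univ, Fintype.card_fin]
  have hpow : ‖g‖ ^ m ≤ max 1 ‖g‖ ^ n :=
    (pow_le_pow_left₀ (norm_nonneg _) (le_max_right _ _) m).trans
      (pow_le_pow_right₀ (le_max_left _ _) hm)
  exact mul_le_mul (hf.norm_iteratedFDerivWithin_le m hm _ hx) hpow (by positivity)
    ((norm_nonneg _).trans (hf.norm_le hx))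

lemma of_ckNorm_le (hC : 0 ≤ C) (hf : ContDiffOn ℝ n f s)
    (h : ckNorm n f s ≤ ENNReal.ofReal C) : CkBoundedOn n C f s := by
  refine ⟨hf, fun m hm x hx => ?_⟩
  have henorm := (iSup₂_le_iff.1 (iSup₂_le_iff.1 h m hm)) x hx
  rwa [← ofReal_norm, ENNReal.ofReal_le_ofReal_iff hC] at henorm

end CkBoundedOn

/-- A family of functions that is `C^n` on `s` with bounds, uniform over the family, on all the
derivatives up to order `n`. All constants that depend on a density only through its `C^k` norm are
obtained by applying the calculus of such families to the family of all admissible densities. -/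
def UnifContDiffOn (n : ℕ) (f : I → E → F) (s : Set E) : Prop :=
  ∃ C : ℝ, ∀ i, CkBoundedOn n C (f i) s

namespace UnifContDiffOn

variable {f f' : I → E → F} {s : Set E}

lemma contDiffOn (hf : UnifContDiffOn n f s) (i : I) : ContDiffOn ℝ n (f i) s :=
  (hf.choose_spec i).1

lemma continuousOn (hf : UnifContDiffOn n f s) (i : I) : ContinuousOn (f i) s :=
  (hf.contDiffOn i).continuousOn

lemma exists_nonneg_bound (hf : UnifContDiffOn n f s) :
    ∃ C : ℝ, 0 ≤ C ∧ ∀ i, ∀ m ≤ n, ∀ x ∈ s, ‖iteratedFDerivWithin ℝ m (f i) s x‖ ≤ C := by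
  obtain ⟨C, hC⟩ := hf
  exact ⟨max C 0, le_max_right _ _,
    fun i m hm x hx => ((hC i).2 m hm x hx).trans (le_max_left _ _)⟩

lemma exists_norm_le (hf : UnifContDiffOn n f s) :
    ∃ C : ℝ, 0 ≤ C ∧ ∀ i, ∀ x ∈ s, ‖f i x‖ ≤ C := by
  obtain ⟨C, hC0, hC⟩ := hf.exists_nonneg_bound
  exact ⟨C, hC0, fun i x hx => by simpa using hC i 0 n.zero_le x hx⟩

lemma of_le {m : ℕ} (hf : UnifContDiffOn n f s) (hmn : m ≤ n) : UnifContDiffOn m f s := by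
  obtain ⟨C, hC⟩ := hf
  exact ⟨C, fun i => ⟨(hC i).1.of_le (by exact_mod_cast hmn),
    fun l hl => (hC i).2 l (hl.trans hmn)⟩⟩

lemma congr (hf : UnifContDiffOn n f s) (h : ∀ i, EqOn (f' i) (f i) s) :
    UnifContDiffOn n f' s := by
  obtain ⟨C, hC⟩ := hf
  refine ⟨C, fun i => ⟨(hC i).1.congr (h i), fun m hm x hx => ?_⟩⟩
  rw [iteratedFDerivWithin_congr (h i) hx]
  exact (hC i).2 m hm x hx

lemma comp_index (hf : UnifContDiffOn n f s) (φ : J → I) :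
    UnifContDiffOn n (fun j => f (φ j)) s :=
  let ⟨C, hC⟩ := hf; ⟨C, fun j => hC (φ j)⟩

lemma const (c : I → F) {C : ℝ} (hc : ∀ i, ‖c i‖ ≤ C) :
    UnifContDiffOn n (fun i (_ : E) => c i) s := by
  refine ⟨max C 0, fun i => ⟨contDiffOn_const, fun m _ x _ => ?_⟩⟩
  rcases m with _ | m
  · simpa using Or.inl (hc i)
  · simp [iteratedFDerivWithin_succ_const]

lemma continuousLinearMap_comp (L : F →L[ℝ] G) (hf : UnifContDiffOn n f s)
    (hs : UniqueDiffOn ℝ s) : UnifContDiffOn n (fun i x => L (f i x)) s := by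
  obtain ⟨C, hC⟩ := hf
  refine ⟨‖L‖ * C, fun i => ⟨L.contDiff.comp_contDiffOn (hC i).1, fun m hm x hx => ?_⟩⟩
  calc ‖iteratedFDerivWithin ℝ m (fun x => L (f i x)) s x‖
      ≤ ‖L‖ * ‖iteratedFDerivWithin ℝ m (f i) s x‖ :=
        L.norm_iteratedFDerivWithin_comp_left ((hC i).1 x hx) hs hx (by exact_mod_cast hm)
    _ ≤ ‖L‖ * C := by gcongr; exact (hC i).2 m hm x hx

lemma add (hf : UnifContDiffOn n f s) (hf' : UnifContDiffOn n f' s) (hs : UniqueDiffOn ℝ s) :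
    UnifContDiffOn n (fun i x => f i x + f' i x) s := by
  obtain ⟨C, hC⟩ := hf
  obtain ⟨C', hC'⟩ := hf'
  refine ⟨C + C', fun i => ⟨(hC i).1.add (hC' i).1, fun m hm x hx => ?_⟩⟩
  have hm' : (m : WithTop ℕ∞) ≤ n := by exact_mod_cast hm
  change ‖iteratedFDerivWithin ℝ m (f i + f' i) s x‖ ≤ _
  rw [iteratedFDerivWithin_add_apply (((hC i).1 x hx).of_le hm')
    (((hC' i).1 x hx).of_le hm') hs hx]
  exact norm_add_le_of_le ((hC i).2 m hm x hx) ((hC' i).2 m hm x hx)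

lemma sub (hf : UnifContDiffOn n f s) (hf' : UnifContDiffOn n f' s) (hs : UniqueDiffOn ℝ s) :
    UnifContDiffOn n (fun i x => f i x - f' i x) s := by
  simpa [sub_eq_add_neg] using
    hf.add (hf'.continuousLinearMap_comp (-(ContinuousLinearMap.id ℝ F)) hs) hs

lemma sum {ι : Type*} (u : Finset ι) {f : ι → I → E → F}
    (hf : ∀ j ∈ u, UnifContDiffOn n (f j) s) (hs : UniqueDiffOn ℝ s) :
    UnifContDiffOn n (fun i x => ∑ j ∈ u, f j i x) s := by
  classical
  induction u using Finset.induction_on with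
  | empty => simpa using const (n := n) (fun _ : I => (0 : F)) (C := 0) (by simp)
  | insert a u ha ih =>
    simp only [Finset.sum_insert ha]
    exact (hf a (by simp)).add (ih fun j hj => hf j (by simp [hj])) hs

lemma pi {ι : Type*} [Fintype ι] {f : I → E → ι → F}
    (hf : ∀ j, UnifContDiffOn n (fun i x => f i x j) s) (hs : UniqueDiffOn ℝ s) :
    UnifContDiffOn n f s := by
  classical
  refine (sum Finset.univ (fun j _ => (hf j).continuousLinearMap_comp
    (ContinuousLinearMap.single ℝ (fun _ => F) j) hs) hs).congr fun i x _ => ?_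
  ext j
  simp [Finset.sum_apply, Pi.single_apply]

lemma apply {ι : Type*} [Fintype ι] {f : I → E → ι → F} (hf : UnifContDiffOn n f s)
    (hs : UniqueDiffOn ℝ s) (j : ι) : UnifContDiffOn n (fun i x => f i x j) s :=
  hf.continuousLinearMap_comp (ContinuousLinearMap.proj (R := ℝ) (φ := fun _ : ι => F) j) hs

lemma bilinear {g : I → E → G} (B : F →L[ℝ] G →L[ℝ] H) (hf : UnifContDiffOn n f s)
    (hg : UnifContDiffOn n g s) (hs : UniqueDiffOn ℝ s) :
    UnifContDiffOn n (fun i x => B (f i x) (g i x)) s := by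
  obtain ⟨C, hC0, hC⟩ := hf.exists_nonneg_bound
  obtain ⟨C', hC'0, hC'⟩ := hg.exists_nonneg_bound
  refine ⟨‖B‖ * (2 ^ n * (C * C')), fun i => ⟨B.isBoundedBilinearMap.contDiff.comp_contDiffOn
    ((hf.contDiffOn i).prodMk (hg.contDiffOn i)), fun m hm x hx => ?_⟩⟩
  refine (B.norm_iteratedFDerivWithin_le_of_bilinear (hf.contDiffOn i) (hg.contDiffOn i) hs hx
    (by exact_mod_cast hm)).trans ?_
  gcongr
  calc _ ≤ ∑ l ∈ Finset.range (m + 1), (m.choose l : ℝ) * (C * C') := by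
        refine Finset.sum_le_sum fun l hl => ?_
        have hlm := Finset.mem_range_succ_iff.1 hl
        rw [mul_assoc]
        gcongr
        · exact hC i l (hlm.trans hm) x hx
        · exact hC' i _ ((Nat.sub_le m l).trans hm) x hx
    _ = 2 ^ m * (C * C') := by
        rw [← Finset.sum_mul, ← Nat.cast_sum, Nat.sum_range_choose]
        norm_cast
    _ ≤ 2 ^ n * (C * C') := by gcongr; norm_num

lemma mul {a b : I → E → ℝ} (ha : UnifContDiffOn n a s) (hb : UnifContDiffOn n b s)
    (hs : UniqueDiffOn ℝ s) : UnifContDiffOn n (fun i x => a i x * b i x) s :=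
  ha.bilinear (ContinuousLinearMap.mul ℝ ℝ) hb hs

lemma comp_of_bound {g : I → F → G} {t : Set F} (hg : ∀ i, ContDiffOn ℝ n (g i) t)
    (ht : UniqueDiffOn ℝ t) {C : ℝ}
    (hC : ∀ i, ∀ m ≤ n, ∀ x ∈ s, ‖iteratedFDerivWithin ℝ m (g i) t (f i x)‖ ≤ C)
    (hf : UnifContDiffOn n f s) (hs : UniqueDiffOn ℝ s) (hst : ∀ i, MapsTo (f i) s t) :
    UnifContDiffOn n (fun i x => g i (f i x)) s := by
  obtain ⟨D, -, hD⟩ := hf.exists_nonneg_bound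
  refine ⟨n.factorial * max C 0 * (max 1 D) ^ n, fun i =>
    ⟨(hg i).comp (hf.contDiffOn i) (hst i), fun m hm x hx => ?_⟩⟩
  calc ‖iteratedFDerivWithin ℝ m (g i ∘ f i) s x‖
      ≤ m.factorial * max C 0 * (max 1 D) ^ m := by
        refine norm_iteratedFDerivWithin_comp_le (hg i) (hf.contDiffOn i) (by exact_mod_cast hm)
          ht hs (hst i) hx (fun l hl => ?_) (fun l hl hlm => ?_)
        · exact (hC i l (hl.trans hm) x hx).trans (le_max_left _ _)
        · exact ((hD i l (hlm.trans hm) x hx).trans (le_max_right _ _)).trans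
            (le_self_pow₀ (le_max_left _ _) (by omega))
    _ ≤ n.factorial * max C 0 * (max 1 D) ^ n := by
        gcongr
        exact le_max_left _ _

lemma comp {g : I → F → G} {t : Set F} (hg : UnifContDiffOn n g t) (ht : UniqueDiffOn ℝ t)
    (hf : UnifContDiffOn n f s) (hs : UniqueDiffOn ℝ s) (hst : ∀ i, MapsTo (f i) s t) :
    UnifContDiffOn n (fun i x => g i (f i x)) s := by
  obtain ⟨C, hC⟩ := hg
  exact comp_of_bound (fun i => (hC i).1) ht
    (fun i m hm x hx => (hC i).2 m hm _ (hst i hx)) hf hs hst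

lemma contDiffOn_comp {g : F → G} {t K : Set F} (hg : ContDiffOn ℝ n g t)
    (ht : UniqueDiffOn ℝ t) (hK : IsCompact K) (hKt : K ⊆ t)
    (hf : UnifContDiffOn n f s) (hs : UniqueDiffOn ℝ s) (hst : ∀ i, MapsTo (f i) s K) :
    UnifContDiffOn n (fun i x => g (f i x)) s := by
  obtain ⟨C, hC⟩ := exists_norm_iteratedFDerivWithin_le_of_isCompact hg ht hK hKt
  exact comp_of_bound (g := fun _ => g) (fun _ => hg) ht
    (fun i m hm x hx => hC m hm _ (hst i hx)) hf hs (fun i => (hst i).mono_right hKt)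

lemma of_contDiffOn {g : E → F} (hg : ContDiffOn ℝ n g s) (hs : UniqueDiffOn ℝ s)
    (hsc : IsCompact s) : UnifContDiffOn n (fun _ : I => g) s := by
  obtain ⟨C, hC⟩ := exists_norm_iteratedFDerivWithin_le_of_isCompact hg hs hsc subset_rfl
  exact ⟨C, fun _ => ⟨hg, hC⟩⟩

lemma inv {a : I → E → ℝ} {c : ℝ} (hc : 0 < c) (ha : UnifContDiffOn n a s)
    (hs : UniqueDiffOn ℝ s) (hca : ∀ i, ∀ x ∈ s, c ≤ a i x) :
    UnifContDiffOn n (fun i x => (a i x)⁻¹) s := by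
  obtain ⟨C, -, hC⟩ := ha.exists_norm_le
  exact contDiffOn_comp (t := Ioi 0) (K := Icc c C)
    (fun y hy => (contDiffAt_inv ℝ (ne_of_gt hy)).contDiffWithinAt) isOpen_Ioi.uniqueDiffOn
    isCompact_Icc (fun y hy => hc.trans_le hy.1) ha hs
    (fun i x hx => ⟨hca i x hx, (le_abs_self _).trans (hC i x hx)⟩)

lemma succ_iff (hs : UniqueDiffOn ℝ s) :
    UnifContDiffOn (n + 1) f s ↔ (∃ C : ℝ, ∀ i, ∀ x ∈ s, ‖f i x‖ ≤ C) ∧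
      (∀ i, DifferentiableOn ℝ (f i) s) ∧
      UnifContDiffOn n (fun i => fderivWithin ℝ (f i) s) s := by
  constructor
  · intro hf
    refine ⟨let ⟨C, _, hC⟩ := hf.exists_norm_le; ⟨C, hC⟩,
      fun i => (hf.contDiffOn i).differentiableOn (by simp), ?_⟩
    obtain ⟨C, hC⟩ := hf
    refine ⟨C, fun i => ⟨(hC i).1.fderivWithin hs (by norm_cast), fun m hm x hx => ?_⟩⟩
    rw [norm_iteratedFDerivWithin_fderivWithin hs hx]
    exact (hC i).2 (m + 1) (by omega) x hx
  · rintro ⟨⟨C, hC⟩, hdiff, C', hC'⟩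
    refine ⟨max C C', fun i => ⟨by
      exact_mod_cast contDiffOn_succ_of_fderivWithin (n := n) (hdiff i) (by simp) (hC' i).1,
      fun m hm x hx => ?_⟩⟩
    rcases m with _ | m
    · simpa using Or.inl (hC i x hx)
    · rw [← norm_iteratedFDerivWithin_fderivWithin hs hx]
      exact ((hC' i).2 m (by omega) x hx).trans (le_max_right _ _)

lemma of_hasFDerivWithinAt (hs : UniqueDiffOn ℝ s) {C : ℝ} (hC : ∀ i, ∀ x ∈ s, ‖f i x‖ ≤ C)
    {A : I → E → E →L[ℝ] F} (hfA : ∀ i, ∀ x ∈ s, HasFDerivWithinAt (f i) (A i x) s x)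
    (hA : UnifContDiffOn n A s) : UnifContDiffOn (n + 1) f s :=
  (succ_iff hs).2 ⟨⟨C, hC⟩, fun i x hx => (hfA i x hx).differentiableWithinAt,
    hA.congr fun i x hx => (hfA i x hx).fderivWithin (hs x hx)⟩

lemma zero_of_continuousOn {C : ℝ} (hf : ∀ i, ContinuousOn (f i) s)
    (hC : ∀ i, ∀ x ∈ s, ‖f i x‖ ≤ C) : UnifContDiffOn 0 f s :=
  ⟨C, fun i => ⟨by simpa using hf i, fun m hm x hx => by
    obtain rfl : m = 0 := by omega
    simpa using hC i x hx⟩⟩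

lemma exists_lipschitz (hf : UnifContDiffOn n f s) (hn : 1 ≤ n) (hs : UniqueDiffOn ℝ s)
    (hconv : Convex ℝ s) :
    ∃ L : ℝ, 0 ≤ L ∧ ∀ i, ∀ x ∈ s, ∀ y ∈ s, ‖f i x - f i y‖ ≤ L * ‖x - y‖ := by
  obtain ⟨C, hC⟩ := hf
  refine ⟨|C|, abs_nonneg C, fun i x hx y hy => ((hC i).norm_sub_le hn hs hconv hx hy).trans ?_⟩
  gcongr
  exact le_abs_self C

end UnifContDiffOn

end UniformSmoothness

section ParametricIntegral

variable {I X E F : Type*} [NormedAddCommGroup E] [NormedSpace ℝ E]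
  [NormedAddCommGroup F] [NormedSpace ℝ F] {a b : ℝ}

lemma intervalIntegrable_of_continuousOn_prod {F : Type*} [NormedAddCommGroup F]
    [TopologicalSpace X] {S : Set X} {g : X × ℝ → F} (hg : ContinuousOn g (S ×ˢ uIcc a b))
    {x : X} (hx : x ∈ S) : IntervalIntegrable (fun s => g (x, s)) volume a b :=
  (hg.comp (by fun_prop) fun _ hs => ⟨hx, hs⟩).intervalIntegrable

lemma norm_intervalIntegral_le_of_uIcc {f : ℝ → F} {C : ℝ} (hf : ∀ s ∈ uIcc a b, ‖f s‖ ≤ C) :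
    ‖∫ s in a..b, f s‖ ≤ C * |b - a| :=
  intervalIntegral.norm_integral_le_of_norm_le_const fun s hs => hf s (uIoc_subset_uIcc hs)

lemma continuousOn_intervalIntegral_of_continuousOn_prod [TopologicalSpace X]
    [FirstCountableTopology X] {S : Set X} {g : X × ℝ → F} (hS : IsCompact S)
    (hg : ContinuousOn g (S ×ˢ uIcc a b)) :
    ContinuousOn (fun x => ∫ s in a..b, g (x, s)) S := by
  obtain ⟨C, hC⟩ := (hS.prod isCompact_uIcc).exists_bound_of_continuousOn hg
  refine fun x hx => intervalIntegral.continuousWithinAt_of_dominated_interval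
    (bound := fun _ => C) ?_ ?_ intervalIntegrable_const (ae_of_all _ fun s hs => ?_)
  · filter_upwards [self_mem_nhdsWithin] with y hy
    exact (intervalIntegrable_of_continuousOn_prod hg hy).def'.aestronglyMeasurable
  · filter_upwards [self_mem_nhdsWithin] with y hy
    exact ae_of_all _ fun s hs => hC (y, s) ⟨hy, uIoc_subset_uIcc hs⟩
  · exact (hg.comp (f := fun y => (y, s)) (by fun_prop)
      fun y hy => ⟨hy, uIoc_subset_uIcc hs⟩) x hx

lemma exists_forall_norm_sub_lt_of_continuousOn_prod {X Y F : Type*} [PseudoMetricSpace X]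
    [PseudoMetricSpace Y] [NormedAddCommGroup F] {S : Set X} {K : Set Y} (hS : IsCompact S)
    (hK : IsCompact K) {g : X × Y → F} (hg : ContinuousOn g (S ×ˢ K)) {ε : ℝ} (hε : 0 < ε) :
    ∃ δ > 0, ∀ x ∈ S, ∀ y ∈ S, dist y x < δ → ∀ s ∈ K, ‖g (y, s) - g (x, s)‖ < ε := by
  obtain ⟨δ, hδ, h⟩ := Metric.uniformContinuousOn_iff.1
    ((hS.prod hK).uniformContinuousOn_of_continuous hg) ε hε
  refine ⟨δ, hδ, fun x hx y hy hxy s hs => ?_⟩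
  rw [← dist_eq_norm]
  exact h (y, s) ⟨hy, hs⟩ (x, s) ⟨hx, hs⟩ (by simpa [Prod.dist_eq] using hxy)

lemma hasFDerivWithinAt_intervalIntegral_of_continuousOn_prod {S : Set E}
    (hS : IsCompact S) (hconv : Convex ℝ S) {g : E × ℝ → F} {A : E × ℝ → E →L[ℝ] F}
    (hg : ContinuousOn g (S ×ˢ uIcc a b)) (hA : ContinuousOn A (S ×ˢ uIcc a b))
    (hgA : ∀ x ∈ S, ∀ s ∈ uIcc a b, HasFDerivWithinAt (fun y => g (y, s)) (A (x, s)) S x)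
    {x : E} (hx : x ∈ S) :
    HasFDerivWithinAt (fun y => ∫ s in a..b, g (y, s)) (∫ s in a..b, A (x, s)) S x := by
  rw [hasFDerivWithinAt_iff_isLittleO, Asymptotics.isLittleO_iff]
  intro ε hε
  obtain ⟨η, hη, hηε⟩ : ∃ η > 0, η * |b - a| ≤ ε :=
    ⟨ε / (|b - a| + 1), by positivity, by
      rw [div_mul_eq_mul_div, div_le_iff₀ (by positivity)]
      nlinarith [abs_nonneg (b - a)]⟩
  obtain ⟨δ, hδ, hAδ⟩ := exists_forall_norm_sub_lt_of_continuousOn_prod hS isCompact_uIcc hA hη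
  filter_upwards [self_mem_nhdsWithin, mem_nhdsWithin_of_mem_nhds (ball_mem_nhds x hδ)]
    with y hy hyx
  have hgx := intervalIntegrable_of_continuousOn_prod hg hx
  have hgy := intervalIntegrable_of_continuousOn_prod hg hy
  have hAx := intervalIntegrable_of_continuousOn_prod hA hx
  have hAxy : IntervalIntegrable (fun s => A (x, s) (y - x)) volume a b :=
    intervalIntegrable_of_continuousOn_prod (g := fun z => A z (y - x))
      (hA.clm_apply continuousOn_const) hx
  have pointwise (s : ℝ) (hs : s ∈ uIcc a b) :
      ‖g (y, s) - g (x, s) - A (x, s) (y - x)‖ ≤ η * ‖y - x‖ :=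
    (hconv.inter (convex_ball x δ)).norm_image_sub_le_of_norm_hasFDerivWithin_le'
      (f := fun y => g (y, s)) (f' := fun z => A (z, s))
      (fun z hz => (hgA z hz.1 s hs).mono inter_subset_left)
      (fun z hz => (hAδ x hx z hz.1 hz.2 s hs).le) ⟨hx, mem_ball_self hδ⟩ ⟨hy, hyx⟩
  rw [ContinuousLinearMap.intervalIntegral_apply hAx, ← intervalIntegral.integral_sub hgy hgx,
    ← intervalIntegral.integral_sub (hgy.sub hgx) hAxy]
  calc _ ≤ η * ‖y - x‖ * |b - a| := norm_intervalIntegral_le_of_uIcc pointwise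
    _ = η * |b - a| * ‖y - x‖ := by ring
    _ ≤ ε * ‖y - x‖ := by gcongr

lemma UnifContDiffOn.exists_norm_parametric_integral_le {n : ℕ} {S : Set E} {g : I → E × ℝ → F}
    (hg : UnifContDiffOn n g (S ×ˢ uIcc a b)) :
    ∃ C : ℝ, ∀ i, ∀ x ∈ S, ‖∫ s in a..b, g i (x, s)‖ ≤ C := by
  obtain ⟨C, -, hC⟩ := hg.exists_norm_le
  exact ⟨C * |b - a|, fun i x hx =>
    norm_intervalIntegral_le_of_uIcc fun s hs => hC i _ ⟨hx, hs⟩⟩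

lemma UnifContDiffOn.parametric_integral {n : ℕ} {E F : Type u} [NormedAddCommGroup E]
    [NormedSpace ℝ E] [NormedAddCommGroup F] [NormedSpace ℝ F] {S : Set E}
    (hS : IsCompact S) (hconv : Convex ℝ S) (hSu : UniqueDiffOn ℝ S) (hab : a ≠ b)
    {g : I → E × ℝ → F} (hg : UnifContDiffOn n g (S ×ˢ uIcc a b)) :
    UnifContDiffOn n (fun i x => ∫ s in a..b, g i (x, s)) S := by
  have hprod : UniqueDiffOn ℝ (S ×ˢ uIcc a b) := hSu.prod (uniqueDiffOn_Icc (inf_lt_sup.2 hab))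
  induction n generalizing F with
  | zero =>
    obtain ⟨C, hC⟩ := hg.exists_norm_parametric_integral_le
    exact zero_of_continuousOn
      (fun i => continuousOn_intervalIntegral_of_continuousOn_prod hS (hg.continuousOn i)) hC
  | succ n ih =>
    obtain ⟨C, hC⟩ := hg.exists_norm_parametric_integral_le
    obtain ⟨-, hdiff, hD⟩ := (succ_iff hprod).1 hg
    have hpartial := hD.continuousLinearMap_comp
      ((ContinuousLinearMap.inl ℝ E ℝ).precomp F) hprod
    refine of_hasFDerivWithinAt hSu hC
      (fun i x hx => hasFDerivWithinAt_intervalIntegral_of_continuousOn_prod hS hconv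
        (hg.continuousOn i) (hpartial.continuousOn i) (fun y hy s hs => ?_) hx) (ih hpartial)
    exact (hdiff i (y, s) ⟨hy, hs⟩).hasFDerivWithinAt.comp (f := fun y : E => (y, s)) y
      ((hasFDerivWithinAt_id y S).prodMk (hasFDerivWithinAt_const s y S)) fun z hz => ⟨hz, hs⟩

end ParametricIntegral

section InverseFamily

variable {I E F : Type*} [NormedAddCommGroup E] [NormedSpace ℝ E]
  [NormedAddCommGroup F] [NormedSpace ℝ F]

lemma continuousOn_of_invOn_of_isCompact {X Y : Type*} [TopologicalSpace X] [TopologicalSpace Y]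
    [T2Space Y] {s : Set X} {t : Set Y} (hs : IsCompact s) {f : X → Y} {g : Y → X}
    (hf : ContinuousOn f s) (hfst : MapsTo f s t) (hgts : MapsTo g t s) (hgf : InvOn g f s t) :
    ContinuousOn g t := by
  have : CompactSpace s := isCompact_iff_compactSpace.1 hs
  let e : s ≃ t :=
    { toFun := hfst.restrict f s t
      invFun := hgts.restrict g t s
      left_inv := fun x => Subtype.ext (hgf.1 x.2)
      right_inv := fun y => Subtype.ext (hgf.2 y.2) }
  have he : Continuous e := hf.mapsToRestrict hfst
  rw [continuousOn_iff_continuous_domRestrict]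
  exact continuous_subtype_val.comp he.homeoOfEquivCompactToT2.symm.continuous

lemma UnifContDiffOn.clm_inverse [FiniteDimensional ℝ E] {n : ℕ} {s : Set F}
    {A : I → F → E →L[ℝ] E} (hA : UnifContDiffOn n A s) (hs : UniqueDiffOn ℝ s) {c : ℝ}
    (hc : 0 < c) (hdet : ∀ i, ∀ x ∈ s, c ≤ |(A i x).det|) :
    UnifContDiffOn n (fun i x => (A i x).inverse) s := by
  have : CompleteSpace E := FiniteDimensional.complete ℝ E
  have : ProperSpace (E →L[ℝ] E) := FiniteDimensional.proper_real _
  obtain ⟨C, -, hC⟩ := hA.exists_norm_le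
  have hcont : Continuous fun B : E →L[ℝ] E => B.det := ContinuousLinearMap.continuous_det
  refine contDiffOn_comp (t := {B | B.det ≠ 0})
    (K := closedBall 0 C ∩ {B : E →L[ℝ] E | c ≤ |B.det|}) (fun B hB => ?_)
    (isOpen_ne.preimage hcont).uniqueDiffOn
    ((isCompact_closedBall _ _).inter_right (isClosed_le continuous_const hcont.abs))
    (fun B hB => abs_pos.1 (hc.trans_le hB.2)) hA hs
    (fun i x hx => ⟨by simpa using hC i x hx, hdet i x hx⟩)
  exact (contDiffAt_map_inverse (𝕜 := ℝ)
    (B.toContinuousLinearEquivOfDetNeZero hB)).contDiffWithinAt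

lemma hasFDerivWithinAt_inverse_of_det_ne_zero [FiniteDimensional ℝ E] {s : Set E}
    {Φ Ψ : E → E} {A : E →L[ℝ] E} {x : E} (hx : x ∈ s) (hΨs : MapsTo Ψ s s)
    (hΨ : ContinuousWithinAt Ψ s x) (hright : RightInvOn Ψ Φ s)
    (hΦ : HasFDerivWithinAt Φ A s (Ψ x)) (hdet : A.det ≠ 0) :
    HasFDerivWithinAt Ψ A.inverse s x := by
  have : CompleteSpace E := FiniteDimensional.complete ℝ E
  have hA : A = (A.toContinuousLinearEquivOfDetNeZero hdet : E →L[ℝ] E) := rfl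
  rw [hA] at hΦ ⊢
  rw [ContinuousLinearMap.inverse_equiv]
  exact HasFDerivWithinAt.of_local_left_inverse (hΨ.tendsto_nhdsWithin hΨs) hΦ hx
    (eventually_of_mem self_mem_nhdsWithin hright)

/- The derivative of `Ψ` is the inverse of `Φ'` composed with `Ψ`, so each order of smoothness of
`Ψ` gives the next one. -/
lemma UnifContDiffOn.inverse [FiniteDimensional ℝ E] {s : Set E} (hs : IsCompact s)
    (hsu : UniqueDiffOn ℝ s) {Φ Ψ : I → E → E} {n : ℕ} (hΦ : UnifContDiffOn n Φ s)
    (hΦs : ∀ i, MapsTo (Φ i) s s) (hΨs : ∀ i, MapsTo (Ψ i) s s)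
    (hinv : ∀ i, InvOn (Ψ i) (Φ i) s s) {c : ℝ} (hc : 0 < c)
    (hdet : ∀ i, ∀ x ∈ s, c ≤ |(fderivWithin ℝ (Φ i) s x).det|) :
    UnifContDiffOn n Ψ s := by
  have hcont (i : I) : ContinuousOn (Ψ i) s :=
    continuousOn_of_invOn_of_isCompact hs (hΦ.continuousOn i) (hΦs i) (hΨs i) (hinv i)
  obtain ⟨C, hC⟩ := hs.exists_bound_of_continuousOn (f := fun x : E => x) continuousOn_id
  have hΨC (i : I) (x : E) (hx : x ∈ s) : ‖Ψ i x‖ ≤ C := hC _ (hΨs i hx)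
  induction n with
  | zero => exact zero_of_continuousOn hcont hΨC
  | succ n ih =>
    have hΨn := ih (hΦ.of_le n.le_succ)
    obtain ⟨-, hdiff, hD⟩ := (succ_iff hsu).1 hΦ
    refine of_hasFDerivWithinAt hsu hΨC (fun i x hx => ?_)
      ((hD.comp hsu hΨn hsu hΨs).clm_inverse hsu hc fun i x hx => hdet i _ (hΨs i hx))
    exact hasFDerivWithinAt_inverse_of_det_ne_zero hx (hΨs i) (hcont i x hx) (hinv i).2
      (hdiff i _ (hΨs i hx)).hasFDerivWithinAt
      (abs_pos.1 (hc.trans_le (hdet i _ (hΨs i hx))))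

end InverseFamily

section Cube

variable {n : ℕ}

lemma uniqueDiffOn_cube : UniqueDiffOn ℝ (Icc (0 : Fin n → ℝ) 1) := by
  rw [← pi_univ_Icc]
  exact UniqueDiffOn.univ_pi fun _ => uniqueDiffOn_Icc_zero_one

lemma update_mem_cube {x : Fin n → ℝ} (hx : x ∈ Icc (0 : Fin n → ℝ) 1) (j : Fin n) {b : ℝ}
    (hb : b ∈ Icc (0 : ℝ) 1) : Function.update x j b ∈ Icc (0 : Fin n → ℝ) 1 := by
  rw [← pi_univ_Icc] at hx ⊢
  rw [update_mem_pi_iff_of_mem hx]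
  exact fun _ => hb

lemma apply_mem_Icc_of_mem_cube {x : Fin n → ℝ} (hx : x ∈ Icc (0 : Fin n → ℝ) 1) (j : Fin n) :
    x j ∈ Icc (0 : ℝ) 1 := ⟨hx.1 j, hx.2 j⟩

lemma det_eq_prod_of_upperTriangular (A : (Fin n → ℝ) →L[ℝ] Fin n → ℝ)
    (hA : ∀ j l, l < j → A (Pi.single l 1) j = 0) : A.det = ∏ j, A (Pi.single j 1) j := by
  rw [ContinuousLinearMap.det, ← LinearMap.det_toMatrix', Matrix.det_of_isUpperTriangular]
  · simp [LinearMap.toMatrix'_apply]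
  · intro j l hlj
    simpa [LinearMap.toMatrix'_apply] using hA j l hlj

lemma hasDerivWithinAt_update_of_hasFDerivWithinAt_cube {φ : (Fin n → ℝ) → Fin n → ℝ}
    {A : (Fin n → ℝ) →L[ℝ] Fin n → ℝ} {x : Fin n → ℝ} (hx : x ∈ Icc (0 : Fin n → ℝ) 1)
    (h : HasFDerivWithinAt φ A (Icc 0 1) x) (l j : Fin n) :
    HasDerivWithinAt (fun b => φ (Function.update x l b) j) (A (Pi.single l 1) j)
      (Icc 0 1) (x l) := by
  have hupdate : HasDerivWithinAt (fun b => Function.update x l b) (Pi.single l 1)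
      (Icc 0 1) (x l) := (hasDerivAt_update x l (x l)).hasDerivWithinAt
  have hφ : HasFDerivWithinAt φ A (Icc 0 1) (Function.update x l (x l)) := by
    rwa [Function.update_eq_self]
  exact hasDerivWithinAt_pi.1
    (hφ.comp_hasDerivWithinAt (x l) hupdate fun b hb => update_mem_cube hx l hb) j

end Cube

/-- A map of the cube `[0,1]^n` that is upper triangular (the `j`-th component depends on the
coordinates `l ≥ j` only), increases in the diagonal variables with slope at least `c`, and
preserves the faces of the cube. -/
structure IsMonotoneTriangular {n : ℕ} (c : ℝ) (φ : (Fin n → ℝ) → Fin n → ℝ) : Prop where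
  dep : ∀ x ∈ Icc (0 : Fin n → ℝ) 1, ∀ y ∈ Icc (0 : Fin n → ℝ) 1, ∀ j,
    (∀ l, j ≤ l → x l = y l) → φ x j = φ y j
  mono : ∀ x ∈ Icc (0 : Fin n → ℝ) 1, ∀ j, ∀ b ∈ Icc (x j) 1,
    c * (b - x j) ≤ φ (Function.update x j b) j - φ x j
  face_zero : ∀ x ∈ Icc (0 : Fin n → ℝ) 1, ∀ j, x j = 0 → φ x j = 0
  face_one : ∀ x ∈ Icc (0 : Fin n → ℝ) 1, ∀ j, x j = 1 → φ x j = 1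

namespace IsMonotoneTriangular

variable {n : ℕ} {c : ℝ} {φ ψ : (Fin n → ℝ) → Fin n → ℝ} {x y : Fin n → ℝ} {j : Fin n}

lemma mapsTo (h : IsMonotoneTriangular c φ) (hc : 0 ≤ c) : MapsTo φ (Icc 0 1) (Icc 0 1) := by
  intro x hx
  rw [mem_Icc, Pi.le_def, Pi.le_def, ← forall_and]
  intro j
  have hxj := apply_mem_Icc_of_mem_cube hx j
  have hx₀ := update_mem_cube hx j (left_mem_Icc.2 zero_le_one)
  have hx₁ := update_mem_cube hx j (right_mem_Icc.2 zero_le_one)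
  have hlow := h.mono _ hx₀ j (x j) (by simpa using hxj)
  have hhigh := h.mono x hx j 1 ⟨hxj.2, le_rfl⟩
  rw [Function.update_idem, Function.update_eq_self, h.face_zero _ hx₀ j (by simp),
    Function.update_self] at hlow
  rw [h.face_one _ hx₁ j (by simp)] at hhigh
  have := mul_nonneg hc hxj.1
  have := mul_nonneg hc (sub_nonneg.2 hxj.2)
  simp only [Pi.zero_apply, Pi.one_apply]
  constructor <;> linarith

lemma apply_eq_apply_update (h : IsMonotoneTriangular c φ) (hx : x ∈ Icc (0 : Fin n → ℝ) 1)
    (hy : y ∈ Icc (0 : Fin n → ℝ) 1) (hxy : ∀ l, j < l → x l = y l) :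
    φ y j = φ (Function.update x j (y j)) j := by
  refine h.dep _ hy _ (update_mem_cube hx j (apply_mem_Icc_of_mem_cube hy j)) j fun l hl => ?_
  rcases hl.eq_or_lt with rfl | hl
  · simp
  · rw [Function.update_of_ne hl.ne', hxy l hl]

lemma le_of_apply_le (h : IsMonotoneTriangular c φ) (hc : 0 < c)
    (hx : x ∈ Icc (0 : Fin n → ℝ) 1) (hy : y ∈ Icc (0 : Fin n → ℝ) 1)
    (hxy : ∀ l, j < l → x l = y l) (hle : φ x j ≤ φ y j) : x j ≤ y j := by
  by_contra! hlt
  have hinc := h.mono y hy j (x j) ⟨hlt.le, (apply_mem_Icc_of_mem_cube hx j).2⟩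
  rw [← h.apply_eq_apply_update hy hx fun l hl => (hxy l hl).symm] at hinc
  linarith [mul_pos hc (sub_pos.2 hlt)]

lemma apply_eq_zero_iff (h : IsMonotoneTriangular c φ) (hc : 0 < c)
    (hx : x ∈ Icc (0 : Fin n → ℝ) 1) : φ x j = 0 ↔ x j = 0 := by
  refine ⟨fun hφ => le_antisymm ?_ (hx.1 j), h.face_zero x hx j⟩
  have hx₀ := update_mem_cube hx j (left_mem_Icc.2 zero_le_one)
  simpa using h.le_of_apply_le (y := Function.update x j 0) hc hx hx₀
    (fun l hl => (Function.update_of_ne hl.ne' _ _).symm)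
    (by rw [hφ, h.face_zero _ hx₀ j (by simp)])

lemma apply_eq_one_iff (h : IsMonotoneTriangular c φ) (hc : 0 < c)
    (hx : x ∈ Icc (0 : Fin n → ℝ) 1) : φ x j = 1 ↔ x j = 1 := by
  refine ⟨fun hφ => le_antisymm (hx.2 j) ?_, h.face_one x hx j⟩
  have hx₁ := update_mem_cube hx j (right_mem_Icc.2 zero_le_one)
  simpa using h.le_of_apply_le (x := Function.update x j 1) hc hx₁ hx
    (fun l hl => Function.update_of_ne hl.ne' _ _)
    (by rw [hφ, h.face_one _ hx₁ j (by simp)])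

lemma eq_of_apply_eq (h : IsMonotoneTriangular c φ) (hc : 0 < c)
    (hx : x ∈ Icc (0 : Fin n → ℝ) 1) (hy : y ∈ Icc (0 : Fin n → ℝ) 1)
    (hxy : ∀ l, j ≤ l → φ x l = φ y l) (l : Fin n) (hl : j ≤ l) : x l = y l := by
  have habove : ∀ m, l < m → x m = y m := fun m hm =>
    h.eq_of_apply_eq hc hx hy hxy m (hl.trans hm.le)
  exact le_antisymm (h.le_of_apply_le hc hx hy habove (hxy l hl).le)
    (h.le_of_apply_le hc hy hx (fun m hm => (habove m hm).symm) (hxy l hl).ge)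
termination_by n - l.val

lemma injOn (h : IsMonotoneTriangular c φ) (hc : 0 < c) : InjOn φ (Icc 0 1) :=
  fun _ hx _ hy hxy => funext fun l =>
    h.eq_of_apply_eq hc hx hy (fun m _ => congrFun hxy m) l le_rfl

lemma exists_update_apply_eq (h : IsMonotoneTriangular c φ) (hφ : ContinuousOn φ (Icc 0 1))
    (hx : x ∈ Icc (0 : Fin n → ℝ) 1) (j : Fin n) {r : ℝ} (hr : r ∈ Icc (0 : ℝ) 1) :
    ∃ b ∈ Icc (0 : ℝ) 1, φ (Function.update x j b) j = r := by
  have hcont : ContinuousOn (fun b => φ (Function.update x j b) j) (Icc 0 1) :=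
    (continuous_apply j).comp_continuousOn
      (hφ.comp (by fun_prop) fun b hb => update_mem_cube hx j hb)
  have hivt := intermediate_value_Icc zero_le_one hcont
  rw [h.face_zero _ (update_mem_cube hx j (left_mem_Icc.2 zero_le_one)) j (by simp),
    h.face_one _ (update_mem_cube hx j (right_mem_Icc.2 zero_le_one)) j (by simp)] at hivt
  exact hivt hr

lemma surjOn (h : IsMonotoneTriangular c φ) (hφ : ContinuousOn φ (Icc 0 1)) :
    SurjOn φ (Icc 0 1) (Icc 0 1) := by
  intro y hy
  suffices hlast : ∀ p ≤ n, ∃ x ∈ Icc (0 : Fin n → ℝ) 1, ∀ l : Fin n, n ≤ p + l → φ x l = y l by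
    obtain ⟨x, hx, hl⟩ := hlast n le_rfl
    exact ⟨x, hx, funext fun l => hl l (by omega)⟩
  intro p
  induction p with
  | zero => exact fun _ => ⟨0, left_mem_Icc.2 zero_le_one, fun l hl => by omega⟩
  | succ p ih =>
    intro hp
    obtain ⟨x, hx, hl⟩ := ih (by omega)
    obtain ⟨j, hj⟩ : ∃ j : Fin n, (j : ℕ) = n - (p + 1) := ⟨⟨n - (p + 1), by omega⟩, rfl⟩
    obtain ⟨b, hb, hbj⟩ := h.exists_update_apply_eq hφ hx j (apply_mem_Icc_of_mem_cube hy j)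
    refine ⟨Function.update x j b, update_mem_cube hx j hb, fun l hl' => ?_⟩
    rcases eq_or_ne l j with rfl | hlj
    · exact hbj
    · have hjl : j < l := Fin.lt_def.2 (by have := Fin.val_ne_of_ne hlj; omega)
      rw [← hl l (by have := Fin.lt_def.1 hjl; omega)]
      exact h.dep _ (update_mem_cube hx j hb) x hx l fun m hm =>
        Function.update_of_ne (hjl.trans_le hm).ne' _ _

lemma abs_apply_sub_le (h : IsMonotoneTriangular c φ) {L : ℝ}
    (hL : ∀ x ∈ Icc (0 : Fin n → ℝ) 1, ∀ y ∈ Icc (0 : Fin n → ℝ) 1, ‖φ x - φ y‖ ≤ L * ‖x - y‖)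
    (hx : x ∈ Icc (0 : Fin n → ℝ) 1) (hy : y ∈ Icc (0 : Fin n → ℝ) 1)
    (hxy : ∀ l, j < l → x l = y l) : |φ y j - φ x j| ≤ L * |y j - x j| := by
  have hnorm : ‖Function.update x j (y j) - x‖ = |y j - x j| := by
    have hsingle : Function.update x j (y j) - x = Pi.single j (y j - x j) := by
      ext l
      rcases eq_or_ne l j with rfl | hl <;> simp [*]
    rw [hsingle, Pi.norm_single, Real.norm_eq_abs]
  rw [h.apply_eq_apply_update hx hy hxy, ← hnorm]
  exact (norm_le_pi_norm (φ (Function.update x j (y j)) - φ x) j).trans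
    (hL _ (update_mem_cube hx j (apply_mem_Icc_of_mem_cube hy j)) x hx)

lemma inverse (h : IsMonotoneTriangular c φ) (hc : 0 < c) {L : ℝ} (hL₀ : 0 < L)
    (hL : ∀ x ∈ Icc (0 : Fin n → ℝ) 1, ∀ y ∈ Icc (0 : Fin n → ℝ) 1, ‖φ x - φ y‖ ≤ L * ‖x - y‖)
    (hψ : MapsTo ψ (Icc 0 1) (Icc 0 1)) (hinv : RightInvOn ψ φ (Icc 0 1)) :
    IsMonotoneTriangular L⁻¹ ψ := by
  have hdep : ∀ x ∈ Icc (0 : Fin n → ℝ) 1, ∀ y ∈ Icc (0 : Fin n → ℝ) 1, ∀ j,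
      (∀ l, j ≤ l → x l = y l) → ψ x j = ψ y j := fun x hx y hy j hxy =>
    h.eq_of_apply_eq hc (hψ hx) (hψ hy) (fun l hl => by rw [hinv hx, hinv hy, hxy l hl]) j le_rfl
  refine ⟨hdep, fun y hy j b hb => ?_, fun y hy j hyj => ?_, fun y hy j hyj => ?_⟩
  · have hy' := update_mem_cube hy j ⟨(apply_mem_Icc_of_mem_cube hy j).1.trans hb.1, hb.2⟩
    have hagree : ∀ l, j < l → ψ y l = ψ (Function.update y j b) l := fun l hl =>
      hdep y hy _ hy' l fun m hm => (Function.update_of_ne (hl.trans_le hm).ne' _ _).symm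
    have hφ : φ (ψ (Function.update y j b)) j - φ (ψ y) j = b - y j := by
      rw [hinv hy, hinv hy', Function.update_self]
    have hle := h.le_of_apply_le hc (hψ hy) (hψ hy') hagree (by linarith [hb.1])
    have hlip := h.abs_apply_sub_le hL (hψ hy) (hψ hy') hagree
    rw [hφ, abs_of_nonneg (sub_nonneg.2 hle)] at hlip
    exact (inv_mul_le_iff₀ hL₀).2 ((le_abs_self _).trans hlip)
  · rwa [← h.apply_eq_zero_iff hc (hψ hy), hinv hy]
  · rwa [← h.apply_eq_one_iff hc (hψ hy), hinv hy]

lemma fderivWithin_lower_eq_zero (h : IsMonotoneTriangular c φ) (hx : x ∈ Icc (0 : Fin n → ℝ) 1)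
    {A : (Fin n → ℝ) →L[ℝ] Fin n → ℝ} (hA : HasFDerivWithinAt φ A (Icc 0 1) x) {l : Fin n}
    (hlj : l < j) : A (Pi.single l 1) j = 0 := by
  have hconst : HasDerivWithinAt (fun b => φ (Function.update x l b) j) 0 (Icc 0 1) (x l) := by
    refine (hasDerivWithinAt_const (x l) _ (φ x j)).congr (fun b hb => ?_) ?_
    · exact h.dep _ (update_mem_cube hx l hb) _ hx j fun m hm =>
        Function.update_of_ne (hlj.trans_le hm).ne' _ _
    · rw [Function.update_eq_self]
  exact (uniqueDiffOn_Icc_zero_one _ (apply_mem_Icc_of_mem_cube hx l)).eq_deriv _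
    (hasDerivWithinAt_update_of_hasFDerivWithinAt_cube hx hA l j) hconst

lemma le_fderivWithin_diag (h : IsMonotoneTriangular c φ) (hx : x ∈ Icc (0 : Fin n → ℝ) 1)
    {A : (Fin n → ℝ) →L[ℝ] Fin n → ℝ} (hA : HasFDerivWithinAt φ A (Icc 0 1) x) (j : Fin n) :
    c ≤ A (Pi.single j 1) j := by
  have hderiv := (hasDerivWithinAt_update_of_hasFDerivWithinAt_cube hx hA j j).sub
    ((hasDerivWithinAt_id (x j) (Icc 0 1)).const_mul c)
  have hmono : MonotoneOn ((fun b => φ (Function.update x j b) j) - fun b => c * id b)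
      (Icc 0 1) := by
    intro a ha b hb hab
    have := h.mono _ (update_mem_cube hx j ha) j b (by simpa using ⟨hab, hb.2⟩)
    rw [Function.update_idem] at this
    simp only [Function.update_self, Pi.sub_apply, id] at this ⊢
    linarith
  have hnonneg := hmono.derivWithin_nonneg (x := x j)
  rw [hderiv.derivWithin (uniqueDiffOn_Icc_zero_one _ (apply_mem_Icc_of_mem_cube hx j))] at hnonneg
  linarith

lemma pow_le_det (h : IsMonotoneTriangular c φ) (hc : 0 ≤ c) (hx : x ∈ Icc (0 : Fin n → ℝ) 1)
    {A : (Fin n → ℝ) →L[ℝ] Fin n → ℝ} (hA : HasFDerivWithinAt φ A (Icc 0 1) x) :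
    c ^ n ≤ A.det := by
  rw [det_eq_prod_of_upperTriangular _ fun j l hlj => h.fderivWithin_lower_eq_zero hx hA hlj]
  calc c ^ n = ∏ _j : Fin n, c := by simp
    _ ≤ _ := Finset.prod_le_prod (fun _ _ => hc) fun j _ => h.le_fderivWithin_diag hx hA j

end IsMonotoneTriangular

/-- A family of monotone triangular maps of the cube, uniform both in its `C^k` bounds and in its
monotonicity constant. -/
structure TriangularFamily {I : Type*} (k n : ℕ) (Φ : I → (Fin n → ℝ) → Fin n → ℝ) : Prop where
  unifContDiffOn : UnifContDiffOn k Φ (Icc 0 1)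
  isMonotoneTriangular : ∃ c > 0, ∀ i, IsMonotoneTriangular c (Φ i)

namespace TriangularFamily

variable {I : Type*} {k n : ℕ} {Φ : I → (Fin n → ℝ) → Fin n → ℝ} {x : Fin n → ℝ}

lemma mapsTo (h : TriangularFamily k n Φ) (i : I) : MapsTo (Φ i) (Icc 0 1) (Icc 0 1) :=
  let ⟨_, hc, hΦ⟩ := h.isMonotoneTriangular
  (hΦ i).mapsTo (le_of_lt hc)

lemma injOn (h : TriangularFamily k n Φ) (i : I) : InjOn (Φ i) (Icc 0 1) :=
  let ⟨_, hc, hΦ⟩ := h.isMonotoneTriangular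
  (hΦ i).injOn hc

lemma surjOn (h : TriangularFamily k n Φ) (i : I) : SurjOn (Φ i) (Icc 0 1) (Icc 0 1) :=
  let ⟨_, _, hΦ⟩ := h.isMonotoneTriangular
  (hΦ i).surjOn (h.unifContDiffOn.continuousOn i)

lemma comp_index {J : Type*} (h : TriangularFamily k n Φ) (σ : J → I) :
    TriangularFamily k n (fun j => Φ (σ j)) :=
  let ⟨c, hc, hΦ⟩ := h.isMonotoneTriangular
  ⟨h.unifContDiffOn.comp_index σ, c, hc, fun j => hΦ (σ j)⟩

lemma hasFDerivWithinAt (h : TriangularFamily k n Φ) (hk : 1 ≤ k) (i : I)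
    (hx : x ∈ Icc (0 : Fin n → ℝ) 1) :
    HasFDerivWithinAt (Φ i) (fderivWithin ℝ (Φ i) (Icc 0 1) x) (Icc 0 1) x :=
  let ⟨_, hC⟩ := h.unifContDiffOn
  (hC i).hasFDerivWithinAt hk hx

lemma exists_le_det (h : TriangularFamily k n Φ) (hk : 1 ≤ k) :
    ∃ c : ℝ, 0 < c ∧ ∀ i, ∀ x ∈ Icc (0 : Fin n → ℝ) 1,
      c ≤ |(fderivWithin ℝ (Φ i) (Icc 0 1) x).det| :=
  let ⟨c, hc, hΦ⟩ := h.isMonotoneTriangular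
  ⟨c ^ n, pow_pos hc n, fun i _ hx =>
    ((hΦ i).pow_le_det (le_of_lt hc) hx (h.hasFDerivWithinAt hk i hx)).trans (le_abs_self _)⟩

/-- The family of inverses on the cube (junk outside the cube). -/
def inv (Φ : I → (Fin n → ℝ) → Fin n → ℝ) (i : I) : (Fin n → ℝ) → Fin n → ℝ :=
  Function.invFunOn (Φ i) (Icc 0 1)

lemma mapsTo_inv (h : TriangularFamily k n Φ) (i : I) : MapsTo (inv Φ i) (Icc 0 1) (Icc 0 1) :=
  (h.surjOn i).mapsTo_invFunOn

lemma invOn_inv (h : TriangularFamily k n Φ) (i : I) : InvOn (inv Φ i) (Φ i) (Icc 0 1) (Icc 0 1) :=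
  ⟨(h.injOn i).leftInvOn_invFunOn, (h.surjOn i).rightInvOn_invFunOn⟩

lemma inverse (h : TriangularFamily k n Φ) (hk : 1 ≤ k) : TriangularFamily k n (inv Φ) := by
  obtain ⟨δ, hδ, hdet⟩ := h.exists_le_det hk
  obtain ⟨c, hc, hΦ⟩ := h.isMonotoneTriangular
  obtain ⟨L, hL₀, hL⟩ :=
    h.unifContDiffOn.exists_lipschitz hk uniqueDiffOn_cube (convex_Icc 0 1)
  refine ⟨UnifContDiffOn.inverse isCompact_Icc uniqueDiffOn_cube h.unifContDiffOn h.mapsTo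
    h.mapsTo_inv h.invOn_inv hδ hdet, (L + 1)⁻¹, by positivity, fun i => ?_⟩
  refine (hΦ i).inverse hc (by positivity) (fun x hx y hy => (hL i x hx y hy).trans ?_)
    (h.mapsTo_inv i) (h.invOn_inv i).2
  gcongr
  linarith

end TriangularFamily

section KnotheRosenblatt

variable {I : Type*} {n k : ℕ}

/-- The measure on the cube `[0,1]^n` with Lebesgue density `q`. -/
def cubeMeasure (q : (Fin n → ℝ) → ℝ) : Measure (Fin n → ℝ) :=
  (volume.restrict (Icc 0 1)).withDensity fun x => ENNReal.ofReal (q x)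

/-- The density `q` with the coordinates `l < j` integrated out over `[0,1]`. -/
def tailMarginal (q : (Fin n → ℝ) → ℝ) : ℕ → (Fin n → ℝ) → ℝ
  | 0 => q
  | j + 1 => fun x => if h : j < n then
      ∫ s in (0 : ℝ)..1, tailMarginal q j (Function.update x ⟨j, h⟩ s) else tailMarginal q j x

/-- The Knothe–Rosenblatt map of a density `q` on the cube to the uniform density: its `j`-th
component is the conditional distribution function of the `j`-th coordinate given the later ones.
The integral over `[0, x j]` is rescaled to `[0, 1]`, which makes the smoothness in `x` that of a
parametric integral with fixed bounds. -/
def knotheMap (q : (Fin n → ℝ) → ℝ) (x : Fin n → ℝ) : Fin n → ℝ := fun j =>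
  x j * (∫ s in (0 : ℝ)..1, tailMarginal q j (Function.update x j (s * x j))) *
    (tailMarginal q (j + 1) x)⁻¹

lemma tailMarginal_succ (q : (Fin n → ℝ) → ℝ) (j : Fin n) (x : Fin n → ℝ) :
    tailMarginal q (j + 1) x = ∫ s in (0 : ℝ)..1, tailMarginal q j (Function.update x j s) := by
  simp [tailMarginal]

lemma tailMarginal_succ_of_le (q : (Fin n → ℝ) → ℝ) {j : ℕ} (hj : n ≤ j) :
    tailMarginal q (j + 1) = tailMarginal q j := by
  simp only [tailMarginal, hj.not_gt, dif_neg, not_false_eq_true]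

lemma tailMarginal_congr (q : (Fin n → ℝ) → ℝ) (j : ℕ) {x y : Fin n → ℝ}
    (hxy : ∀ l : Fin n, j ≤ l → x l = y l) : tailMarginal q j x = tailMarginal q j y := by
  induction j generalizing x y with
  | zero => rw [funext fun l => hxy l (Nat.zero_le _)]
  | succ j ih =>
    by_cases hj : j < n
    · rw [tailMarginal_succ q ⟨j, hj⟩ x, tailMarginal_succ q ⟨j, hj⟩ y]
      refine intervalIntegral.integral_congr fun s _ => ih fun l hl => ?_
      rcases eq_or_ne l ⟨j, hj⟩ with rfl | hlj
      · simp
      · rw [Function.update_of_ne hlj, Function.update_of_ne hlj]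
        exact hxy l (hl.lt_of_ne fun h => hlj (Fin.ext h.symm))
    · rw [tailMarginal_succ_of_le q (not_lt.1 hj)]
      exact ih fun l _ => absurd l.2 (by omega)

lemma knotheMap_eq_integral (q : (Fin n → ℝ) → ℝ) (x : Fin n → ℝ) (j : Fin n) :
    knotheMap q x j = (∫ s in (0 : ℝ)..x j, tailMarginal q j (Function.update x j s)) *
      (tailMarginal q (j + 1) x)⁻¹ := by
  rw [knotheMap, intervalIntegral.mul_integral_comp_mul_right
    (f := fun s => tailMarginal q j (Function.update x j s))]
  simp

lemma knotheMap_update (q : (Fin n → ℝ) → ℝ) (x : Fin n → ℝ) (j : Fin n) (b : ℝ) :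
    knotheMap q (Function.update x j b) j =
      (∫ s in (0 : ℝ)..b, tailMarginal q j (Function.update x j s)) *
      (tailMarginal q (j + 1) x)⁻¹ := by
  rw [knotheMap_eq_integral]
  simp only [Function.update_self, Function.update_idem]
  congr 2
  exact tailMarginal_congr q _ fun l hl =>
    Function.update_of_ne (fun h => by rw [h] at hl; omega) _ _

lemma contDiff_update_prod (j : Fin n) :
    ContDiff ℝ k fun z : (Fin n → ℝ) × ℝ => Function.update z.1 j z.2 := by
  rw [contDiff_pi]
  intro l
  rcases eq_or_ne l j with rfl | hl
  · simp only [Function.update_self]; fun_prop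
  · simp only [Function.update_of_ne hl]; fun_prop

lemma UnifContDiffOn.integral_update {p : I → (Fin n → ℝ) → ℝ}
    (hp : UnifContDiffOn k p (Icc 0 1)) (j : Fin n) {a : (Fin n → ℝ) × ℝ → ℝ}
    (ha : ContDiff ℝ k a)
    (hmaps : MapsTo a (Icc (0 : Fin n → ℝ) 1 ×ˢ Icc (0 : ℝ) 1) (Icc 0 1)) :
    UnifContDiffOn k (fun i x => ∫ s in (0 : ℝ)..1, p i (Function.update x j (a (x, s))))
      (Icc 0 1) := by
  have huniq : UniqueDiffOn ℝ (Icc (0 : Fin n → ℝ) 1 ×ˢ Icc (0 : ℝ) 1) :=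
    uniqueDiffOn_cube.prod uniqueDiffOn_Icc_zero_one
  have hupdate : UnifContDiffOn (I := I) k
      (fun _ (z : (Fin n → ℝ) × ℝ) => Function.update z.1 j (a z))
      (Icc (0 : Fin n → ℝ) 1 ×ˢ Icc (0 : ℝ) 1) :=
    .of_contDiffOn ((contDiff_update_prod j).comp (contDiff_fst.prodMk ha)).contDiffOn huniq
      (isCompact_Icc.prod isCompact_Icc)
  refine UnifContDiffOn.parametric_integral (g := fun i z => p i (Function.update z.1 j (a z)))
    isCompact_Icc (convex_Icc 0 1) uniqueDiffOn_cube zero_ne_one ?_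
  rw [uIcc_of_le zero_le_one]
  exact hp.comp uniqueDiffOn_cube hupdate huniq fun _ z hz => update_mem_cube hz.1 j (hmaps hz)

lemma UnifContDiffOn.tailMarginal {p : I → (Fin n → ℝ) → ℝ}
    (hp : UnifContDiffOn k p (Icc 0 1)) (j : ℕ) :
    UnifContDiffOn k (fun i => tailMarginal (p i) j) (Icc 0 1) := by
  induction j with
  | zero => exact hp
  | succ j ih =>
    by_cases hj : j < n
    · exact (ih.integral_update ⟨j, hj⟩ (a := fun z => z.2) contDiff_snd
        fun z hz => hz.2).congr fun i x _ => tailMarginal_succ (p i) ⟨j, hj⟩ x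
    · simpa only [tailMarginal_succ_of_le _ (not_lt.1 hj)] using ih

section SingleDensity

variable {q : (Fin n → ℝ) → ℝ} {x : Fin n → ℝ} {c C : ℝ}

lemma continuousOn_tailMarginal (hq : ContinuousOn q (Icc 0 1)) (j : ℕ) :
    ContinuousOn (tailMarginal q j) (Icc 0 1) :=
  ((UnifContDiffOn.of_contDiffOn (I := Unit) (n := 0) (contDiffOn_zero.2 hq) uniqueDiffOn_cube
    isCompact_Icc).tailMarginal j).continuousOn ()

lemma continuousOn_tailMarginal_update (hq : ContinuousOn q (Icc 0 1)) (j : ℕ) (l : Fin n)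
    (hx : x ∈ Icc (0 : Fin n → ℝ) 1) :
    ContinuousOn (fun s => tailMarginal q j (Function.update x l s)) (Icc 0 1) :=
  (continuousOn_tailMarginal hq j).comp (by fun_prop) fun _ hs => update_mem_cube hx l hs

lemma intervalIntegrable_tailMarginal_update (hq : ContinuousOn q (Icc 0 1)) (j : ℕ) (l : Fin n)
    (hx : x ∈ Icc (0 : Fin n → ℝ) 1) {a b : ℝ} (ha : a ∈ Icc (0 : ℝ) 1) (hb : b ∈ Icc (0 : ℝ) 1) :
    IntervalIntegrable (fun s => tailMarginal q j (Function.update x l s)) volume a b :=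
  ((continuousOn_tailMarginal_update hq j l hx).mono (uIcc_subset_Icc ha hb)).intervalIntegrable

lemma tailMarginal_mem_Icc (hq : ContinuousOn q (Icc 0 1))
    (hqc : ∀ x ∈ Icc (0 : Fin n → ℝ) 1, q x ∈ Icc c C) (j : ℕ) (hx : x ∈ Icc (0 : Fin n → ℝ) 1) :
    tailMarginal q j x ∈ Icc c C := by
  induction j generalizing x with
  | zero => exact hqc x hx
  | succ j ih =>
    by_cases hj : j < n
    · have hint := intervalIntegrable_tailMarginal_update hq j ⟨j, hj⟩ hx
        (left_mem_Icc.2 zero_le_one) (right_mem_Icc.2 zero_le_one)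
      have hmem (s : ℝ) (hs : s ∈ Icc (0 : ℝ) 1) := ih (update_mem_cube hx ⟨j, hj⟩ hs)
      rw [tailMarginal_succ q ⟨j, hj⟩ x]
      constructor
      · simpa using intervalIntegral.integral_mono_on zero_le_one
          (intervalIntegrable_const (c := c)) hint fun s hs => (hmem s hs).1
      · simpa using intervalIntegral.integral_mono_on zero_le_one hint
          (intervalIntegrable_const (c := C)) fun s hs => (hmem s hs).2
    · rw [tailMarginal_succ_of_le q (not_lt.1 hj)]
      exact ih hx

lemma tailMarginal_pos (hq : ContinuousOn q (Icc 0 1)) (hc : 0 < c)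
    (hqc : ∀ x ∈ Icc (0 : Fin n → ℝ) 1, q x ∈ Icc c C) (j : ℕ) (hx : x ∈ Icc (0 : Fin n → ℝ) 1) :
    0 < tailMarginal q j x :=
  hc.trans_le (tailMarginal_mem_Icc hq hqc j hx).1

lemma div_mul_sub_le_knotheMap_update_sub (hq : ContinuousOn q (Icc 0 1)) (hc : 0 < c)
    (hqc : ∀ x ∈ Icc (0 : Fin n → ℝ) 1, q x ∈ Icc c C) (hx : x ∈ Icc (0 : Fin n → ℝ) 1)
    (j : Fin n) {b : ℝ} (hb : b ∈ Icc (x j) 1) :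
    c / C * (b - x j) ≤ knotheMap q (Function.update x j b) j - knotheMap q x j := by
  have hxj := apply_mem_Icc_of_mem_cube hx j
  have hb01 : b ∈ Icc (0 : ℝ) 1 := ⟨hxj.1.trans hb.1, hb.2⟩
  have h0 : (0 : ℝ) ∈ Icc (0 : ℝ) 1 := left_mem_Icc.2 zero_le_one
  have hint := intervalIntegral.integral_mono_on hb.1 (intervalIntegrable_const (c := c))
    (intervalIntegrable_tailMarginal_update hq j j hx hxj hb01) fun s hs =>
      (tailMarginal_mem_Icc hq hqc j
        (update_mem_cube hx j ⟨hxj.1.trans hs.1, hs.2.trans hb.2⟩)).1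
  rw [intervalIntegral.integral_const, smul_eq_mul] at hint
  have hpos := tailMarginal_pos hq hc hqc (j + 1) hx
  have hinv : C⁻¹ ≤ (tailMarginal q (j + 1) x)⁻¹ :=
    inv_anti₀ hpos (tailMarginal_mem_Icc hq hqc (j + 1) hx).2
  have hC : 0 ≤ C⁻¹ :=
    inv_nonneg.2 (hpos.le.trans (tailMarginal_mem_Icc hq hqc (j + 1) hx).2)
  have hnonneg : 0 ≤ (b - x j) * c := mul_nonneg (sub_nonneg.2 hb.1) hc.le
  rw [knotheMap_update, knotheMap_eq_integral, ← sub_mul,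
    intervalIntegral.integral_interval_sub_left
      (intervalIntegrable_tailMarginal_update hq j j hx h0 hb01)
      (intervalIntegrable_tailMarginal_update hq j j hx h0 hxj)]
  calc c / C * (b - x j) = (b - x j) * c * C⁻¹ := by ring
    _ ≤ _ := mul_le_mul hint hinv hC (hnonneg.trans hint)

lemma isMonotoneTriangular_knotheMap (hq : ContinuousOn q (Icc 0 1)) (hc : 0 < c)
    (hqc : ∀ x ∈ Icc (0 : Fin n → ℝ) 1, q x ∈ Icc c C) :
    IsMonotoneTriangular (c / C) (knotheMap q) := by
  refine ⟨fun x _ y _ j hxy => ?_,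
    fun x hx j b hb => div_mul_sub_le_knotheMap_update_sub hq hc hqc hx j hb,
    fun x _ j hxj => by simp [knotheMap, hxj], fun x hx j hxj => ?_⟩
  · rw [knotheMap_eq_integral, knotheMap_eq_integral, hxy j le_rfl,
      tailMarginal_congr q (j + 1) (x := x) (y := y) fun l hl => hxy l
        (by rw [Fin.le_def]; omega)]
    congr 1
    refine intervalIntegral.integral_congr fun s _ => tailMarginal_congr q j fun l hl => ?_
    rcases eq_or_ne l j with rfl | hlj
    · simp
    · rw [Function.update_of_ne hlj, Function.update_of_ne hlj]
      exact hxy l hl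
  · rw [knotheMap_eq_integral, hxj, ← tailMarginal_succ]
    exact mul_inv_cancel₀ (tailMarginal_pos hq hc hqc _ hx).ne'

lemma fderivWithin_knotheMap_diag (hq : ContinuousOn q (Icc 0 1))
    (hx : x ∈ Icc (0 : Fin n → ℝ) 1) {A : (Fin n → ℝ) →L[ℝ] Fin n → ℝ}
    (hA : HasFDerivWithinAt (knotheMap q) A (Icc 0 1) x) (j : Fin n) :
    A (Pi.single j 1) j = tailMarginal q j x / tailMarginal q (j + 1) x := by
  have hxj := apply_mem_Icc_of_mem_cube hx j
  have hpartial := hasDerivWithinAt_update_of_hasFDerivWithinAt_cube hx hA j j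
  simp only [knotheMap_update] at hpartial
  have hcont := continuousOn_tailMarginal_update hq j j hx
  have : Fact (x j ∈ Icc (0 : ℝ) 1) := ⟨hxj⟩
  have hftc := (intervalIntegral.integral_hasDerivWithinAt_right (a := 0) (b := x j)
    (s := Icc (0 : ℝ) 1) (t := Icc (0 : ℝ) 1)
    (intervalIntegrable_tailMarginal_update hq j j hx (left_mem_Icc.2 zero_le_one) hxj)
    (hcont.stronglyMeasurableAtFilter_nhdsWithin measurableSet_Icc _)
    (hcont _ hxj)).mul_const (tailMarginal q (j + 1) x)⁻¹
  rw [(uniqueDiffOn_Icc_zero_one _ hxj).eq_deriv _ hpartial hftc, Function.update_eq_self,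
    div_eq_mul_inv]

/- The Jacobian is triangular and its diagonal entries telescope. -/
lemma det_fderivWithin_knotheMap (hq : ContinuousOn q (Icc 0 1)) (hc : 0 < c)
    (hqc : ∀ x ∈ Icc (0 : Fin n → ℝ) 1, q x ∈ Icc c C) (hx : x ∈ Icc (0 : Fin n → ℝ) 1)
    {A : (Fin n → ℝ) →L[ℝ] Fin n → ℝ} (hA : HasFDerivWithinAt (knotheMap q) A (Icc 0 1) x) :
    A.det = q x / tailMarginal q n x := by
  have htelescope : ∀ N, ∏ j ∈ Finset.range N,
      tailMarginal q j x / tailMarginal q (j + 1) x = q x / tailMarginal q N x := by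
    have hne (j : ℕ) : tailMarginal q j x ≠ 0 := (tailMarginal_pos hq hc hqc j hx).ne'
    intro N
    induction N with
    | zero => exact (div_self (hne 0)).symm
    | succ N ih => rw [Finset.prod_range_succ, ih, div_mul_div_cancel₀ (hne N)]
  rw [det_eq_prod_of_upperTriangular _ fun j l hlj =>
    (isMonotoneTriangular_knotheMap hq hc hqc).fderivWithin_lower_eq_zero hx hA hlj]
  simp only [fderivWithin_knotheMap_diag hq hx hA]
  rw [Fin.prod_univ_eq_prod_range (fun j => tailMarginal q j x / tailMarginal q (j + 1) x) n,
    htelescope]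

lemma volume_cube : volume (Icc (0 : Fin n → ℝ) 1) = 1 := by
  simp [Real.volume_Icc_pi]

lemma aemeasurable_cubeMeasure_of_continuousOn {f : (Fin n → ℝ) → Fin n → ℝ}
    (hf : ContinuousOn f (Icc 0 1)) : AEMeasurable f (cubeMeasure q) :=
  (hf.aemeasurable measurableSet_Icc).mono_ac (withDensity_absolutelyContinuous _ _)

/- The change of variables formula gives this up to a constant factor, which is `1` because both
sides are probability measures. -/
lemma map_knotheMap [IsProbabilityMeasure (cubeMeasure q)] (hq : ContinuousOn q (Icc 0 1))
    (hc : 0 < c) (hqc : ∀ x ∈ Icc (0 : Fin n → ℝ) 1, q x ∈ Icc c C)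
    (hdiff : DifferentiableOn ℝ (knotheMap q) (Icc 0 1)) :
    (cubeMeasure q).map (knotheMap q) = volume.restrict (Icc 0 1) := by
  have hK := isMonotoneTriangular_knotheMap hq hc hqc
  have h0 : (0 : Fin n → ℝ) ∈ Icc (0 : Fin n → ℝ) 1 := left_mem_Icc.2 zero_le_one
  have hslope : 0 < c / C := div_pos hc (hc.trans_le ((hqc 0 h0).1.trans (hqc 0 h0).2))
  set M := tailMarginal q n 0
  have hM (x : Fin n → ℝ) : tailMarginal q n x = M :=
    tailMarginal_congr q n fun l hl => absurd l.2 (by omega)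
  have hM0 : 0 < M := tailMarginal_pos hq hc hqc n h0
  have hchange := map_withDensity_abs_det_fderiv_eq_addHaar volume
    measurableSet_Icc.nullMeasurableSet (fun x hx => (hdiff x hx).hasFDerivWithinAt)
    (hK.injOn hslope)
  rw [(hK.surjOn hdiff.continuousOn).image_eq_of_mapsTo (hK.mapsTo hslope.le)] at hchange
  have hdensity : cubeMeasure q = ENNReal.ofReal M •
      (volume.restrict (Icc (0 : Fin n → ℝ) 1)).withDensity (fun x => ENNReal.ofReal
        |(fderivWithin ℝ (knotheMap q) (Icc 0 1) x).det|) := by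
    rw [← withDensity_smul' _ _ ENNReal.ofReal_ne_top]
    refine withDensity_congr_ae
      ((ae_restrict_iff' measurableSet_Icc).2 (ae_of_all _ fun x hx => ?_))
    rw [Pi.smul_apply, smul_eq_mul,
      det_fderivWithin_knotheMap hq hc hqc hx (hdiff x hx).hasFDerivWithinAt, hM,
      ← ENNReal.ofReal_mul hM0.le, abs_of_pos (div_pos (hc.trans_le (hqc x hx).1) hM0),
      mul_div_cancel₀ _ hM0.ne']
  have hmap : (cubeMeasure q).map (knotheMap q) =
      ENNReal.ofReal M • volume.restrict (Icc 0 1) := by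
    rw [hdensity, Measure.map_smul, hchange]
  have htotal := congrArg (fun μ => μ univ) hmap
  simp only [Measure.map_apply_of_aemeasurable
      (aemeasurable_cubeMeasure_of_continuousOn hdiff.continuousOn) MeasurableSet.univ,
    preimage_univ, measure_univ, Measure.smul_apply, Measure.restrict_apply_univ, volume_cube,
    smul_eq_mul, mul_one] at htotal
  rw [hmap, ← htotal, one_smul]

end SingleDensity

variable {p : I → (Fin n → ℝ) → ℝ} {c : ℝ}

lemma UnifContDiffOn.knotheMap (hp : UnifContDiffOn k p (Icc 0 1)) (hc : 0 < c)
    (hpc : ∀ i, ∀ x ∈ Icc (0 : Fin n → ℝ) 1, c ≤ p i x) :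
    UnifContDiffOn k (fun i => knotheMap (p i)) (Icc 0 1) := by
  have hu : UniqueDiffOn ℝ (Icc (0 : Fin n → ℝ) 1) := uniqueDiffOn_cube
  obtain ⟨C, -, hC⟩ := hp.exists_norm_le
  have htail (j : ℕ) (i : I) (x : Fin n → ℝ) (hx : x ∈ Icc (0 : Fin n → ℝ) 1) :
      c ≤ _root_.tailMarginal (p i) j x :=
    (tailMarginal_mem_Icc (C := C) (hp.continuousOn i)
      (fun x hx => ⟨hpc i x hx, (le_abs_self _).trans (hC i x hx)⟩) j hx).1
  refine UnifContDiffOn.pi (fun j => ?_) hu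
  refine ((UnifContDiffOn.of_contDiffOn (g := fun x : Fin n → ℝ => x j) (by fun_prop) hu
    isCompact_Icc).mul ((hp.tailMarginal j).integral_update j (a := fun z => z.2 * z.1 j)
      (by fun_prop) fun z hz => ?_) hu).mul (.inv hc (hp.tailMarginal (j + 1)) hu (htail _)) hu
  have hz₁ := apply_mem_Icc_of_mem_cube hz.1 j
  exact ⟨mul_nonneg hz.2.1 hz₁.1, mul_le_one₀ hz.2.2 hz₁.1 hz₁.2⟩

lemma triangularFamily_knotheMap (hp : UnifContDiffOn k p (Icc 0 1)) (hc : 0 < c)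
    (hpc : ∀ i, ∀ x ∈ Icc (0 : Fin n → ℝ) 1, c ≤ p i x) :
    TriangularFamily k n (fun i => knotheMap (p i)) := by
  obtain ⟨C, hC₀, hC⟩ := hp.exists_norm_le
  refine ⟨hp.knotheMap hc hpc, c / (C + 1), by positivity, fun i =>
    isMonotoneTriangular_knotheMap (hp.continuousOn i) hc fun x hx => ⟨hpc i x hx, ?_⟩⟩
  linarith [(le_abs_self _).trans (hC i x hx)]

end KnotheRosenblatt

section Interpolation

variable {I : Type*} {d k : ℕ}

/-- The point of space-time with position `x` and time `t`; time is the last coordinate, as in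
`toVelocity`. -/
def withTime (x : Fin d → ℝ) (t : ℝ) : Fin (d + 1) → ℝ := Fin.snoc (α := fun _ => ℝ) x t

/-- The projection of space-time, with time as the last coordinate, to space. -/
def space : (Fin (d + 1) → ℝ) →L[ℝ] Fin d → ℝ :=
  ContinuousLinearMap.pi fun j => ContinuousLinearMap.proj (R := ℝ) (φ := fun _ => ℝ) j.castSucc

@[simp] lemma space_apply (z : Fin (d + 1) → ℝ) (j : Fin d) : space z j = z j.castSucc := rfl

@[simp] lemma withTime_castSucc (x : Fin d → ℝ) (t : ℝ) (j : Fin d) :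
    withTime x t j.castSucc = x j := by simp [withTime]

@[simp] lemma withTime_last (x : Fin d → ℝ) (t : ℝ) : withTime x t (Fin.last d) = t := by
  simp [withTime]

@[simp] lemma space_withTime (x : Fin d → ℝ) (t : ℝ) : space (withTime x t) = x := by
  ext j; simp

lemma withTime_space (z : Fin (d + 1) → ℝ) : withTime (space z) (z (Fin.last d)) = z := by
  ext j
  cases j using Fin.lastCases <;> simp

lemma withTime_mem_cube {x : Fin d → ℝ} {t : ℝ} :
    withTime x t ∈ Icc (0 : Fin (d + 1) → ℝ) 1 ↔
      x ∈ Icc (0 : Fin d → ℝ) 1 ∧ t ∈ Icc (0 : ℝ) 1 := by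
  simp only [mem_Icc, Pi.le_def, Fin.forall_fin_succ', withTime_castSucc, withTime_last,
    Pi.zero_apply, Pi.one_apply]
  tauto

lemma space_mem_cube {z : Fin (d + 1) → ℝ} (hz : z ∈ Icc (0 : Fin (d + 1) → ℝ) 1) :
    space z ∈ Icc (0 : Fin d → ℝ) 1 := by
  rw [← withTime_space z] at hz
  exact (withTime_mem_cube.1 hz).1

lemma space_update_castSucc (z : Fin (d + 1) → ℝ) (j : Fin d) (b : ℝ) :
    space (Function.update z j.castSucc b) = Function.update (space z) j b := by
  ext l
  rcases eq_or_ne l j with rfl | hl <;> simp [*]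

lemma hasDerivWithinAt_withTime {γ : ℝ → Fin d → ℝ} {v : Fin d → ℝ} {s : Set ℝ} {t : ℝ}
    (h : HasDerivWithinAt γ v s t) :
    HasDerivWithinAt (fun τ => withTime (γ τ) τ) (withTime v 1) s t := by
  rw [hasDerivWithinAt_pi] at h ⊢
  intro j
  cases j using Fin.lastCases with
  | last => simpa using (hasDerivAt_id' t).hasDerivWithinAt
  | cast j => simpa using h j

/-- The displacement interpolation of two maps, with the time as last coordinate. -/
def interpMap (G₀ G₁ : (Fin d → ℝ) → Fin d → ℝ) (z : Fin (d + 1) → ℝ) : Fin (d + 1) → ℝ :=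
  withTime (AffineMap.lineMap (G₀ (space z)) (G₁ (space z)) (z (Fin.last d))) (z (Fin.last d))

section SinglePair

variable {c₀ c₁ : ℝ} {G₀ G₁ : (Fin d → ℝ) → Fin d → ℝ}

lemma interpMap_withTime (u : Fin d → ℝ) (t : ℝ) :
    interpMap G₀ G₁ (withTime u t) = withTime (AffineMap.lineMap (G₀ u) (G₁ u) t) t := by
  simp [interpMap]

lemma interpMap_castSucc (z : Fin (d + 1) → ℝ) (j : Fin d) :
    interpMap G₀ G₁ z j.castSucc =
      (1 - z (Fin.last d)) * G₀ (space z) j + z (Fin.last d) * G₁ (space z) j := by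
  rw [interpMap, withTime_castSucc, AffineMap.pi_lineMap_apply, AffineMap.lineMap_apply_ring]

lemma interpMap_last (z : Fin (d + 1) → ℝ) :
    interpMap G₀ G₁ z (Fin.last d) = z (Fin.last d) := by simp [interpMap]

lemma mul_sub_le_interpMap_update_sub (h₀ : IsMonotoneTriangular c₀ G₀)
    (h₁ : IsMonotoneTriangular c₁ G₁) {z : Fin (d + 1) → ℝ}
    (hz : z ∈ Icc (0 : Fin (d + 1) → ℝ) 1) (j : Fin d) {b : ℝ} (hb : b ∈ Icc (z j.castSucc) 1) :
    min c₀ c₁ * (b - z j.castSucc) ≤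
      interpMap G₀ G₁ (Function.update z j.castSucc b) j.castSucc -
        interpMap G₀ G₁ z j.castSucc := by
  have ht := apply_mem_Icc_of_mem_cube hz (Fin.last d)
  have hb₀ := sub_nonneg.2 hb.1
  rw [interpMap_castSucc, interpMap_castSucc, space_update_castSucc,
    Function.update_of_ne (Fin.castSucc_lt_last j).ne']
  have hG₀ := (mul_le_mul_of_nonneg_right (min_le_left c₀ c₁) hb₀).trans
    (h₀.mono _ (space_mem_cube hz) j b hb)
  have hG₁ := (mul_le_mul_of_nonneg_right (min_le_right c₀ c₁) hb₀).trans
    (h₁.mono _ (space_mem_cube hz) j b hb)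
  linarith [mul_le_mul_of_nonneg_left hG₀ (sub_nonneg.2 ht.2),
    mul_le_mul_of_nonneg_left hG₁ ht.1]

lemma isMonotoneTriangular_interpMap (h₀ : IsMonotoneTriangular c₀ G₀)
    (h₁ : IsMonotoneTriangular c₁ G₁) :
    IsMonotoneTriangular (min 1 (min c₀ c₁)) (interpMap G₀ G₁) where
  dep x hx y hy j hxy := by
    have htime := hxy (Fin.last d) (Fin.le_last j)
    cases j using Fin.lastCases with
    | last => simpa [interpMap_last] using htime
    | cast j =>
      have hspace : ∀ l, j ≤ l → space x l = space y l := fun l hl => hxy _ (by simpa using hl)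
      rw [interpMap_castSucc, interpMap_castSucc, htime,
        h₀.dep _ (space_mem_cube hx) _ (space_mem_cube hy) j hspace,
        h₁.dep _ (space_mem_cube hx) _ (space_mem_cube hy) j hspace]
  mono x hx j b hb := by
    have hb₀ := sub_nonneg.2 hb.1
    cases j using Fin.lastCases with
    | last =>
      rw [interpMap_last, interpMap_last, Function.update_self]
      exact mul_le_of_le_one_left hb₀ (min_le_left _ _)
    | cast j =>
      exact (mul_le_mul_of_nonneg_right (min_le_right _ _) hb₀).trans
        (mul_sub_le_interpMap_update_sub h₀ h₁ hx j hb)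
  face_zero x hx j hj := by
    cases j using Fin.lastCases with
    | last => rwa [interpMap_last]
    | cast j =>
      rw [interpMap_castSucc, h₀.face_zero _ (space_mem_cube hx) j hj,
        h₁.face_zero _ (space_mem_cube hx) j hj]
      ring
  face_one x hx j hj := by
    cases j using Fin.lastCases with
    | last => rwa [interpMap_last]
    | cast j =>
      rw [interpMap_castSucc, h₀.face_one _ (space_mem_cube hx) j hj,
        h₁.face_one _ (space_mem_cube hx) j hj]
      ring

end SinglePair

variable {F : Type*} [NormedAddCommGroup F] [NormedSpace ℝ F] {G₀ G₁ : I → (Fin d → ℝ) → Fin d → ℝ}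

lemma UnifContDiffOn.comp_space {f : I → (Fin d → ℝ) → F} (hf : UnifContDiffOn k f (Icc 0 1)) :
    UnifContDiffOn k (fun i z => f i (space z)) (Icc (0 : Fin (d + 1) → ℝ) 1) :=
  hf.comp uniqueDiffOn_cube (f := fun _ z => space z)
    (.of_contDiffOn space.contDiff.contDiffOn uniqueDiffOn_cube isCompact_Icc)
    uniqueDiffOn_cube fun _ _ => space_mem_cube

lemma UnifContDiffOn.interpMap (h₀ : UnifContDiffOn k G₀ (Icc 0 1))
    (h₁ : UnifContDiffOn k G₁ (Icc 0 1)) :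
    UnifContDiffOn k (fun i => interpMap (G₀ i) (G₁ i)) (Icc 0 1) := by
  have hu : UniqueDiffOn ℝ (Icc (0 : Fin (d + 1) → ℝ) 1) := uniqueDiffOn_cube
  have hweight {w : (Fin (d + 1) → ℝ) → ℝ} (hw : ContDiff ℝ k w) :
      UnifContDiffOn k (fun _ : I => w) (Icc 0 1) :=
    .of_contDiffOn hw.contDiffOn hu isCompact_Icc
  refine UnifContDiffOn.pi (fun j => ?_) hu
  cases j using Fin.lastCases with
  | last =>
    simp only [interpMap_last]
    exact hweight (by fun_prop)
  | cast j =>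
    simp only [interpMap_castSucc]
    exact ((hweight (by fun_prop)).mul (h₀.comp_space.apply hu j) hu).add
      ((hweight (by fun_prop)).mul (h₁.comp_space.apply hu j) hu) hu

lemma TriangularFamily.interpMap (h₀ : TriangularFamily k d G₀) (h₁ : TriangularFamily k d G₁) :
    TriangularFamily k (d + 1) (fun i => interpMap (G₀ i) (G₁ i)) := by
  obtain ⟨c₀, hc₀, hG₀⟩ := h₀.isMonotoneTriangular
  obtain ⟨c₁, hc₁, hG₁⟩ := h₁.isMonotoneTriangular
  exact ⟨h₀.unifContDiffOn.interpMap h₁.unifContDiffOn, min 1 (min c₀ c₁),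
    lt_min one_pos (lt_min hc₀ hc₁), fun i => isMonotoneTriangular_interpMap (hG₀ i) (hG₁ i)⟩

/-- The Eulerian velocity field of the displacement interpolation: at the point reached at time `t`
from `G₀ u` on the straight line to `G₁ u` its value is `G₁ u - G₀ u`. -/
def interpVelocity (G₀ G₁ : I → (Fin d → ℝ) → Fin d → ℝ) (i : I) (z : Fin (d + 1) → ℝ) :
    Fin d → ℝ :=
  let u := space (TriangularFamily.inv (fun i => interpMap (G₀ i) (G₁ i)) i z)
  G₁ i u - G₀ i u

lemma unifContDiffOn_interpVelocity (h₀ : TriangularFamily k d G₀) (h₁ : TriangularFamily k d G₁)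
    (hk : 1 ≤ k) : UnifContDiffOn k (interpVelocity G₀ G₁) (Icc 0 1) := by
  have hT := h₀.interpMap h₁
  have hu : UniqueDiffOn ℝ (Icc (0 : Fin (d + 1) → ℝ) 1) := uniqueDiffOn_cube
  have hinv := (hT.inverse hk).unifContDiffOn
  exact (h₁.unifContDiffOn.comp_space.comp hu hinv hu hT.mapsTo_inv).sub
    (h₀.unifContDiffOn.comp_space.comp hu hinv hu hT.mapsTo_inv) hu

variable {i : I} {u : Fin d → ℝ} {t : ℝ} {z : Fin (d + 1) → ℝ}

lemma interpVelocity_lineMap (h₀ : TriangularFamily k d G₀) (h₁ : TriangularFamily k d G₁)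
    (hu : u ∈ Icc (0 : Fin d → ℝ) 1) (ht : t ∈ Icc (0 : ℝ) 1) :
    interpVelocity G₀ G₁ i (withTime (AffineMap.lineMap (G₀ i u) (G₁ i u) t) t) =
      G₁ i u - G₀ i u := by
  have hinv := ((h₀.interpMap h₁).invOn_inv i).1 (withTime_mem_cube.2 ⟨hu, ht⟩)
  rw [interpMap_withTime] at hinv
  rw [interpVelocity, hinv, space_withTime]

lemma hasDerivWithinAt_lineMap_interpVelocity (h₀ : TriangularFamily k d G₀)
    (h₁ : TriangularFamily k d G₁) (hu : u ∈ Icc (0 : Fin d → ℝ) 1) (ht : t ∈ Icc (0 : ℝ) 1) :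
    HasDerivWithinAt (AffineMap.lineMap (G₀ i u) (G₁ i u))
      (interpVelocity G₀ G₁ i (withTime (AffineMap.lineMap (G₀ i u) (G₁ i u) t) t))
      (Icc 0 1) t := by
  rw [interpVelocity_lineMap h₀ h₁ hu ht]
  exact AffineMap.hasDerivWithinAt_lineMap

lemma exists_withTime_lineMap_eq (h₀ : TriangularFamily k d G₀) (h₁ : TriangularFamily k d G₁)
    (i : I) (hz : z ∈ Icc (0 : Fin (d + 1) → ℝ) 1) :
    ∃ u ∈ Icc (0 : Fin d → ℝ) 1, ∃ t ∈ Icc (0 : ℝ) 1,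
      z = withTime (AffineMap.lineMap (G₀ i u) (G₁ i u) t) t :=
  have hT := h₀.interpMap h₁
  have hw := hT.mapsTo_inv i hz
  ⟨_, space_mem_cube hw, _, apply_mem_Icc_of_mem_cube hw (Fin.last d),
    ((hT.invOn_inv i).2 hz).symm⟩

/-- A velocity field on space-time `[0,1]^{d+1}` that is tangent to the faces of the cube of
positions and has zero Lagrangian acceleration, so that its particles move on straight lines at
constant speed. -/
structure IsStraightField (f : (Fin (d + 1) → ℝ) → Fin d → ℝ) : Prop where
  face : ∀ z ∈ Icc (0 : Fin (d + 1) → ℝ) 1, ∀ j : Fin d,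
    z j.castSucc = 0 ∨ z j.castSucc = 1 → f z j = 0
  acceleration : ∀ z ∈ Icc (0 : Fin (d + 1) → ℝ) 1,
    fderivWithin ℝ f (Icc 0 1) z (withTime (f z) 1) = 0

lemma interpVelocity_face (h₀ : TriangularFamily k d G₀) (h₁ : TriangularFamily k d G₁)
    (hk : 1 ≤ k) (hz : z ∈ Icc (0 : Fin (d + 1) → ℝ) 1) (j : Fin d)
    (hj : z j.castSucc = 0 ∨ z j.castSucc = 1) : interpVelocity G₀ G₁ i z j = 0 := by
  have hT := (h₀.interpMap h₁).inverse hk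
  have hw := space_mem_cube (hT.mapsTo i hz)
  obtain ⟨_, _, hinv⟩ := hT.isMonotoneTriangular
  obtain ⟨_, _, hG₀⟩ := h₀.isMonotoneTriangular
  obtain ⟨_, _, hG₁⟩ := h₁.isMonotoneTriangular
  rw [interpVelocity, Pi.sub_apply]
  rcases hj with hj | hj
  · have hface := (hinv i).face_zero z hz _ hj
    rw [(hG₁ i).face_zero _ hw j hface, (hG₀ i).face_zero _ hw j hface, sub_zero]
  · have hface := (hinv i).face_one z hz _ hj
    rw [(hG₁ i).face_one _ hw j hface, (hG₀ i).face_one _ hw j hface, sub_self]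

lemma fderivWithin_interpVelocity (h₀ : TriangularFamily k d G₀) (h₁ : TriangularFamily k d G₁)
    (hk : 1 ≤ k) (hz : z ∈ Icc (0 : Fin (d + 1) → ℝ) 1) :
    fderivWithin ℝ (interpVelocity G₀ G₁ i) (Icc 0 1) z
      (withTime (interpVelocity G₀ G₁ i z) 1) = 0 := by
  obtain ⟨u, hu, t, ht, rfl⟩ := exists_withTime_lineMap_eq h₀ h₁ i hz
  obtain ⟨C, hC⟩ := unifContDiffOn_interpVelocity h₀ h₁ hk
  have hchain := ((hC i).hasFDerivWithinAt hk hz).comp_hasDerivWithinAt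
    (f := fun τ => withTime (AffineMap.lineMap (G₀ i u) (G₁ i u) τ) τ) t
    (hasDerivWithinAt_withTime (hasDerivWithinAt_lineMap_interpVelocity h₀ h₁ hu ht))
    fun τ hτ => withTime_mem_cube.2
      ⟨(convex_Icc _ _).lineMap_mem (h₀.mapsTo i hu) (h₁.mapsTo i hu) hτ, hτ⟩
  refine (uniqueDiffOn_Icc_zero_one _ ht).eq_deriv _ hchain ?_
  exact (hasDerivWithinAt_const t _ (G₁ i u - G₀ i u)).congr
    (fun τ hτ => interpVelocity_lineMap h₀ h₁ hu hτ) (interpVelocity_lineMap h₀ h₁ hu ht)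

lemma isStraightField_interpVelocity (h₀ : TriangularFamily k d G₀)
    (h₁ : TriangularFamily k d G₁) (hk : 1 ≤ k) (i : I) :
    IsStraightField (interpVelocity G₀ G₁ i) :=
  ⟨fun _ hz => interpVelocity_face h₀ h₁ hk hz, fun _ hz => fderivWithin_interpVelocity h₀ h₁ hk hz⟩

end Interpolation

section Transport

variable {d k : ℕ} {C c : ℝ}

/-- `q` is the density on the cube of a probability measure, is at least `c`, and has `C^k` norm at
most `C`. -/
structure CubeDensity (k : ℕ) (C c : ℝ) (q : (Fin d → ℝ) → ℝ) : Prop where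
  ckBoundedOn : CkBoundedOn k C q (Icc 0 1)
  lower : ∀ x ∈ Icc (0 : Fin d → ℝ) 1, c ≤ q x
  isProbabilityMeasure : IsProbabilityMeasure (cubeMeasure q)

/-- `X x` is, for every `x` in the cube, a trajectory of `f` in the cube started at `x`, and the
time-one map of `X` is continuous and pushes `μ` to `ν`. -/
structure IsTransportFlow (f : (Fin (d + 1) → ℝ) → Fin d → ℝ) (X : (Fin d → ℝ) → ℝ → Fin d → ℝ)
    (μ ν : Measure (Fin d → ℝ)) : Prop where
  apply_zero : ∀ x ∈ Icc (0 : Fin d → ℝ) 1, X x 0 = x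
  mem_cube : ∀ x ∈ Icc (0 : Fin d → ℝ) 1, ∀ t ∈ Icc (0 : ℝ) 1, X x t ∈ Icc (0 : Fin d → ℝ) 1
  hasDerivWithinAt : ∀ x ∈ Icc (0 : Fin d → ℝ) 1, ∀ t ∈ Icc (0 : ℝ) 1,
    HasDerivWithinAt (X x) (f (withTime (X x t) t)) (Icc 0 1) t
  continuousOn_one : ContinuousOn (fun x => X x 1) (Icc 0 1)
  map_one : μ.map (fun x => X x 1) = ν

lemma isTransportFlow_interpVelocity {I : Type*} {G₀ G₁ : I → (Fin d → ℝ) → Fin d → ℝ}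
    (h₀ : TriangularFamily k d G₀) (h₁ : TriangularFamily k d G₁) {i : I}
    {T : (Fin d → ℝ) → Fin d → ℝ} (hT : MapsTo T (Icc 0 1) (Icc 0 1))
    (hG₀ : LeftInvOn (G₀ i) T (Icc 0 1)) (hG₁ : ContinuousOn (G₁ i ∘ T) (Icc 0 1))
    {μ ν : Measure (Fin d → ℝ)} (hμν : μ.map (G₁ i ∘ T) = ν) :
    IsTransportFlow (interpVelocity G₀ G₁ i)
      (fun x => AffineMap.lineMap (G₀ i (T x)) (G₁ i (T x))) μ ν where
  apply_zero x hx := (AffineMap.lineMap_apply_zero _ _).trans (hG₀ hx)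
  mem_cube _ hx _ ht :=
    (convex_Icc _ _).lineMap_mem (h₀.mapsTo i (hT hx)) (h₁.mapsTo i (hT hx)) ht
  hasDerivWithinAt _ hx _ ht := hasDerivWithinAt_lineMap_interpVelocity h₀ h₁ (hT hx) ht
  continuousOn_one := by simpa only [AffineMap.lineMap_apply_one, Function.comp_def] using hG₁
  map_one := by simpa only [AffineMap.lineMap_apply_one, Function.comp_def] using hμν

lemma CubeDensity.map_knotheMap {q : (Fin d → ℝ) → ℝ} (hq : CubeDensity k C c q) (hk : 1 ≤ k)
    (hc : 0 < c) : (cubeMeasure q).map (knotheMap q) = volume.restrict (Icc 0 1) := by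
  have := hq.isProbabilityMeasure
  obtain ⟨M, hM⟩ := (triangularFamily_knotheMap (I := Unit) ⟨C, fun _ => hq.ckBoundedOn⟩ hc
    fun _ => hq.lower).unifContDiffOn
  exact _root_.map_knotheMap hq.ckBoundedOn.contDiffOn.continuousOn hc
    (fun x hx => ⟨hq.lower x hx, (le_abs_self _).trans (hq.ckBoundedOn.norm_le hx)⟩)
    ((hM ()).contDiffOn.differentiableOn (by norm_cast; omega))

lemma map_map_eq_self_of_ae {X Y : Type*} [MeasurableSpace X] [MeasurableSpace Y] {μ : Measure X}
    {φ : X → Y} {ψ : Y → X} (hφ : AEMeasurable φ μ) (hψ : AEMeasurable ψ (μ.map φ))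
    (hψφ : ∀ᵐ x ∂μ, ψ (φ x) = x) : (μ.map φ).map ψ = μ := by
  rw [AEMeasurable.map_map_of_aemeasurable hψ hφ,
    Measure.map_congr (g := id) (by filter_upwards [hψφ] with x hx using hx), Measure.map_id]

lemma ae_mem_cube_cubeMeasure (q : (Fin d → ℝ) → ℝ) :
    ∀ᵐ x ∂cubeMeasure q, x ∈ Icc (0 : Fin d → ℝ) 1 :=
  (withDensity_absolutelyContinuous _ _).ae_le (ae_restrict_mem measurableSet_Icc)

section KnotheInverse

variable {I : Type*} {p : I → (Fin d → ℝ) → ℝ}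

lemma continuousOn_inv_knotheMap_comp (hp : ∀ i, CubeDensity k C c (p i)) (hk : 1 ≤ k)
    (hc : 0 < c) (i j : I) :
    ContinuousOn (TriangularFamily.inv (fun i => knotheMap (p i)) j ∘ knotheMap (p i))
      (Icc 0 1) :=
  have hK := triangularFamily_knotheMap ⟨C, fun i => (hp i).ckBoundedOn⟩ hc fun i => (hp i).lower
  ((hK.inverse hk).unifContDiffOn.continuousOn j).comp (hK.unifContDiffOn.continuousOn i)
    (hK.mapsTo i)

lemma map_inv_knotheMap_comp (hp : ∀ i, CubeDensity k C c (p i)) (hk : 1 ≤ k) (hc : 0 < c)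
    (i j : I) :
    (cubeMeasure (p i)).map
      (TriangularFamily.inv (fun i => knotheMap (p i)) j ∘ knotheMap (p i)) =
      cubeMeasure (p j) := by
  have hK := triangularFamily_knotheMap ⟨C, fun i => (hp i).ckBoundedOn⟩ hc fun i => (hp i).lower
  have hφ (i : I) : AEMeasurable (knotheMap (p i)) (cubeMeasure (p i)) :=
    aemeasurable_cubeMeasure_of_continuousOn (hK.unifContDiffOn.continuousOn i)
  have hψ : AEMeasurable (TriangularFamily.inv (fun i => knotheMap (p i)) j)
      (volume.restrict (Icc 0 1)) :=
    ((hK.inverse hk).unifContDiffOn.continuousOn j).aemeasurable measurableSet_Icc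
  have huniform (i : I) := (hp i).map_knotheMap hk hc
  rw [← AEMeasurable.map_map_of_aemeasurable (by rwa [huniform]) (hφ i), huniform i, ← huniform j]
  refine map_map_eq_self_of_ae (hφ j) (by rwa [huniform]) ?_
  filter_upwards [ae_mem_cube_cubeMeasure (p j)] with x hx using (hK.invOn_inv j).1 hx

end KnotheInverse

theorem exists_straightField_transportFlow (hk : 1 ≤ k) (C : ℝ) (hc : 0 < c) :
    ∃ M : ℝ, ∀ q₀ q₁ : (Fin d → ℝ) → ℝ, CubeDensity k C c q₀ → CubeDensity k C c q₁ →
      ∃ (f : (Fin (d + 1) → ℝ) → Fin d → ℝ) (X : (Fin d → ℝ) → ℝ → Fin d → ℝ),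
        CkBoundedOn k M f (Icc 0 1) ∧ IsStraightField f ∧
          IsTransportFlow f X (cubeMeasure q₀) (cubeMeasure q₁) := by
  let I := {q : (Fin d → ℝ) → ℝ // CubeDensity k C c q}
  have hp : ∀ i : I, CubeDensity k C c i.1 := fun i => i.2
  have hK := triangularFamily_knotheMap ⟨C, fun i => (hp i).ckBoundedOn⟩ hc fun i => (hp i).lower
  have hG₀ := (hK.inverse hk).comp_index (Prod.fst : I × I → I)
  have hG₁ := (hK.inverse hk).comp_index (Prod.snd : I × I → I)
  obtain ⟨M, hM⟩ := unifContDiffOn_interpVelocity hG₀ hG₁ hk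
  refine ⟨M, fun q₀ q₁ hq₀ hq₁ => ?_⟩
  let i : I × I := (⟨q₀, hq₀⟩, ⟨q₁, hq₁⟩)
  exact ⟨_, _, hM i, isStraightField_interpVelocity hG₀ hG₁ hk i,
    isTransportFlow_interpVelocity hG₀ hG₁ (hK.mapsTo i.1) (hK.invOn_inv i.1).1
      (continuousOn_inv_knotheMap_comp hp hk hc i.1 i.2)
      (map_inv_knotheMap_comp hp hk hc i.1 i.2)⟩

end Transport

section Layers

variable {ι κ : Type*} {n m : ℕ}

namespace AffineLayer

/-- The affine layer `z ↦ A z + b` for inputs and outputs indexed by arbitrary finite types. -/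
def reindex (e : ι ≃ Fin n) (e' : κ ≃ Fin m) (A : Matrix κ ι ℝ) (b : κ → ℝ) : AffineLayer n m :=
  ⟨A.submatrix e'.symm e.symm, b ∘ e'.symm⟩

variable {e : ι ≃ Fin n} {e' : κ ≃ Fin m} {A : Matrix κ ι ℝ} {b : κ → ℝ}

lemma boundedBy_reindex {B : ℝ} (hA : ∀ i j, |A i j| ≤ B) (hb : ∀ i, |b i| ≤ B) :
    (reindex e e' A b).BoundedBy B :=
  ⟨fun _ _ => hA _ _, fun _ => hb _⟩

variable [Fintype ι]

lemma apply_reindex_comp (z : ι → ℝ) :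
    (reindex e e' A b).apply (z ∘ e.symm) = (A *ᵥ z + b) ∘ e'.symm := by
  rw [apply, reindex, Matrix.submatrix_mulVec_equiv, Equiv.symm_symm, Function.comp_assoc,
    Equiv.symm_comp_self, Function.comp_id]
  rfl

variable [Fintype κ]

open Classical in
lemma numNonzero_reindex :
    (reindex e e' A b).numNonzero =
      (Finset.univ.filter fun ij : κ × ι => A ij.1 ij.2 ≠ 0).card +
        (Finset.univ.filter fun i : κ => b i ≠ 0).card := by
  rw [numNonzero]
  refine congrArg₂ (· + ·) (Finset.card_equiv (e'.prodCongr e).symm ?_)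
    (Finset.card_equiv e'.symm ?_) <;>
    simp only [Finset.mem_filter, Finset.mem_univ, true_and] <;> exact fun _ => Iff.rfl

lemma numNonzero_reindex_le :
    (reindex e e' A b).numNonzero ≤ Fintype.card κ * Fintype.card ι + Fintype.card κ := by
  classical
  rw [numNonzero_reindex, ← Fintype.card_prod]
  exact add_le_add (Finset.card_le_univ _) (Finset.card_le_univ _)

lemma numNonzero_reindex_zero_le :
    (reindex e e' A 0).numNonzero ≤ Fintype.card κ * Fintype.card ι := by
  classical
  rw [numNonzero_reindex, ← Fintype.card_prod]
  simp only [Pi.zero_apply, ne_eq, not_true_eq_false, Finset.filter_false, Finset.card_empty,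
    add_zero]
  exact Finset.card_le_univ _

end AffineLayer

variable [Fintype κ]

lemma foldl_replicate_reindex (e : κ ≃ Fin n) (A : Matrix κ κ ℝ) (l : ℕ) (u : κ → ℝ) :
    (List.replicate l (AffineLayer.reindex e e A 0)).foldl (fun z A => A.apply (reluSq z))
      (u ∘ e.symm) = ((fun v => A *ᵥ reluSq v)^[l] u) ∘ e.symm := by
  induction l generalizing u with
  | zero => rfl
  | succ l ih =>
    rw [List.replicate_succ, List.foldl_cons, Function.iterate_succ_apply, ← ih,
      show reluSq (u ∘ e.symm) = reluSq u ∘ e.symm from rfl, AffineLayer.apply_reindex_comp,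
      add_zero]

open Classical in
lemma iterate_mulVec_reluSq_mem_reluSqClass {D d s : ℕ} {B : ℝ} (hB : 0 ≤ B)
    {Win : Matrix κ (Fin D) ℝ} {b : κ → ℝ} {A : Matrix κ κ ℝ} {Wout : Matrix (Fin d) κ ℝ}
    (hWin : ∀ i j, |Win i j| ≤ B) (hb : ∀ i, |b i| ≤ B) (hA : ∀ i j, |A i j| ≤ B)
    (hWout : ∀ i j, |Wout i j| ≤ B)
    (hs : (Finset.univ.filter fun ij : κ × κ => A ij.1 ij.2 ≠ 0).card ≤ s) (l : ℕ) :
    (fun z => Wout *ᵥ reluSq ((fun v => A *ᵥ reluSq v)^[l] (Win *ᵥ z + b))) ∈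
      reluSqClass D d (l + 2) (Fintype.card κ)
        (Fintype.card κ * (D + 1) + l * s + d * Fintype.card κ) B := by
  let e := Fintype.equivFin κ
  let hiddenLayer := AffineLayer.reindex e e A 0
  refine ⟨⟨.reindex (.refl _) e Win b, List.replicate l hiddenLayer, .reindex e (.refl _) Wout 0⟩,
    by simp [ReLUSqNetwork.depth], ?_, ⟨AffineLayer.boundedBy_reindex hWin hb, fun L hL => ?_,
      AffineLayer.boundedBy_reindex hWout fun _ => by simpa⟩, ?_⟩
  · have hhidden : hiddenLayer.numNonzero ≤ s := by
      rw [AffineLayer.numNonzero_reindex]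
      simpa using hs
    rw [ReLUSqNetwork.numNonzero, List.map_replicate, List.sum_replicate, smul_eq_mul]
    refine add_le_add (add_le_add ?_ (Nat.mul_le_mul_left l hhidden)) ?_
    · exact AffineLayer.numNonzero_reindex_le.trans_eq (by rw [Fintype.card_fin, mul_add_one])
    · exact AffineLayer.numNonzero_reindex_zero_le.trans_eq (by rw [Fintype.card_fin])
  · rw [List.eq_of_mem_replicate hL]
    exact AffineLayer.boundedBy_reindex hA fun _ => by simpa
  · ext1 z
    have hinput : (AffineLayer.reindex (.refl _) e Win b).apply z = (Win *ᵥ z + b) ∘ e.symm :=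
      AffineLayer.apply_reindex_comp z
    rw [ReLUSqNetwork.eval, hinput, foldl_replicate_reindex]
    exact (AffineLayer.apply_reindex_comp (reluSq _)).trans (add_zero _)

end Layers

section ProductNetwork

/-- The scalar activation `max{0,s}²`. -/
def relu2 (s : ℝ) : ℝ := (max 0 s) ^ 2

lemma relu2_add_relu2_neg (s : ℝ) : relu2 s + relu2 (-s) = s ^ 2 := by
  rcases le_total 0 s with h | h <;> simp [relu2, h]

/-- The output weights of the four neurons whose combination is the product of two numbers `x`
and `y`, by `4xy = (x + y)² - (x - y)²` and `s² = relu2 s + relu2 (-s)`. -/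
def quadSign : Fin 4 → ℝ := ![1 / 4, -1 / 4, 1 / 4, -1 / 4]

/-- The weights of the first factor in the four neurons of `quadSign`. -/
def quadLeft : Fin 4 → ℝ := ![1, 1, -1, -1]

/-- The weights of the second factor in the four neurons of `quadSign`. -/
def quadRight : Fin 4 → ℝ := ![1, -1, -1, 1]

lemma sum_quad_mul (x y : ℝ) :
    ∑ r, quadSign r * relu2 (quadLeft r * x + quadRight r * y) = x * y := by
  have hadd := relu2_add_relu2_neg (x + y)
  have hsub := relu2_add_relu2_neg (x - y)
  simp only [Fin.sum_univ_four, quadSign, quadLeft, quadRight, Matrix.cons_val]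
  rw [show -1 * x + -1 * y = -(x + y) by ring, show -1 * x + 1 * y = -(x - y) by ring,
    show 1 * x + 1 * y = x + y by ring, show 1 * x + -1 * y = x - y by ring]
  linarith [show (x + y) ^ 2 - (x - y) ^ 2 = 4 * (x * y) by ring]

lemma abs_quadSign (r : Fin 4) : |quadSign r| = 1 / 4 := by
  fin_cases r <;> norm_num [quadSign, abs_of_pos, abs_of_neg]

lemma abs_quadLeft (r : Fin 4) : |quadLeft r| = 1 := by
  fin_cases r <;> norm_num [quadLeft]

lemma abs_quadRight (r : Fin 4) : |quadRight r| = 1 := by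
  fin_cases r <;> norm_num [quadRight]

section Tree

variable {M : ℕ} [NeZero M]

/-- One level of a binary tree of products. Indices are taken modulo `M`, so that every level has
`M` entries; after `l` levels only the first `M / 2 ^ l` of them are meaningful. -/
def treeStep (x : Fin M → ℝ) (q : Fin M) : ℝ :=
  x (Fin.ofNat M (2 * q)) * x (Fin.ofNat M (2 * q + 1))

lemma treeStep_iterate (x : Fin M → ℝ) (l i : ℕ) (hi : (i + 1) * 2 ^ l ≤ M) :
    treeStep^[l] x (Fin.ofNat M i) =
      ∏ q ∈ Finset.range (2 ^ l), x (Fin.ofNat M (i * 2 ^ l + q)) := by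
  induction l generalizing i with
  | zero => simp
  | succ l ih =>
    have hdouble : (i + 1) * 2 ^ (l + 1) = (2 * i + 1 + 1) * 2 ^ l := by ring
    have hpos := Nat.one_le_two_pow (n := l)
    have hlt : i < M := by nlinarith [Nat.one_le_two_pow (n := l + 1)]
    have hval : ((Fin.ofNat M i : Fin M) : ℕ) = i := by simp [Fin.ofNat, Nat.mod_eq_of_lt hlt]
    rw [Function.iterate_succ_apply', treeStep, hval, ih _ (by nlinarith), ih _ (by linarith),
      pow_succ, mul_two, Finset.prod_range_add]
    congr 1 <;> exact Finset.prod_congr rfl fun q _ => by congr 2; ring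

lemma treeStep_iterate_prod {m : ℕ} (x : Fin (2 ^ m) → ℝ) : treeStep^[m] x 0 = ∏ q, x q := by
  have h := treeStep_iterate x m 0 (by simp)
  rw [← Fin.prod_univ_eq_prod_range (fun q => x (Fin.ofNat (2 ^ m) (0 * 2 ^ m + q)))] at h
  simpa [Fin.ofNat_eq_cast] using h

/-- The weights between two levels of products: neuron `(r, q)` is the `r`-th of the four neurons
computing the product of the values of the groups `2q` and `2q+1` of the previous level. -/
def treeMatrix : Matrix (Fin 4 × Fin M) (Fin 4 × Fin M) ℝ := fun a b =>
  quadSign b.1 * ((if b.2 = Fin.ofNat M (2 * a.2) then quadLeft a.1 else 0) +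
    if b.2 = Fin.ofNat M (2 * a.2 + 1) then quadRight a.1 else 0)

/-- The number represented by the `q`-th group of four neurons with preactivations `u`. -/
def groupValue (u : Fin 4 × Fin M → ℝ) (q : Fin M) : ℝ := ∑ r, quadSign r * relu2 (u (r, q))

lemma abs_treeMatrix_le (a b : Fin 4 × Fin M) : |treeMatrix a b| ≤ 1 := by
  have hsum := abs_add_le (quadLeft a.1) (quadRight a.1)
  rw [abs_quadLeft, abs_quadRight] at hsum
  rw [treeMatrix, abs_mul, abs_quadSign]
  split_ifs <;> norm_num [abs_quadLeft, abs_quadRight]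
  linarith

lemma treeMatrix_mulVec_reluSq (u : Fin 4 × Fin M → ℝ) (a : Fin 4 × Fin M) :
    (treeMatrix *ᵥ reluSq u) a =
      quadLeft a.1 * groupValue u (Fin.ofNat M (2 * a.2)) +
        quadRight a.1 * groupValue u (Fin.ofNat M (2 * a.2 + 1)) := by
  change ∑ b : Fin 4 × Fin M, treeMatrix a b * relu2 (u b) = _
  simp only [treeMatrix, groupValue, Fintype.sum_prod_type, mul_add, add_mul,
    Finset.sum_add_distrib, mul_ite, mul_zero, ite_mul, zero_mul, Finset.sum_ite_eq',
    Finset.mem_univ, if_true, Finset.mul_sum]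
  congr 1 <;> exact Finset.sum_congr rfl fun r _ => by ring

lemma groupValue_treeMatrix_mulVec_reluSq (u : Fin 4 × Fin M → ℝ) :
    groupValue (treeMatrix *ᵥ reluSq u) = treeStep (groupValue u) := by
  ext q
  simp only [groupValue, treeMatrix_mulVec_reluSq]
  exact sum_quad_mul _ _

end Tree

open scoped Kronecker

variable {T ι : Type*} [Fintype T] [Fintype ι]

/-- The weights of the output layer that reads off, for every term `t`, the product formed in the
group `0` of its neurons, and combines the terms with the coefficients `c`. -/
def productOutputMatrix {d m : ℕ} (c : Fin d → T → ℝ) :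
    Matrix (Fin d) (T × (Fin 4 × Fin (2 ^ m))) ℝ :=
  fun j a => if a.2.2 = 0 then c j a.1 * quadSign a.2.1 else 0

lemma productOutputMatrix_mulVec_reluSq {d m : ℕ} (c : Fin d → T → ℝ)
    (u : T × (Fin 4 × Fin (2 ^ m)) → ℝ) (j : Fin d) :
    (productOutputMatrix c *ᵥ reluSq u) j = ∑ t, c j t * groupValue (fun a => u (t, a)) 0 := by
  change ∑ a : T × (Fin 4 × Fin (2 ^ m)), productOutputMatrix c j a * relu2 (u a) = _
  simp only [productOutputMatrix, groupValue, Fintype.sum_prod_type, ite_mul, zero_mul,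
    Finset.sum_ite_eq', Finset.mem_univ, if_true, Finset.mul_sum, mul_assoc]

lemma one_kronecker_mulVec [DecidableEq T] (A : Matrix ι ι ℝ) (z : T × ι → ℝ) (t : T) (i : ι) :
    (((1 : Matrix T T ℝ) ⊗ₖ A) *ᵥ z) (t, i) = (A *ᵥ fun j => z (t, j)) i := by
  simp [Matrix.mulVec, dotProduct, Fintype.sum_prod_type, Matrix.one_apply]

open Classical in
lemma card_nonzero_one_kronecker_le [DecidableEq T] (A : Matrix ι ι ℝ) :
    (Finset.univ.filter fun ab : (T × ι) × (T × ι) =>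
      ((1 : Matrix T T ℝ) ⊗ₖ A) ab.1 ab.2 ≠ 0).card ≤ Fintype.card T * Fintype.card ι ^ 2 := by
  have hcard : Fintype.card T * Fintype.card ι ^ 2 =
      (Finset.univ : Finset (T × ι × ι)).card := by simp [pow_two]
  rw [hcard]
  refine Finset.card_le_card_of_injOn (fun ab => (ab.1.1, ab.1.2, ab.2.2)) (by simp) ?_
  have hblock : ∀ a b : T × ι, ((1 : Matrix T T ℝ) ⊗ₖ A) a b ≠ 0 → a.1 = b.1 := by
    intro a b hab
    by_contra hne
    exact hab (by simp [Matrix.kroneckerMap_apply, Matrix.one_apply_ne hne])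
  rintro ⟨⟨t, i⟩, ⟨s, j⟩⟩ hab ⟨⟨t', i'⟩, ⟨s', j'⟩⟩ hab' h
  obtain rfl : t = s := hblock _ _ (Finset.mem_filter.1 (Finset.mem_coe.1 hab)).2
  obtain rfl : t' = s' := hblock _ _ (Finset.mem_filter.1 (Finset.mem_coe.1 hab')).2
  simp only [Prod.mk.injEq] at h ⊢
  tauto

lemma groupValue_iterate_treeMatrix [DecidableEq T] {m : ℕ}
    (u : T × (Fin 4 × Fin (2 ^ m)) → ℝ) (t : T) :
    groupValue (fun a => (fun v => ((1 : Matrix T T ℝ) ⊗ₖ treeMatrix) *ᵥ reluSq v)^[m] u (t, a)) 0 =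
      ∏ q, groupValue (fun a => u (t, a)) q := by
  have hstep (v : T × (Fin 4 × Fin (2 ^ m)) → ℝ) :
      groupValue (fun a => (((1 : Matrix T T ℝ) ⊗ₖ treeMatrix) *ᵥ reluSq v) (t, a)) =
        treeStep (groupValue fun a => v (t, a)) := by
    rw [← groupValue_treeMatrix_mulVec_reluSq]
    congr 1
    ext1 a
    exact one_kronecker_mulVec _ _ _ _
  rw [← treeStep_iterate_prod]
  exact congrFun (Function.Semiconj.iterate_right
    (f := fun v : T × (Fin 4 × Fin (2 ^ m)) → ℝ => groupValue fun a => v (t, a)) hstep m u) 0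

lemma sum_prod_quad_mem_reluSqClass {D d m : ℕ} {B : ℝ} (hB : 1 ≤ B)
    {w : T → Fin (2 ^ m) → Fin 4 → Fin D → ℝ} {b : T → Fin (2 ^ m) → Fin 4 → ℝ} {c : Fin d → T → ℝ}
    (hw : ∀ t q r j, |w t q r j| ≤ B) (hb : ∀ t q r, |b t q r| ≤ B) (hc : ∀ j t, |c j t| ≤ B) :
    (fun z j => ∑ t, c j t * ∏ q, ∑ r, quadSign r * relu2 (∑ l, w t q r l * z l + b t q r)) ∈
      reluSqClass D d (m + 2) (Fintype.card T * (4 * 2 ^ m))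
        (Fintype.card T * (4 * 2 ^ m * (D + 1) + m * (4 * 2 ^ m) ^ 2 + d * (4 * 2 ^ m))) B := by
  classical
  have hB₀ := zero_le_one.trans hB
  have hcard : Fintype.card (T × (Fin 4 × Fin (2 ^ m))) = Fintype.card T * (4 * 2 ^ m) := by simp
  have htree (a a' : T × (Fin 4 × Fin (2 ^ m))) :
      |((1 : Matrix T T ℝ) ⊗ₖ treeMatrix) a a'| ≤ B := by
    rw [Matrix.kroneckerMap_apply, Matrix.one_apply, abs_mul]
    split_ifs
    · rw [abs_one, one_mul]
      exact (abs_treeMatrix_le _ _).trans hB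
    · simpa
  have hout (j : Fin d) (a : T × (Fin 4 × Fin (2 ^ m))) : |productOutputMatrix c j a| ≤ B := by
    rw [productOutputMatrix]
    split_ifs
    · rw [abs_mul, abs_quadSign]
      linarith [hc j a.1, abs_nonneg (c j a.1)]
    · simpa
  have hnet := iterate_mulVec_reluSq_mem_reluSqClass hB₀
    (Win := fun a : T × (Fin 4 × Fin (2 ^ m)) => w a.1 a.2.2 a.2.1)
    (b := fun a => b a.1 a.2.2 a.2.1) (fun a => hw _ _ _) (fun a => hb _ _ _) htree hout
    (card_nonzero_one_kronecker_le treeMatrix) m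
  have hsize : Fintype.card T * (4 * 2 ^ m) * (D + 1) +
      m * (Fintype.card T * Fintype.card (Fin 4 × Fin (2 ^ m)) ^ 2) +
        d * (Fintype.card T * (4 * 2 ^ m)) =
      Fintype.card T * (4 * 2 ^ m * (D + 1) + m * (4 * 2 ^ m) ^ 2 + d * (4 * 2 ^ m)) := by
    simp only [Fintype.card_prod, Fintype.card_fin]
    ring
  rw [hcard, hsize] at hnet
  refine Set.mem_of_eq_of_mem ?_ hnet
  ext z j
  rw [productOutputMatrix_mulVec_reluSq]
  refine Finset.sum_congr rfl fun t _ => ?_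
  rw [groupValue_iterate_treeMatrix]
  rfl

end ProductNetwork

section Taylor

variable {E F : Type u} [NormedAddCommGroup E] [NormedSpace ℝ E] [NormedAddCommGroup F]
  [NormedSpace ℝ F] {s : Set E}

lemma iteratedFDerivWithin_fderivWithin_fderivWithin_comm (hs : UniqueDiffOn ℝ s)
    (hsc : s ⊆ closure (interior s)) {m : ℕ} {f : E → F} (hf : ContDiffOn ℝ (m + 2) f s) {x : E}
    (hx : x ∈ s) (p : Fin m → E) (v w : E) :
    iteratedFDerivWithin ℝ m (fderivWithin ℝ (fderivWithin ℝ f s) s) s x p v w =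
      iteratedFDerivWithin ℝ m (fderivWithin ℝ (fderivWithin ℝ f s) s) s x p w v := by
  have hf₂ : ContDiffOn ℝ m (fderivWithin ℝ (fderivWithin ℝ f s) s) s :=
    (hf.fderivWithin (m := (m + 1 : ℕ)) hs (by norm_cast)).fderivWithin hs (by norm_cast)
  let flip : (E →L[ℝ] E →L[ℝ] F) →L[ℝ] (E →L[ℝ] E →L[ℝ] F) :=
    (ContinuousLinearMap.flipₗᵢ ℝ E E F).toContinuousLinearEquiv.toContinuousLinearMap
  have hsymm : EqOn (fderivWithin ℝ (fderivWithin ℝ f s) s)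
      (flip ∘ fderivWithin ℝ (fderivWithin ℝ f s) s) s := by
    intro y hy
    ext v w
    refine (hf y hy).isSymmSndFDerivWithinAt ?_ hs (hsc hy) hy v w
    rw [minSmoothness_of_isRCLikeNormedField]
    norm_cast
    omega
  have hflip := iteratedFDerivWithin_congr (𝕜 := ℝ) hsymm hx m
  rw [ContinuousLinearMap.iteratedFDerivWithin_comp_left (𝕜 := ℝ) (F := E →L[ℝ] E →L[ℝ] F)
    (G := E →L[ℝ] E →L[ℝ] F) (f := fderivWithin ℝ (fderivWithin ℝ f s) s) flip (hf₂ x hx) hs hx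
    le_rfl] at hflip
  conv_lhs => rw [hflip]
  rfl

lemma iteratedFDerivWithin_succ_update (hs : UniqueDiffOn ℝ s) (hsc : s ⊆ closure (interior s))
    {m : ℕ} {f : E → F} (hf : ContDiffOn ℝ (m + 1) f s) {x : E} (hx : x ∈ s) (v w : E)
    (i : Fin (m + 1)) :
    iteratedFDerivWithin ℝ (m + 1) f s x (Function.update (fun _ => w) i v) =
      iteratedFDerivWithin ℝ m (fderivWithin ℝ f s) s x (fun _ => w) v := by
  induction m generalizing F with
  | zero =>
    obtain rfl : i = 0 := by ext; omega
    rw [iteratedFDerivWithin_succ_apply_right hs hx]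
    simp
  | succ m ih =>
    rw [iteratedFDerivWithin_succ_apply_right hs hx]
    cases i using Fin.lastCases with
    | last =>
      rw [Function.update_self]
      congr 2
      ext q
      simp [Fin.init]
    | cast i =>
      have hinit : Fin.init (Function.update (fun _ : Fin (m + 1 + 1) => w) i.castSucc v) =
          Function.update (fun _ => w) i v := by
        ext q
        by_cases hq : q = i
        · subst hq; simp [Fin.init]
        · simp [Fin.init, hq]
      rw [hinit, Function.update_of_ne (Fin.castSucc_lt_last i).ne',
        ih (hf.fderivWithin hs (by norm_cast)) i, iteratedFDerivWithin_succ_apply_right hs hx]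
      exact iteratedFDerivWithin_fderivWithin_fderivWithin_comm hs hsc
        (hf.of_le (by norm_cast)) hx _ _ _

/-- The Taylor polynomial at `a` of degree `n - 1`, with derivatives taken within `s`. -/
def taylorPoly (n : ℕ) (f : E → F) (s : Set E) (a z : E) : F :=
  ∑ m ∈ Finset.range n, ((m.factorial : ℝ)⁻¹) • iteratedFDerivWithin ℝ m f s a (fun _ => z - a)

lemma taylorPoly_self (n : ℕ) (f : E → F) (a : E) : taylorPoly (n + 1) f s a a = f a := by
  rw [taylorPoly, Finset.sum_range_succ']
  simp only [sub_self, Nat.factorial_zero, Nat.cast_one, inv_one, one_smul,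
    iteratedFDerivWithin_zero_apply]
  rw [Finset.sum_eq_zero, zero_add]
  intro m _
  rw [ContinuousMultilinearMap.map_coord_zero _ 0 rfl, smul_zero]

lemma hasFDerivAt_taylorTerm (hs : UniqueDiffOn ℝ s) (hsc : s ⊆ closure (interior s)) {m : ℕ}
    {f : E → F} (hf : ContDiffOn ℝ (m + 1) f s) {a : E} (ha : a ∈ s) (z : E) :
    HasFDerivAt
      (fun z => ((m + 1).factorial : ℝ)⁻¹ • iteratedFDerivWithin ℝ (m + 1) f s a (fun _ => z - a))
      ((m.factorial : ℝ)⁻¹ •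
        iteratedFDerivWithin ℝ m (fderivWithin ℝ f s) s a (fun _ => z - a)) z := by
  have hmultilinear := HasFDerivAt.multilinear_comp (f := iteratedFDerivWithin ℝ (m + 1) f s a)
    (g := fun _ z => z - a) (g' := fun _ => ContinuousLinearMap.id ℝ E) (x := z)
    (fun _ => (hasFDerivAt_id z).sub_const a)
  have hfactorial : ((m + 1).factorial : ℝ)⁻¹ * ((m + 1 : ℕ) : ℝ) = (m.factorial : ℝ)⁻¹ := by
    rw [Nat.factorial_succ, Nat.cast_mul, mul_inv_rev, mul_assoc,
      inv_mul_cancel₀ (by positivity), mul_one]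
  refine (hmultilinear.const_smul ((m + 1).factorial : ℝ)⁻¹).congr_fderiv ?_
  ext v
  simp only [_root_.smul_apply, _root_.sum_apply, ContinuousLinearMap.comp_apply,
    ContinuousLinearMap.id_apply, ContinuousMultilinearMap.toContinuousLinearMap_apply,
    iteratedFDerivWithin_succ_update hs hsc hf ha, Finset.sum_const, Finset.card_univ,
    Fintype.card_fin]
  rw [← Nat.cast_smul_eq_nsmul ℝ, smul_smul, hfactorial]

lemma hasFDerivAt_taylorPoly (hs : UniqueDiffOn ℝ s) (hsc : s ⊆ closure (interior s))
    {n : ℕ} {f : E → F} (hf : ContDiffOn ℝ n f s) {a : E} (ha : a ∈ s) (z : E) :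
    HasFDerivAt (taylorPoly (n + 1) f s a) (taylorPoly n (fderivWithin ℝ f s) s a z) z := by
  have hsplit : taylorPoly (n + 1) f s a = fun z => (∑ m ∈ Finset.range n,
      ((m + 1).factorial : ℝ)⁻¹ •
        iteratedFDerivWithin ℝ (m + 1) f s a (fun _ => z - a)) + f a := by
    ext z
    rw [taylorPoly, Finset.sum_range_succ']
    simp
  rw [hsplit, taylorPoly]
  refine HasFDerivAt.add_const _ (HasFDerivAt.fun_sum fun m hm => ?_)
  exact hasFDerivAt_taylorTerm hs hsc
    (hf.of_le (by exact_mod_cast Finset.mem_range.1 hm)) ha z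

lemma norm_sub_taylorPoly_le (hs : UniqueDiffOn ℝ s) (hsc : s ⊆ closure (interior s))
    (hconv : Convex ℝ s) {n : ℕ} {f : E → F} (hf : ContDiffOn ℝ n f s) {M : ℝ}
    (hM : ∀ x ∈ s, ‖iteratedFDerivWithin ℝ n f s x‖ ≤ M) {a z : E} (ha : a ∈ s) (hz : z ∈ s) :
    ‖f z - taylorPoly n f s a z‖ ≤ M * ‖z - a‖ ^ n := by
  induction n generalizing F z with
  | zero => simpa [taylorPoly] using hM z hz
  | succ n ih =>
    have hM₀ : 0 ≤ M := (norm_nonneg _).trans (hM a ha)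
    have hderiv : ∀ y ∈ s, HasFDerivWithinAt (fun y => f y - taylorPoly (n + 1) f s a y)
        (fderivWithin ℝ f s y - taylorPoly n (fderivWithin ℝ f s) s a y) s y := fun y hy =>
      ((hf.differentiableOn (by simp)) y hy).hasFDerivWithinAt.sub
        (hasFDerivAt_taylorPoly hs hsc (hf.of_le (by norm_cast; omega)) ha y).hasFDerivWithinAt
    have hbound : ∀ y ∈ s, ‖fderivWithin ℝ f s y - taylorPoly n (fderivWithin ℝ f s) s a y‖ ≤
        M * ‖y - a‖ ^ n := fun y hy =>
      ih (hf.fderivWithin hs (by norm_cast))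
        (fun x hx => (norm_iteratedFDerivWithin_fderivWithin hs hx).trans_le (hM x hx)) hy
    have hmvt := (hconv.inter
      (convex_closedBall a ‖z - a‖)).norm_image_sub_le_of_norm_hasFDerivWithin_le
      (f := fun y => f y - taylorPoly (n + 1) f s a y) (C := M * ‖z - a‖ ^ n)
      (fun y hy => (hderiv y hy.1).mono inter_subset_left)
      (fun y hy => (hbound y hy.1).trans (by
        have := mem_closedBall_iff_norm.1 hy.2
        gcongr))
      ⟨ha, mem_closedBall_self (norm_nonneg _)⟩ ⟨hz, mem_closedBall_iff_norm.2 le_rfl⟩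
    rwa [taylorPoly_self, sub_self, sub_zero, mul_assoc, ← pow_succ] at hmvt

lemma norm_fderivWithin_sub_taylorPoly_le (hs : UniqueDiffOn ℝ s)
    (hsc : s ⊆ closure (interior s)) (hconv : Convex ℝ s) {n : ℕ} {f : E → F}
    (hf : ContDiffOn ℝ (n + 1) f s) {M : ℝ}
    (hM : ∀ x ∈ s, ‖iteratedFDerivWithin ℝ (n + 1) f s x‖ ≤ M) {a z : E} (ha : a ∈ s)
    (hz : z ∈ s) :
    ‖fderivWithin ℝ f s z - taylorPoly n (fderivWithin ℝ f s) s a z‖ ≤ M * ‖z - a‖ ^ n :=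
  norm_sub_taylorPoly_le hs hsc hconv (hf.fderivWithin hs (by norm_cast))
    (fun x hx => by rw [norm_iteratedFDerivWithin_fderivWithin hs hx]; exact hM x hx) ha hz

lemma taylorPoly_eq_sum {D : ℕ} {G : Type} [NormedAddCommGroup G] [NormedSpace ℝ G]
    {s : Set (Fin D → ℝ)} (n : ℕ) (f : (Fin D → ℝ) → G)
    (a z : Fin D → ℝ) :
    taylorPoly n f s a z = ∑ t : (Σ m : Fin n, Fin m → Fin D),
      (∏ q, (z (t.2 q) - a (t.2 q))) • (((t.1 : ℕ).factorial : ℝ)⁻¹ •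
        iteratedFDerivWithin ℝ t.1 f s a (fun q => Pi.single (t.2 q) 1)) := by
  classical
  rw [taylorPoly, Fintype.sum_sigma, ← Fin.sum_univ_eq_sum_range
    (fun m => ((m.factorial : ℝ)⁻¹) • iteratedFDerivWithin ℝ m f s a (fun _ => z - a)) n]
  refine Finset.sum_congr rfl fun m _ => ?_
  have hw : (fun _ : Fin m => z - a) = fun _ => ∑ j, (z j - a j) • Pi.single j (1 : ℝ) := by
    ext _ l
    simp [Finset.sum_apply, Pi.single_apply]
  rw [hw, ContinuousMultilinearMap.map_sum, Finset.smul_sum]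
  refine Finset.sum_congr rfl fun J _ => ?_
  rw [ContinuousMultilinearMap.map_smul_univ, smul_comm]

end Taylor

section Bump

lemma hasDerivAt_relu2 (s : ℝ) : HasDerivAt relu2 (2 * max 0 s) s := by
  rcases lt_trichotomy s 0 with h | rfl | h
  · rw [max_eq_left h.le, mul_zero]
    refine (hasDerivAt_const s (0 : ℝ)).congr_of_eventuallyEq ?_
    filter_upwards [Iio_mem_nhds h] with y hy
    simp [relu2, (mem_Iio.1 hy).le]
  · rw [max_self, mul_zero]
    have h : relu2 =O[𝓝 0] fun x => ‖x - 0‖ ^ 2 := by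
      refine Asymptotics.IsBigO.of_bound 1 (Eventually.of_forall fun y => ?_)
      simp only [relu2, sub_zero, norm_pow, norm_norm, one_mul]
      gcongr
      rw [Real.norm_eq_abs, Real.norm_eq_abs, abs_of_nonneg (le_max_left _ _)]
      exact max_le (abs_nonneg _) (le_abs_self _)
    have := h.hasFDerivAt (𝕜 := ℝ) one_lt_two
    simpa using this.hasDerivAt
  · rw [max_eq_right h.le]
    have h1 : HasDerivAt (fun y : ℝ => y ^ 2) (2 * s) s := by simpa using hasDerivAt_pow 2 s
    refine h1.congr_of_eventuallyEq ?_
    filter_upwards [Ioi_mem_nhds h] with y hy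
    simp [relu2, (mem_Ioi.1 hy).le]

/-- A `C¹` piecewise quadratic step from `0` to `1` on `[0,1]`. -/
def smoothStep (s : ℝ) : ℝ := 2 * relu2 s - 4 * relu2 (s - 1 / 2) + 2 * relu2 (s - 1)

/-- The derivative of `smoothStep`. -/
def smoothStepDeriv (s : ℝ) : ℝ := 4 * max 0 s - 8 * max 0 (s - 1 / 2) + 4 * max 0 (s - 1)

lemma hasDerivAt_smoothStep (s : ℝ) : HasDerivAt smoothStep (smoothStepDeriv s) s := by
  have h : ∀ a, HasDerivAt (fun s => relu2 (s - a)) (2 * max 0 (s - a)) s := fun a =>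
    (hasDerivAt_relu2 (s - a)).comp_sub_const s a
  refine ((((hasDerivAt_relu2 s).const_mul 2).sub ((h (1 / 2)).const_mul 4)).add
    ((h 1).const_mul 2)).congr_deriv ?_
  rw [smoothStepDeriv]
  ring

section

variable {s : ℝ}

lemma smoothStep_of_nonpos (hs : s ≤ 0) : smoothStep s = 0 := by
  simp [smoothStep, relu2, hs, show s - 2⁻¹ ≤ 0 by linarith, show s ≤ 1 by linarith]

lemma smoothStepDeriv_of_nonpos (hs : s ≤ 0) : smoothStepDeriv s = 0 := by
  simp [smoothStepDeriv, hs, show s - 2⁻¹ ≤ 0 by linarith, show s ≤ 1 by linarith]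

lemma smoothStep_of_one_le (hs : 1 ≤ s) : smoothStep s = 1 := by
  rw [smoothStep, relu2, relu2, relu2, max_eq_right (by linarith : 0 ≤ s),
    max_eq_right (by linarith : 0 ≤ s - 1 / 2), max_eq_right (by linarith : 0 ≤ s - 1)]
  ring

lemma smoothStepDeriv_of_one_le (hs : 1 ≤ s) : smoothStepDeriv s = 0 := by
  rw [smoothStepDeriv, max_eq_right (by linarith : 0 ≤ s),
    max_eq_right (by linarith : 0 ≤ s - 1 / 2), max_eq_right (by linarith : 0 ≤ s - 1)]
  ring

end

lemma smoothStepDeriv_mem_Icc (s : ℝ) : smoothStepDeriv s ∈ Icc (0 : ℝ) 2 := by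
  rcases le_total s 0 with hs₀ | hs₀
  · simp [smoothStepDeriv_of_nonpos hs₀]
  rcases le_total 1 s with hs₁ | hs₁
  · simp [smoothStepDeriv_of_one_le hs₁]
  rw [smoothStepDeriv, max_eq_right hs₀, max_eq_left (by linarith : s - 1 ≤ 0)]
  rcases le_total s (1 / 2) with h | h
  · rw [max_eq_left (by linarith : s - 1 / 2 ≤ 0)]
    constructor <;> linarith
  · rw [max_eq_right (by linarith : 0 ≤ s - 1 / 2)]
    constructor <;> linarith

lemma smoothStep_mem_Icc (s : ℝ) : smoothStep s ∈ Icc (0 : ℝ) 1 := by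
  have hmono : Monotone smoothStep :=
    monotone_of_hasDerivAt_nonneg hasDerivAt_smoothStep fun s => (smoothStepDeriv_mem_Icc s).1
  constructor
  · rw [← smoothStep_of_nonpos (min_le_right s 0)]
    exact hmono (min_le_left s 0)
  · rw [← smoothStep_of_one_le (le_max_right s 1)]
    exact hmono (le_max_left s 1)

/-- A `C¹` piecewise quadratic bump supported in `[-1,1]` whose integer translates sum to one. -/
def bump (s : ℝ) : ℝ := smoothStep (s + 1) - smoothStep s

/-- The derivative of `bump`. -/
def bumpDeriv (s : ℝ) : ℝ := smoothStepDeriv (s + 1) - smoothStepDeriv s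

lemma hasDerivAt_bump (s : ℝ) : HasDerivAt bump (bumpDeriv s) s :=
  ((hasDerivAt_smoothStep (s + 1)).comp_add_const s 1).sub (hasDerivAt_smoothStep s)

lemma abs_bump_le (s : ℝ) : |bump s| ≤ 1 :=
  (abs_sub_le_of_le_of_le (smoothStep_mem_Icc (s + 1)).1 (smoothStep_mem_Icc (s + 1)).2
    (smoothStep_mem_Icc s).1 (smoothStep_mem_Icc s).2).trans_eq (sub_zero 1)

lemma abs_bumpDeriv_le (s : ℝ) : |bumpDeriv s| ≤ 2 :=
  (abs_sub_le_of_le_of_le (smoothStepDeriv_mem_Icc (s + 1)).1 (smoothStepDeriv_mem_Icc (s + 1)).2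
    (smoothStepDeriv_mem_Icc s).1 (smoothStepDeriv_mem_Icc s).2).trans_eq (sub_zero 2)

lemma bump_eq_zero {s : ℝ} (hs : 1 ≤ |s|) : bump s = 0 := by
  rw [bump, sub_eq_zero]
  rcases le_abs.1 hs with h | h
  · rw [smoothStep_of_one_le h, smoothStep_of_one_le (by linarith)]
  · rw [smoothStep_of_nonpos (by linarith), smoothStep_of_nonpos (by linarith)]

lemma bumpDeriv_eq_zero {s : ℝ} (hs : 1 ≤ |s|) : bumpDeriv s = 0 := by
  rw [bumpDeriv, sub_eq_zero]
  rcases le_abs.1 hs with h | h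
  · rw [smoothStepDeriv_of_one_le h, smoothStepDeriv_of_one_le (by linarith)]
  · rw [smoothStepDeriv_of_nonpos (by linarith), smoothStepDeriv_of_nonpos (by linarith)]

lemma sum_bump {N : ℕ} {y : ℝ} (hy : y ∈ Icc (0 : ℝ) N) :
    ∑ j : Fin (N + 1), bump (y - (j : ℕ)) = 1 := by
  have htelescope : ∀ j : ℕ,
      bump (y - j) = smoothStep (y + 1 - j) - smoothStep (y + 1 - (j + 1 : ℕ)) := by
    intro j
    rw [bump]
    push_cast
    congr 2 <;> ring
  rw [Fin.sum_univ_eq_sum_range (fun j => bump (y - (j : ℕ))) (N + 1)]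
  simp only [htelescope]
  rw [Finset.sum_range_sub', smoothStep_of_one_le, smoothStep_of_nonpos, sub_zero]
  · push_cast; linarith [hy.2]
  · push_cast; linarith [hy.1]

end Bump

section QuadFactor

variable {D : ℕ} {B : ℝ}

/-- `h` is the combination, with output weights `quadSign`, of four neurons whose weights are at
most `B`. Such functions are the factors of the products formed by `sum_prod_quad_mem_reluSqClass`.
-/
def IsQuadFactor (B : ℝ) (h : (Fin D → ℝ) → ℝ) : Prop :=
  ∃ (w : Fin 4 → Fin D → ℝ) (b : Fin 4 → ℝ), (∀ r l, |w r l| ≤ B) ∧ (∀ r, |b r| ≤ B) ∧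
    ∀ z, h z = ∑ r, quadSign r * relu2 (∑ l, w r l * z l + b r)

lemma isQuadFactor_const_one (hB : 2 ≤ B) : IsQuadFactor B (fun _ : Fin D → ℝ => 1) := by
  refine ⟨0, fun r => quadLeft r * 1 + quadRight r * 1, fun r l => by simp; linarith, fun r => ?_,
    fun z => by simpa using (sum_quad_mul 1 1).symm⟩
  refine (abs_add_le _ _).trans ?_
  rw [mul_one, mul_one, abs_quadLeft, abs_quadRight]
  linarith

lemma isQuadFactor_comp_apply {g : ℝ → ℝ} {α β : Fin 4 → ℝ} (hα : ∀ r, |α r| ≤ B)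
    (hβ : ∀ r, |β r| ≤ B) (hg : ∀ s, g s = ∑ r, quadSign r * relu2 (α r * s + β r)) (j : Fin D) :
    IsQuadFactor B (fun z : Fin D → ℝ => g (z j)) := by
  refine ⟨fun r => Pi.single j (α r), β, fun r l => ?_, hβ, fun z => ?_⟩
  · rcases eq_or_ne l j with rfl | hl
    · simpa using hα r
    · simpa [hl] using (abs_nonneg _).trans (hα r)
  · simp [hg, Pi.single_apply]

lemma isQuadFactor_sub (hB : 2 ≤ B) (j : Fin D) {a : ℝ} (ha : a ∈ Icc (0 : ℝ) 1) :
    IsQuadFactor B (fun z : Fin D → ℝ => z j - a) := by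
  refine isQuadFactor_comp_apply (g := fun s => s - a) (α := quadLeft)
    (β := fun r => quadLeft r * (-a) + quadRight r * 1) (fun r => ?_) (fun r => ?_) (fun s => ?_) j
  · rw [abs_quadLeft]
    linarith
  · refine (abs_add_le _ _).trans ?_
    rw [mul_one, abs_mul, abs_quadLeft, abs_quadRight, abs_neg, abs_of_nonneg ha.1]
    linarith [ha.2]
  · calc s - a = ∑ r, quadSign r * relu2 (quadLeft r * (s - a) + quadRight r * 1) := by
          rw [sum_quad_mul, mul_one]
      _ = _ := Finset.sum_congr rfl fun r _ => by congr 2; ring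

lemma relu2_mul {c : ℝ} (hc : 0 ≤ c) (s : ℝ) : relu2 (c * s) = c ^ 2 * relu2 s := by
  rw [relu2, relu2, ← mul_pow, mul_max_of_nonneg _ _ hc, mul_zero]

/-- The scales of the four neurons representing `bump`: by the homogeneity of `relu2`, their
squares times `quadSign` are the coefficients in
`bump s = 2 σ(s + 1) - 4 σ(s + 1/2) + 4 σ(s - 1/2) - 2 σ(s - 1)`, where `σ = relu2`. -/
def bumpScale : Fin 4 → ℝ := ![√8, 4, 4, √8]

/-- The shifts of the four neurons representing `bump`. -/
def bumpShift : Fin 4 → ℝ := ![1, 1 / 2, -1 / 2, -1]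

lemma bumpScale_mem_Icc (r : Fin 4) : bumpScale r ∈ Icc (0 : ℝ) 4 := by
  have hsqrt : √8 ≤ 4 := Real.sqrt_le_iff.2 (by norm_num)
  fin_cases r <;> simp [bumpScale, hsqrt]

lemma abs_bumpShift_le (r : Fin 4) : |bumpShift r| ≤ 1 := by
  fin_cases r <;> norm_num [bumpShift, abs_le]

lemma bump_eq_sum (s : ℝ) :
    bump s = ∑ r, quadSign r * relu2 (bumpScale r * (s + bumpShift r)) := by
  simp only [relu2_mul (bumpScale_mem_Icc _).1]
  simp only [Fin.sum_univ_four, quadSign, bumpScale, bumpShift, Matrix.cons_val,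
    Real.sq_sqrt (by norm_num : (0 : ℝ) ≤ 8), bump, smoothStep]
  rw [show s + 1 - 1 / 2 = s + 1 / 2 by ring, show s + 1 - 1 = s by ring,
    show s + -1 / 2 = s - 1 / 2 by ring, show s + -1 = s - 1 by ring]
  ring

lemma isQuadFactor_bump {N : ℕ} (hN : 1 ≤ N) (hB : 8 * N ≤ B) (j : Fin D) {i : ℕ} (hi : i ≤ N) :
    IsQuadFactor B (fun z : Fin D → ℝ => bump (N * z j - i)) := by
  have hN' : (1 : ℝ) ≤ N := by exact_mod_cast hN
  have hi' : (i : ℝ) ≤ N := by exact_mod_cast hi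
  have hscale (r : Fin 4) : |bumpScale r| ≤ 4 :=
    (abs_of_nonneg (bumpScale_mem_Icc r).1).trans_le (bumpScale_mem_Icc r).2
  refine isQuadFactor_comp_apply (g := fun s => bump (N * s - i)) (α := fun r => bumpScale r * N)
    (β := fun r => bumpScale r * (bumpShift r - i)) (fun r => ?_) (fun r => ?_) (fun s => ?_) j
  · rw [abs_mul, Nat.abs_cast]
    nlinarith [hscale r]
  · have hshift : |bumpShift r - i| ≤ 1 + N := (abs_sub _ _).trans (by
      rw [Nat.abs_cast]; exact add_le_add (abs_bumpShift_le r) hi')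
    calc |bumpScale r * (bumpShift r - i)| ≤ 4 * (1 + N) := by
          rw [abs_mul]
          exact mul_le_mul (hscale r) hshift (abs_nonneg _) (by norm_num)
      _ ≤ B := by linarith
  · rw [bump_eq_sum]
    exact Finset.sum_congr rfl fun r _ => by congr 2; ring

lemma sum_prod_mem_reluSqClass {T : Type*} [Fintype T] {d m : ℕ} (hB : 1 ≤ B)
    {h : T → Fin (2 ^ m) → (Fin D → ℝ) → ℝ} (hh : ∀ t q, IsQuadFactor B (h t q))
    {c : Fin d → T → ℝ} (hc : ∀ j t, |c j t| ≤ B) :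
    (fun z j => ∑ t, c j t * ∏ q, h t q z) ∈
      reluSqClass D d (m + 2) (Fintype.card T * (4 * 2 ^ m))
        (Fintype.card T * (4 * 2 ^ m * (D + 1) + m * (4 * 2 ^ m) ^ 2 + d * (4 * 2 ^ m))) B := by
  choose w b hw hb hz using hh
  simp only [hz]
  exact sum_prod_quad_mem_reluSqClass hB hw hb hc

end QuadFactor

section QuasiInterpolant

variable {D d N k : ℕ} {i : Fin D → Fin (N + 1)} {z : Fin D → ℝ}

/-- The point with index `i` of the grid of mesh `1 / N` in the cube. -/
def gridPoint (i : Fin D → Fin (N + 1)) (l : Fin D) : ℝ := ((i l : ℕ) : ℝ) / N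

lemma gridPoint_mem_cube (hN : 1 ≤ N) (i : Fin D → Fin (N + 1)) :
    gridPoint i ∈ Icc (0 : Fin D → ℝ) 1 := by
  have hN' : (0 : ℝ) < N := by exact_mod_cast hN
  have hi : ∀ l, ((i l : ℕ) : ℝ) ≤ N := fun l => by exact_mod_cast Nat.lt_succ_iff.1 (i l).2
  exact ⟨fun l => by simp only [gridPoint, Pi.zero_apply]; positivity,
    fun l => by rw [gridPoint, Pi.one_apply, div_le_one hN']; exact hi l⟩

/-- The tensor product bump of radius `1 / N` around the grid point with index `i`. -/
def bumpProd (i : Fin D → Fin (N + 1)) (z : Fin D → ℝ) : ℝ := ∏ l, bump (N * z l - (i l : ℕ))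

/-- The derivative of `bumpProd`. -/
def bumpProdDeriv (i : Fin D → Fin (N + 1)) (z : Fin D → ℝ) : (Fin D → ℝ) →L[ℝ] ℝ :=
  ∑ l, (∏ j ∈ Finset.univ.erase l, bump (N * z j - (i j : ℕ))) •
    ((bumpDeriv (N * z l - (i l : ℕ)) * N) • ContinuousLinearMap.proj (R := ℝ) (φ := fun _ => ℝ) l)

lemma hasFDerivAt_bumpProd (i : Fin D → Fin (N + 1)) (z : Fin D → ℝ) :
    HasFDerivAt (bumpProd i) (bumpProdDeriv i z) z := by
  refine HasFDerivAt.finsetProd (g := fun l (z : Fin D → ℝ) => bump (N * z l - (i l : ℕ)))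
    fun l _ => ?_
  have haffine : HasFDerivAt (fun z : Fin D → ℝ => N * z l - ((i l : ℕ) : ℝ))
      ((N : ℝ) • ContinuousLinearMap.proj (R := ℝ) (φ := fun _ => ℝ) l) z :=
    ((ContinuousLinearMap.proj (R := ℝ) (φ := fun _ : Fin D => ℝ) l).hasFDerivAt.const_mul
      (N : ℝ)).sub_const _
  refine ((hasDerivAt_bump (N * z l - (i l : ℕ))).comp_hasFDerivAt z haffine).congr_fderiv ?_
  rw [smul_smul]

lemma abs_bumpProd_le (i : Fin D → Fin (N + 1)) (z : Fin D → ℝ) : |bumpProd i z| ≤ 1 := by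
  rw [bumpProd, Finset.abs_prod]
  exact Finset.prod_le_one (fun _ _ => abs_nonneg _) fun _ _ => abs_bump_le _

lemma norm_bumpProdDeriv_le (i : Fin D → Fin (N + 1)) (z : Fin D → ℝ) :
    ‖bumpProdDeriv i z‖ ≤ D * (2 * N) := by
  have hterm : ∀ l, ‖(∏ j ∈ Finset.univ.erase l, bump (N * z j - (i j : ℕ))) •
    ((bumpDeriv (N * z l - (i l : ℕ)) * N) •
      ContinuousLinearMap.proj (R := ℝ) (φ := fun _ : Fin D => ℝ) l)‖ ≤ 2 * N := by
    intro l
    have hproj : ‖ContinuousLinearMap.proj (R := ℝ) (φ := fun _ : Fin D => ℝ) l‖ ≤ 1 :=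
      ContinuousLinearMap.opNorm_le_bound _ zero_le_one fun x => by
        simpa using norm_le_pi_norm x l
    have hothers : ∏ j ∈ Finset.univ.erase l, |bump (N * z j - (i j : ℕ))| ≤ 1 :=
      Finset.prod_le_one (fun _ _ => abs_nonneg _) fun _ _ => abs_bump_le _
    rw [norm_smul, norm_smul, norm_mul, Real.norm_eq_abs, Real.norm_eq_abs, Finset.abs_prod,
      Real.norm_natCast]
    calc _ ≤ 1 * (2 * (N : ℝ) * 1) := by
          gcongr
          exact abs_bumpDeriv_le _
      _ = 2 * N := by ring
  refine (norm_sum_le_of_le _ fun l _ => hterm l).trans ?_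
  simp

lemma sum_bumpProd (hz : z ∈ Icc (0 : Fin D → ℝ) 1) :
    ∑ i : Fin D → Fin (N + 1), bumpProd i z = 1 := by
  have hswap := Finset.prod_univ_sum (fun _ : Fin D => (Finset.univ : Finset (Fin (N + 1))))
    (fun l j => bump (N * z l - (j : ℕ)))
  rw [Fintype.piFinset_univ] at hswap
  simp only [bumpProd]
  rw [← hswap]
  refine Finset.prod_eq_one fun l _ => sum_bump ?_
  have hl := apply_mem_Icc_of_mem_cube hz l
  exact ⟨mul_nonneg (Nat.cast_nonneg _) hl.1, mul_le_of_le_one_right (Nat.cast_nonneg _) hl.2⟩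

open Classical in
/-- The indices of the grid points whose bump does not vanish near `z`. -/
def nearIndices (N : ℕ) (z : Fin D → ℝ) : Finset (Fin D → Fin (N + 1)) :=
  Fintype.piFinset fun l => Finset.univ.filter fun j : Fin (N + 1) => |N * z l - (j : ℕ)| < 1

lemma mem_nearIndices : i ∈ nearIndices N z ↔ ∀ l, |N * z l - (i l : ℕ)| < 1 := by
  simp [nearIndices, Fintype.mem_piFinset]

lemma notMem_nearIndices : i ∉ nearIndices N z ↔ ∃ l, 1 ≤ |N * z l - (i l : ℕ)| := by
  simp [mem_nearIndices]

lemma card_nearIndices_le (z : Fin D → ℝ) : (nearIndices N z).card ≤ 2 ^ D := by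
  classical
  rw [nearIndices, Fintype.card_piFinset]
  refine (Finset.prod_le_pow_card _ _ 2 fun l _ => ?_).trans (by simp)
  set y := N * z l
  have hsubset : ((Finset.univ.filter fun j : Fin (N + 1) => |y - (j : ℕ)| < 1).image
      fun j : Fin (N + 1) => ((j : ℕ) : ℤ)) ⊆ {⌊y⌋, ⌊y⌋ + 1} := by
    intro n hn
    obtain ⟨j, hj, rfl⟩ := Finset.mem_image.1 hn
    have hj' := abs_lt.1 (Finset.mem_filter.1 hj).2
    have hlt : ⌊y⌋ < ((j : ℕ) : ℤ) + 1 := by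
      rw [Int.floor_lt]; push_cast; linarith
    have hle : ((j : ℕ) : ℤ) - 1 ≤ ⌊y⌋ := by
      rw [Int.le_floor]; push_cast; linarith
    simp only [Finset.mem_insert, Finset.mem_singleton]
    omega
  have hinj : Function.Injective fun j : Fin (N + 1) => ((j : ℕ) : ℤ) := fun a b hab =>
    Fin.ext (Nat.cast_injective (R := ℤ) hab)
  rw [← Finset.card_image_of_injective _ hinj]
  exact (Finset.card_le_card hsubset).trans Finset.card_le_two

lemma norm_sum_le_of_nearIndices {G : Type*} [NormedAddCommGroup G] (z : Fin D → ℝ)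
    {g : (Fin D → Fin (N + 1)) → G} {C : ℝ} (hg : ∀ i, i ∉ nearIndices N z → g i = 0)
    (hC : ∀ i ∈ nearIndices N z, ‖g i‖ ≤ C) (hC₀ : 0 ≤ C) : ‖∑ i, g i‖ ≤ 2 ^ D * C := by
  rw [← Finset.sum_subset (Finset.subset_univ (nearIndices N z)) fun i _ hi => hg i hi]
  refine (norm_sum_le_of_le _ hC).trans ?_
  rw [Finset.sum_const, nsmul_eq_mul]
  gcongr
  exact_mod_cast card_nearIndices_le z

lemma bumpProd_eq_zero (hi : i ∉ nearIndices N z) : bumpProd i z = 0 := by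
  obtain ⟨l, hl⟩ := notMem_nearIndices.1 hi
  exact Finset.prod_eq_zero (Finset.mem_univ l) (bump_eq_zero hl)

lemma bumpProdDeriv_eq_zero (hi : i ∉ nearIndices N z) : bumpProdDeriv i z = 0 := by
  obtain ⟨l, hl⟩ := notMem_nearIndices.1 hi
  refine Finset.sum_eq_zero fun m _ => ?_
  by_cases hml : m = l
  · rw [hml, bumpDeriv_eq_zero hl, zero_mul, zero_smul, smul_zero]
  · rw [Finset.prod_eq_zero (Finset.mem_erase.2 ⟨Ne.symm hml, Finset.mem_univ l⟩)
      (bump_eq_zero hl), zero_smul]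

lemma norm_sub_gridPoint_le (hN : 1 ≤ N) (hi : i ∈ nearIndices N z) :
    ‖z - gridPoint i‖ ≤ (N : ℝ)⁻¹ := by
  have hN' : (0 : ℝ) < N := by exact_mod_cast hN
  refine (pi_norm_le_iff_of_nonneg (by positivity)).2 fun l => ?_
  rw [Pi.sub_apply, gridPoint, Real.norm_eq_abs, ← mul_le_mul_iff_of_pos_left hN',
    mul_inv_cancel₀ hN'.ne']
  nth_rewrite 1 [← abs_of_pos hN']
  rw [← abs_mul, mul_sub, mul_div_cancel₀ _ hN'.ne']
  exact (mem_nearIndices.1 hi l).le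

lemma cube_subset_closure_interior :
    Icc (0 : Fin D → ℝ) 1 ⊆ closure (interior (Icc (0 : Fin D → ℝ) 1)) := by
  rw [← pi_univ_Icc, interior_pi_set finite_univ, closure_pi_set]
  simp only [Pi.zero_apply, Pi.one_apply, interior_Icc]
  rw [closure_Ioo zero_ne_one]

variable {F : Type} [NormedAddCommGroup F] [NormedSpace ℝ F] {f : (Fin D → ℝ) → F} {M : ℝ}

/-- The Taylor polynomials of degree `k - 1` of `f` at the grid points of mesh `1 / N`, glued by
the partition of unity `bumpProd`. -/
def quasiInterpolant (N k : ℕ) (f : (Fin D → ℝ) → F) (z : Fin D → ℝ) : F :=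
  ∑ i : Fin D → Fin (N + 1), bumpProd i z • taylorPoly k f (Icc 0 1) (gridPoint i) z

lemma hasFDerivAt_quasiInterpolant (hN : 1 ≤ N) (hf : ContDiffOn ℝ k f (Icc 0 1))
    (z : Fin D → ℝ) :
    HasFDerivAt (quasiInterpolant N (k + 1) f) (∑ i : Fin D → Fin (N + 1),
      (bumpProd i z • taylorPoly k (fderivWithin ℝ f (Icc 0 1)) (Icc 0 1) (gridPoint i) z +
        (bumpProdDeriv i z).smulRight (taylorPoly (k + 1) f (Icc 0 1) (gridPoint i) z))) z :=
  HasFDerivAt.fun_sum fun i _ => (hasFDerivAt_bumpProd i z).fun_smul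
    (hasFDerivAt_taylorPoly uniqueDiffOn_cube cube_subset_closure_interior hf
      (gridPoint_mem_cube hN i) z)

lemma quasiInterpolant_sub (f : (Fin D → ℝ) → F) (hz : z ∈ Icc (0 : Fin D → ℝ) 1) :
    quasiInterpolant N k f z - f z = ∑ i : Fin D → Fin (N + 1),
      bumpProd i z • (taylorPoly k f (Icc 0 1) (gridPoint i) z - f z) := by
  simp only [smul_sub, Finset.sum_sub_distrib]
  rw [← Finset.sum_smul, sum_bumpProd hz, one_smul]
  rfl

lemma hasFDerivWithinAt_quasiInterpolant_sub (hN : 1 ≤ N)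
    (hf : ContDiffOn ℝ (k + 1) f (Icc 0 1)) (hz : z ∈ Icc (0 : Fin D → ℝ) 1) :
    HasFDerivWithinAt (fun y => quasiInterpolant N (k + 1) f y - f y)
      (∑ i : Fin D → Fin (N + 1), (bumpProd i z •
        (taylorPoly k (fderivWithin ℝ f (Icc 0 1)) (Icc 0 1) (gridPoint i) z -
          fderivWithin ℝ f (Icc 0 1) z) + (bumpProdDeriv i z).smulRight
        (taylorPoly (k + 1) f (Icc 0 1) (gridPoint i) z - f z))) (Icc 0 1) z := by
  have hderiv := ((hf.differentiableOn (by simp)) z hz).hasFDerivWithinAt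
  refine HasFDerivWithinAt.congr ?_ (fun y hy => quasiInterpolant_sub f hy)
    (quasiInterpolant_sub f hz)
  exact HasFDerivWithinAt.fun_sum fun i _ =>
    (hasFDerivAt_bumpProd i z).hasFDerivWithinAt.fun_smul
      ((hasFDerivAt_taylorPoly uniqueDiffOn_cube cube_subset_closure_interior
        (hf.of_le (by norm_cast; omega)) (gridPoint_mem_cube hN i) z).hasFDerivWithinAt.sub hderiv)

lemma norm_taylorPoly_gridPoint_sub_le (hN : 1 ≤ N) (hf : CkBoundedOn (k + 1) M f (Icc 0 1))
    (hz : z ∈ Icc (0 : Fin D → ℝ) 1) (hi : i ∈ nearIndices N z) :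
    ‖taylorPoly (k + 1) f (Icc 0 1) (gridPoint i) z - f z‖ ≤ M * (N : ℝ)⁻¹ ^ (k + 1) := by
  have hM : 0 ≤ M := (norm_nonneg _).trans (hf.norm_le hz)
  rw [norm_sub_rev]
  refine (norm_sub_taylorPoly_le uniqueDiffOn_cube cube_subset_closure_interior (convex_Icc 0 1)
    hf.contDiffOn (hf.norm_iteratedFDerivWithin_le _ le_rfl)
    (gridPoint_mem_cube hN i) hz).trans ?_
  gcongr
  exact norm_sub_gridPoint_le hN hi

lemma norm_taylorPoly_fderivWithin_gridPoint_sub_le (hN : 1 ≤ N)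
    (hf : CkBoundedOn (k + 1) M f (Icc 0 1)) (hz : z ∈ Icc (0 : Fin D → ℝ) 1)
    (hi : i ∈ nearIndices N z) :
    ‖taylorPoly k (fderivWithin ℝ f (Icc 0 1)) (Icc 0 1) (gridPoint i) z -
      fderivWithin ℝ f (Icc 0 1) z‖ ≤ M * (N : ℝ)⁻¹ ^ k := by
  have hM : 0 ≤ M := (norm_nonneg _).trans (hf.norm_le hz)
  rw [norm_sub_rev]
  refine (norm_fderivWithin_sub_taylorPoly_le uniqueDiffOn_cube cube_subset_closure_interior
    (convex_Icc 0 1) (by exact_mod_cast hf.contDiffOn) (hf.norm_iteratedFDerivWithin_le _ le_rfl)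
    (gridPoint_mem_cube hN i) hz).trans ?_
  gcongr
  exact norm_sub_gridPoint_le hN hi

lemma norm_quasiInterpolant_sub_le (hN : 1 ≤ N) (hf : CkBoundedOn (k + 1) M f (Icc 0 1))
    (hz : z ∈ Icc (0 : Fin D → ℝ) 1) :
    ‖quasiInterpolant N (k + 1) f z - f z‖ ≤ 2 ^ D * M * (N : ℝ)⁻¹ ^ (k + 1) := by
  have hM : 0 ≤ M := (norm_nonneg _).trans (hf.norm_le hz)
  rw [quasiInterpolant_sub f hz, mul_assoc]
  refine norm_sum_le_of_nearIndices z (fun i hi => by rw [bumpProd_eq_zero hi, zero_smul])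
    (fun i hi => ?_) (by positivity)
  rw [norm_smul, ← one_mul (M * _)]
  gcongr
  · exact abs_bumpProd_le i z
  · exact norm_taylorPoly_gridPoint_sub_le hN hf hz hi

lemma norm_fderiv_quasiInterpolant_sub_le (hN : 1 ≤ N) (hf : CkBoundedOn (k + 1) M f (Icc 0 1))
    (hz : z ∈ Icc (0 : Fin D → ℝ) 1) :
    ‖fderiv ℝ (quasiInterpolant N (k + 1) f) z - fderivWithin ℝ f (Icc 0 1) z‖ ≤
      2 ^ D * ((1 + 2 * D) * M) * (N : ℝ)⁻¹ ^ k := by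
  have hM : 0 ≤ M := (norm_nonneg _).trans (hf.norm_le hz)
  have hN' : (N : ℝ) ≠ 0 := by exact_mod_cast (zero_lt_one.trans_le hN).ne'
  have hsmooth : ContDiffOn ℝ (k + 1) f (Icc 0 1) := by exact_mod_cast hf.contDiffOn
  have hinterp := hasFDerivAt_quasiInterpolant (k := k) hN
    (hsmooth.of_le (by norm_cast; omega)) z
  have hderiv := ((hsmooth.differentiableOn (by simp)) z hz).hasFDerivWithinAt
  rw [hinterp.fderiv, (uniqueDiffOn_cube z hz).eq (hinterp.hasFDerivWithinAt.sub hderiv)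
    (hasFDerivWithinAt_quasiInterpolant_sub hN hsmooth hz), mul_assoc]
  refine norm_sum_le_of_nearIndices z (fun i hi => ?_) (fun i hi => ?_) (by positivity)
  · rw [bumpProd_eq_zero hi, bumpProdDeriv_eq_zero hi, zero_smul, zero_add]
    ext v
    simp
  · refine (norm_add_le _ _).trans ?_
    rw [norm_smul, ContinuousLinearMap.norm_smulRight_apply]
    calc _ ≤ 1 * (M * (N : ℝ)⁻¹ ^ k) + (D * (2 * N)) * (M * (N : ℝ)⁻¹ ^ (k + 1)) := by
          gcongr
          · exact abs_bumpProd_le i z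
          · exact norm_taylorPoly_fderivWithin_gridPoint_sub_le hN hf hz hi
          · exact norm_bumpProdDeriv_le i z
          · exact norm_taylorPoly_gridPoint_sub_le hN hf hz hi
      _ = (1 + 2 * D) * M * (N : ℝ)⁻¹ ^ k := by
          rw [pow_succ]
          field_simp

end QuasiInterpolant

section NetworkApproximation

variable {D d N k : ℕ} {M B : ℝ} {f : (Fin D → ℝ) → Fin d → ℝ}

lemma prod_dite_pad {m Q : ℕ} (hQ : D + m ≤ Q) (a : Fin D → ℝ) (b : Fin m → ℝ) :
    (∏ q : Fin Q, if hq : (q : ℕ) < D then a ⟨q, hq⟩ else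
      if hq' : (q : ℕ) - D < m then b ⟨q - D, hq'⟩ else 1) = (∏ l, a l) * ∏ l, b l := by
  obtain ⟨e, rfl⟩ := Nat.exists_eq_add_of_le hQ
  rw [Fin.prod_univ_add, Fin.prod_univ_add]
  have hleft : ∀ l : Fin e, ¬ (D + m + (l : ℕ) < D) := fun l => by omega
  have hright : ∀ l : Fin e, ¬ (D + m + (l : ℕ) - D < m) := fun l => by omega
  simp [hleft, hright]

/-- The indices of the terms of `quasiInterpolant N k f`: a grid point together with a monomial in
`D` variables of degree less than `k`, written as the list of its variables. -/
abbrev TermIndex (D N k : ℕ) : Type := (Fin D → Fin (N + 1)) × (Σ m : Fin k, Fin m → Fin D)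

/-- The `Q` factors of a term of the quasi-interpolant: first the `D` univariate bumps, then the
linear factors of the monomial, then ones as padding. -/
def termFactor (Q : ℕ) (t : TermIndex D N k) (q : Fin Q) (z : Fin D → ℝ) : ℝ :=
  if hq : (q : ℕ) < D then bump (N * z ⟨q, hq⟩ - (t.1 ⟨q, hq⟩ : ℕ)) else
    if hq' : (q : ℕ) - D < t.2.1 then
      z (t.2.2 ⟨q - D, hq'⟩) - gridPoint t.1 (t.2.2 ⟨q - D, hq'⟩) else 1

/-- The Taylor coefficient of a term of the quasi-interpolant of `f`. -/
def termCoeff (f : (Fin D → ℝ) → Fin d → ℝ) (t : TermIndex D N k) : Fin d → ℝ :=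
  ((t.2.1 : ℕ).factorial : ℝ)⁻¹ •
    iteratedFDerivWithin ℝ t.2.1 f (Icc 0 1) (gridPoint t.1) (fun q => Pi.single (t.2.2 q) 1)

lemma isQuadFactor_termFactor (hN : 1 ≤ N) (hB : 8 * N ≤ B) {Q : ℕ} (t : TermIndex D N k)
    (q : Fin Q) : IsQuadFactor B (termFactor Q t q) := by
  have hN' : (1 : ℝ) ≤ N := by exact_mod_cast hN
  unfold termFactor
  split_ifs with hq hq'
  · exact isQuadFactor_bump hN hB _ (Nat.lt_succ_iff.1 (t.1 ⟨q, hq⟩).2)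
  · exact isQuadFactor_sub (by linarith) _
      (apply_mem_Icc_of_mem_cube (gridPoint_mem_cube hN t.1) _)
  · exact isQuadFactor_const_one (by linarith)

lemma norm_termCoeff_le (hN : 1 ≤ N) (hf : CkBoundedOn k M f (Icc 0 1))
    (t : TermIndex D N k) : ‖termCoeff f t‖ ≤ M := by
  have hmultilinear := ContinuousMultilinearMap.le_opNorm
    (iteratedFDerivWithin ℝ t.2.1 f (Icc 0 1) (gridPoint t.1))
    (fun q => Pi.single (t.2.2 q) (1 : ℝ))
  have hbasis : ∏ q, ‖(Pi.single (t.2.2 q) (1 : ℝ) : Fin D → ℝ)‖ = 1 :=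
    Finset.prod_eq_one fun q _ => by rw [Pi.norm_single, norm_one]
  have hfactorial : ((t.2.1 : ℕ).factorial : ℝ)⁻¹ ≤ 1 :=
    inv_le_one_of_one_le₀ (by exact_mod_cast (t.2.1 : ℕ).factorial_pos)
  rw [hbasis, mul_one] at hmultilinear
  rw [termCoeff, norm_smul, Real.norm_of_nonneg (by positivity)]
  exact (mul_le_of_le_one_left (norm_nonneg _) hfactorial).trans (hmultilinear.trans
    (hf.norm_iteratedFDerivWithin_le _ t.2.1.2.le _ (gridPoint_mem_cube hN t.1)))

lemma quasiInterpolant_eq_sum_terms {Q : ℕ} (hQ : D + k ≤ Q) (f : (Fin D → ℝ) → Fin d → ℝ) :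
    quasiInterpolant N k f = fun z j =>
      ∑ t : TermIndex D N k, termCoeff f t j * ∏ q, termFactor Q t q z := by
  ext z j
  simp only [quasiInterpolant, Finset.sum_apply, Pi.smul_apply, taylorPoly_eq_sum]
  rw [Fintype.sum_prod_type]
  refine Finset.sum_congr rfl fun i _ => ?_
  rw [smul_eq_mul, Finset.mul_sum]
  refine Finset.sum_congr rfl fun t _ => ?_
  have hprod := prod_dite_pad (show D + (t.1 : ℕ) ≤ Q by have := t.1.2; omega)
    (fun l => bump (N * z l - (i l : ℕ))) (fun q => z (t.2 q) - gridPoint i (t.2 q))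
  simp only [termFactor, termCoeff]
  rw [hprod, bumpProd]
  simp only [Pi.smul_apply, smul_eq_mul]
  ring

lemma quasiInterpolant_mem_reluSqClass (hN : 1 ≤ N) (hB : 8 * N ≤ B) (hMB : M ≤ B)
    (hf : CkBoundedOn k M f (Icc 0 1)) :
    quasiInterpolant N k f ∈ reluSqClass D d (D + k + 2)
      (Fintype.card (TermIndex D N k) * (4 * 2 ^ (D + k)))
      (Fintype.card (TermIndex D N k) * (4 * 2 ^ (D + k) * (D + 1) +
        (D + k) * (4 * 2 ^ (D + k)) ^ 2 + d * (4 * 2 ^ (D + k)))) B := by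
  have hN' : (1 : ℝ) ≤ N := by exact_mod_cast hN
  rw [quasiInterpolant_eq_sum_terms Nat.lt_two_pow_self.le]
  exact sum_prod_mem_reluSqClass (by linarith) (isQuadFactor_termFactor hN hB)
    (fun j t => (norm_le_pi_norm (termCoeff f t) j).trans ((norm_termCoeff_le hN hf t).trans hMB))

lemma exists_mem_reluSqClass_fderiv_sub_le (D d k : ℕ) :
    ∃ K : ℕ, ∀ (M : ℝ) (f : (Fin D → ℝ) → Fin d → ℝ), CkBoundedOn (k + 1) M f (Icc 0 1) →
      ∀ N : ℕ, 1 ≤ N → ∃ W S : ℕ, ∃ φ ∈ reluSqClass D d (D + (k + 1) + 2) W S ((|M| + 8) * N),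
        W ≤ K * (N + 1) ^ D ∧ S ≤ K * (N + 1) ^ D ∧ Differentiable ℝ φ ∧
        ∀ z ∈ Icc (0 : Fin D → ℝ) 1,
          ‖φ z - f z‖ ≤ 2 ^ D * ((1 + 2 * D) * M) * (N : ℝ)⁻¹ ^ k ∧
          ‖fderiv ℝ φ z - fderivWithin ℝ f (Icc 0 1) z‖ ≤
            2 ^ D * ((1 + 2 * D) * M) * (N : ℝ)⁻¹ ^ k := by
  classical
  let w := 4 * 2 ^ (D + (k + 1))
  let A := w * (D + 1) + (D + (k + 1)) * w ^ 2 + d * w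
  let m := Fintype.card (Σ m : Fin (k + 1), Fin m → Fin D)
  refine ⟨m * A, fun M f hf N hN => ?_⟩
  have hN' : (1 : ℝ) ≤ N := by exact_mod_cast hN
  have hcard : Fintype.card (TermIndex D N (k + 1)) = (N + 1) ^ D * m := by
    simp only [TermIndex, m, Fintype.card_prod, Fintype.card_fun, Fintype.card_fin]
  have hwA : w ≤ A := by
    simp only [A]
    nlinarith [Nat.zero_le (w * D), Nat.zero_le ((D + (k + 1)) * w ^ 2), Nat.zero_le (d * w)]
  refine ⟨_, _, _, quasiInterpolant_mem_reluSqClass hN (by nlinarith [abs_nonneg M])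
    (by nlinarith [le_abs_self M, abs_nonneg M]) hf, ?_, ?_, fun z =>
    (hasFDerivAt_quasiInterpolant hN
      (hf.contDiffOn.of_le (by norm_cast; omega)) z).differentiableAt,
    fun z hz => ⟨?_, norm_fderiv_quasiInterpolant_sub_le hN hf hz⟩⟩
  · rw [hcard]
    exact (Nat.mul_le_mul_left _ hwA).trans_eq (by ring)
  · rw [hcard]
    exact le_of_eq (by ring)
  · have hM : 0 ≤ M := (norm_nonneg _).trans (hf.norm_le hz)
    refine (norm_quasiInterpolant_sub_le hN hf hz).trans ?_
    gcongr ?_ * ?_ * ?_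
    · exact le_mul_of_one_le_left hM (by norm_num)
    · exact pow_le_pow_of_le_one (by positivity) (inv_le_one_of_one_le₀ hN') k.le_succ

end NetworkApproximation

section InwardField

variable {d : ℕ}

lemma eventually_nonneg_of_hasDerivWithinAt {u : ℝ → ℝ} {u' t : ℝ}
    (h : HasDerivWithinAt u u' (Ici t) t) (hu : 0 ≤ u t) (hu' : u t = 0 → 0 < u') :
    ∀ᶠ τ in 𝓝[>] t, 0 ≤ u τ := by
  rcases hu.eq_or_lt with hzero | hpos
  · have hslope := (hasDerivWithinAt_iff_tendsto_slope' (by simp)).1 (h.mono Ioi_subset_Ici_self)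
    filter_upwards [hslope.eventually (lt_mem_nhds (hu' hzero.symm)), self_mem_nhdsWithin]
      with τ hτ htτ
    rw [slope_def_field, ← hzero, sub_zero] at hτ
    exact ((div_pos_iff_of_pos_right (sub_pos.2 htτ)).1 hτ).le
  · have htendsto : Tendsto u (𝓝[>] t) (𝓝 (u t)) :=
      h.continuousWithinAt.mono Ioi_subset_Ici_self
    filter_upwards [htendsto.eventually (lt_mem_nhds hpos)] with τ hτ using hτ.le

lemma mem_cube_of_hasDerivWithinAt_of_inward {γ v : ℝ → Fin d → ℝ}
    (h₀ : γ 0 ∈ Icc (0 : Fin d → ℝ) 1)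
    (hγ : ∀ t ∈ Icc (0 : ℝ) 1, HasDerivWithinAt γ (v t) (Icc 0 1) t)
    (hv : ∀ t ∈ Icc (0 : ℝ) 1, γ t ∈ Icc (0 : Fin d → ℝ) 1 → ∀ j,
      (γ t j = 0 → 0 < v t j) ∧ (γ t j = 1 → v t j < 0)) :
    ∀ t ∈ Icc (0 : ℝ) 1, γ t ∈ Icc (0 : Fin d → ℝ) 1 := by
  have hclosed : IsClosed (γ ⁻¹' (Icc (0 : Fin d → ℝ) 1) ∩ Icc (0 : ℝ) 1) := by
    rw [inter_comm]
    exact ContinuousOn.preimage_isClosed_of_isClosed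
      (fun t ht => (hγ t ht).continuousWithinAt) isClosed_Icc isClosed_Icc
  refine hclosed.Icc_subset_of_forall_mem_nhdsWithin h₀ ?_
  rintro t ⟨hmem, ht⟩
  have ht' : t ∈ Icc (0 : ℝ) 1 := Ico_subset_Icc_self ht
  have hderiv := hasDerivWithinAt_pi.1
    ((hγ t ht').mono_of_mem_nhdsWithin (Icc_mem_nhdsGE_of_mem ht))
  have hlower : ∀ j, ∀ᶠ τ in 𝓝[>] t, 0 ≤ γ τ j := fun j =>
    eventually_nonneg_of_hasDerivWithinAt (hderiv j) (hmem.1 j) (hv t ht' hmem j).1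
  have hupper : ∀ j, ∀ᶠ τ in 𝓝[>] t, 0 ≤ 1 - γ τ j := fun j =>
    eventually_nonneg_of_hasDerivWithinAt ((hderiv j).const_sub 1) (sub_nonneg.2 (hmem.2 j))
      fun hj => neg_pos.2 ((hv t ht' hmem j).2 (by linarith))
  filter_upwards [eventually_all.2 hlower, eventually_all.2 hupper] with τ hτ₀ hτ₁
  exact ⟨hτ₀, fun j => sub_nonneg.1 (hτ₁ j)⟩

/-- The nearest point of the cube. -/
def clampCube (y : Fin d → ℝ) (j : Fin d) : ℝ := projIcc (0 : ℝ) 1 zero_le_one (y j)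

lemma clampCube_mem (y : Fin d → ℝ) : clampCube y ∈ Icc (0 : Fin d → ℝ) 1 :=
  ⟨fun j => (projIcc (0 : ℝ) 1 zero_le_one (y j)).2.1,
    fun j => (projIcc (0 : ℝ) 1 zero_le_one (y j)).2.2⟩

lemma clampCube_of_mem {y : Fin d → ℝ} (hy : y ∈ Icc (0 : Fin d → ℝ) 1) : clampCube y = y := by
  ext j
  rw [clampCube, projIcc_of_mem zero_le_one (apply_mem_Icc_of_mem_cube hy j)]

lemma lipschitzWith_clampCube : LipschitzWith 1 (clampCube : (Fin d → ℝ) → Fin d → ℝ) := by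
  refine .of_dist_le_mul fun y y' => (dist_pi_le_iff (by positivity)).2 fun j => ?_
  rw [NNReal.coe_one, one_mul]
  exact (abs_projIcc_sub_projIcc zero_le_one).trans (dist_le_pi_dist y y' j)

lemma lipschitzWith_withTime (t : ℝ) : LipschitzWith 1 fun x : Fin d → ℝ => withTime x t := by
  refine .of_dist_le_mul fun x y => (dist_pi_le_iff (by positivity)).2 fun j => ?_
  cases j using Fin.lastCases with
  | last => simp
  | cast j => simpa using dist_le_pi_dist x y j

lemma continuous_withTime (x : Fin d → ℝ) : Continuous (withTime x) := by
  refine continuous_pi fun j => ?_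
  cases j using Fin.lastCases with
  | last => simpa using continuous_id'
  | cast j => simpa using continuous_const

/-- A velocity field on space-time `[0,1]^{d+1}` that is `K`-Lipschitz and points strictly inwards
on the faces of the cube of positions. -/
structure IsInwardField (K : ℝ≥0) (g : (Fin (d + 1) → ℝ) → Fin d → ℝ) : Prop where
  lipschitzOnWith : LipschitzOnWith K g (Icc 0 1)
  inward : ∀ z ∈ Icc (0 : Fin (d + 1) → ℝ) 1, ∀ j : Fin d,
    (z j.castSucc = 0 → 0 < g z j) ∧ (z j.castSucc = 1 → g z j < 0)

variable {K : ℝ≥0} {f g : (Fin (d + 1) → ℝ) → Fin d → ℝ} {t : ℝ}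

lemma lipschitzOnWith_comp_withTime (hg : LipschitzOnWith K g (Icc 0 1))
    (ht : t ∈ Icc (0 : ℝ) 1) : LipschitzOnWith K (fun x => g (withTime x t)) (Icc 0 1) := by
  simpa only [mul_one, Function.comp_def] using
    hg.comp (lipschitzWith_withTime t).lipschitzOnWith fun _ hx => withTime_mem_cube.2 ⟨hx, ht⟩

namespace IsInwardField

lemma inward_withTime (hg : IsInwardField K g) {x : Fin d → ℝ}
    (hx : x ∈ Icc (0 : Fin d → ℝ) 1) (ht : t ∈ Icc (0 : ℝ) 1) (j : Fin d) :
    (x j = 0 → 0 < g (withTime x t) j) ∧ (x j = 1 → g (withTime x t) j < 0) := by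
  simpa only [withTime_castSucc] using hg.inward _ (withTime_mem_cube.2 ⟨hx, ht⟩) j

lemma mem_cube (hg : IsInwardField K g) {γ : ℝ → Fin d → ℝ} (h₀ : γ 0 ∈ Icc (0 : Fin d → ℝ) 1)
    (hγ : ∀ t ∈ Icc (0 : ℝ) 1, HasDerivWithinAt γ (g (withTime (γ t) t)) (Icc 0 1) t) :
    ∀ t ∈ Icc (0 : ℝ) 1, γ t ∈ Icc (0 : Fin d → ℝ) 1 :=
  mem_cube_of_hasDerivWithinAt_of_inward h₀ hγ fun _ ht hmem => hg.inward_withTime hmem ht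

end IsInwardField

lemma exists_isPicardLindelof_clampCube (hg : LipschitzOnWith K g (Icc 0 1)) (x : Fin d → ℝ) :
    ∃ C : ℝ≥0, IsPicardLindelof (fun t y => g (withTime (clampCube y) t))
      (⟨0, left_mem_Icc.2 zero_le_one⟩ : Icc (0 : ℝ) 1) x C 0 C K := by
  obtain ⟨C, hC⟩ := isCompact_Icc.exists_bound_of_continuousOn hg.continuousOn
  have hmem : ∀ y : Fin d → ℝ, ∀ t ∈ Icc (0 : ℝ) 1,
      withTime (clampCube y) t ∈ Icc (0 : Fin (d + 1) → ℝ) 1 := fun y t ht =>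
    withTime_mem_cube.2 ⟨clampCube_mem y, ht⟩
  refine ⟨C.toNNReal, fun t ht => ?_, fun y _ => ?_, fun t ht y _ => ?_, by simp⟩
  · simpa only [mul_one, Function.comp_def] using
      (lipschitzOnWith_comp_withTime hg ht).comp lipschitzWith_clampCube.lipschitzOnWith
        fun y _ => clampCube_mem y
  · exact hg.continuousOn.comp (continuous_withTime _).continuousOn (hmem y)
  · exact (hC _ (hmem y t ht)).trans (Real.le_coe_toNNReal C)

namespace IsInwardField

-- Clamping the position extends the field to the whole space, where Picard–Lindelöf applies; the
-- solution never leaves the cube, so that it is a trajectory of the field itself.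
lemma exists_trajectory (hg : IsInwardField K g) {x : Fin d → ℝ}
    (hx : x ∈ Icc (0 : Fin d → ℝ) 1) :
    ∃ γ : ℝ → Fin d → ℝ, γ 0 = x ∧
      ∀ t ∈ Icc (0 : ℝ) 1, HasDerivWithinAt γ (g (withTime (γ t) t)) (Icc 0 1) t := by
  obtain ⟨C, hC⟩ := exists_isPicardLindelof_clampCube hg.lipschitzOnWith x
  obtain ⟨γ, hγ₀, hγ⟩ := hC.exists_eq_forall_mem_Icc_hasDerivWithinAt₀
  have hmem := mem_cube_of_hasDerivWithinAt_of_inward (γ := γ) (hγ₀ ▸ hx) hγ fun t ht hmem => by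
    simpa only [clampCube_of_mem hmem] using hg.inward_withTime hmem ht
  exact ⟨γ, hγ₀, fun t ht => by simpa only [clampCube_of_mem (hmem t ht)] using hγ t ht⟩

end IsInwardField

lemma gronwallBound_one_le {K η δ : ℝ} (hK : 0 ≤ K) (hδ : 0 ≤ δ) :
    gronwallBound η K δ 1 ≤ (η + δ) * Real.exp K := by
  rcases hK.eq_or_lt with rfl | hK
  · simp [gronwallBound_K0]
  · have hexp : Real.exp K - 1 ≤ K * Real.exp K := by
      have := mul_le_mul_of_nonneg_right (Real.one_sub_le_exp_neg K) (Real.exp_pos K).le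
      rw [← Real.exp_add, neg_add_cancel, Real.exp_zero] at this
      linarith
    have hslope : δ / K * (Real.exp K - 1) ≤ δ * Real.exp K := by
      rw [div_mul_eq_mul_div, div_le_iff₀ hK]
      linarith [mul_le_mul_of_nonneg_left hexp hδ]
    simp only [gronwallBound_of_K_ne_0 hK.ne', mul_one, add_mul]
    linarith

lemma dist_trajectory_le {δ : ℝ} (hf : LipschitzOnWith K f (Icc 0 1))
    (hfg : ∀ z ∈ Icc (0 : Fin (d + 1) → ℝ) 1, dist (g z) (f z) ≤ δ) {X γ : ℝ → Fin d → ℝ}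
    (hX : ∀ t ∈ Icc (0 : ℝ) 1, HasDerivWithinAt X (f (withTime (X t) t)) (Icc 0 1) t)
    (hX_mem : ∀ t ∈ Icc (0 : ℝ) 1, X t ∈ Icc (0 : Fin d → ℝ) 1)
    (hγ : ∀ t ∈ Icc (0 : ℝ) 1, HasDerivWithinAt γ (g (withTime (γ t) t)) (Icc 0 1) t)
    (hγ_mem : ∀ t ∈ Icc (0 : ℝ) 1, γ t ∈ Icc (0 : Fin d → ℝ) 1) :
    dist (X 1) (γ 1) ≤ (dist (X 0) (γ 0) + δ) * Real.exp K := by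
  have hsub : ∀ t ∈ Ico (0 : ℝ) 1, t ∈ Icc (0 : ℝ) 1 := fun _ ht => Ico_subset_Icc_self ht
  have hgron := dist_le_of_approx_trajectories_ODE_of_mem (a := 0) (b := 1) (εf := 0) (εg := δ)
    (v := fun t y => f (withTime y t)) (s := fun _ => Icc 0 1)
    (fun t ht => lipschitzOnWith_comp_withTime hf (hsub t ht))
    (fun t ht => (hX t ht).continuousWithinAt)
    (fun t ht => (hX t (hsub t ht)).mono_of_mem_nhdsWithin (Icc_mem_nhdsGE_of_mem ht))
    (fun t _ => (dist_self _).le) (fun t ht => hX_mem t (hsub t ht))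
    (fun t ht => (hγ t ht).continuousWithinAt)
    (fun t ht => (hγ t (hsub t ht)).mono_of_mem_nhdsWithin (Icc_mem_nhdsGE_of_mem ht))
    (fun t ht => hfg _ (withTime_mem_cube.2 ⟨hγ_mem t (hsub t ht), hsub t ht⟩))
    (fun t ht => hγ_mem t (hsub t ht)) le_rfl 1 (right_mem_Icc.2 zero_le_one)
  have hδ : 0 ≤ δ := dist_nonneg.trans (hfg 0 (left_mem_Icc.2 zero_le_one))
  simpa only [zero_add, sub_zero] using
    hgron.trans (by simpa using gronwallBound_one_le K.2 hδ)

end InwardField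

section ApproximateField

variable {D d k : ℕ} {M δ ε : ℝ}

/-- `φ` is differentiable and is `δ`-close to `f` on the unit cube, together with its derivative. -/
structure IsC1Close (δ : ℝ) (φ f : (Fin D → ℝ) → Fin d → ℝ) : Prop where
  differentiable : Differentiable ℝ φ
  norm_sub_le : ∀ z ∈ Icc (0 : Fin D → ℝ) 1, ‖φ z - f z‖ ≤ δ
  norm_fderiv_sub_le : ∀ z ∈ Icc (0 : Fin D → ℝ) 1,
    ‖fderiv ℝ φ z - fderivWithin ℝ f (Icc 0 1) z‖ ≤ δ

lemma exists_nat_mul_inv_pow_le (hk : k ≠ 0) {E : ℝ} (hE : 0 ≤ E) (hε₀ : 0 < ε) (hε₁ : ε ≤ 1) :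
    ∃ N : ℕ, 1 ≤ N ∧ E * (N : ℝ)⁻¹ ^ k ≤ ε ∧ (N : ℝ) + 1 ≤ (E + 3) * ε ^ (-(1 / (k : ℝ))) := by
  set r : ℝ := ε ^ (-(1 / (k : ℝ))) with hr
  have hr_one : 1 ≤ r :=
    Real.one_le_rpow_of_pos_of_le_one_of_nonpos hε₀ hε₁ (neg_nonpos.2 (by positivity))
  have hr_pow : r ^ k = ε⁻¹ := by
    rw [hr, ← Real.rpow_natCast, ← Real.rpow_mul hε₀.le, neg_mul,
      one_div_mul_cancel (by exact_mod_cast hk), Real.rpow_neg_one]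
  have hceil : (E + 1) * r ≤ ⌈(E + 1) * r⌉₊ := Nat.le_ceil _
  have hone : (1 : ℝ) ≤ ⌈(E + 1) * r⌉₊ :=
    (one_le_mul_of_one_le_of_one_le (by linarith) hr_one).trans hceil
  refine ⟨⌈(E + 1) * r⌉₊, by exact_mod_cast hone, ?_, ?_⟩
  · have hpow : E * ε⁻¹ ≤ (⌈(E + 1) * r⌉₊ : ℝ) ^ k :=
      calc E * ε⁻¹ ≤ (E + 1) ^ k * r ^ k := by
            rw [hr_pow]
            gcongr
            linarith [le_self_pow₀ (show 1 ≤ E + 1 by linarith) hk]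
        _ ≤ (⌈(E + 1) * r⌉₊ : ℝ) ^ k := by
            rw [← mul_pow]
            gcongr
    rw [inv_pow, mul_inv_le_iff₀ (by positivity)]
    rwa [← div_eq_mul_inv, div_le_iff₀' hε₀] at hpow
  · linarith [(Nat.ceil_lt_add_one (show 0 ≤ (E + 1) * r by positivity)).le]

theorem exists_mem_reluSqClass_isC1Close (D d : ℕ) (hk : k ≠ 0) (M : ℝ) :
    ∃ C : ℝ, ∀ f : (Fin D → ℝ) → Fin d → ℝ, CkBoundedOn (k + 1) M f (Icc 0 1) →
      ∀ ε : ℝ, 0 < ε → ε ≤ 1 → ∃ (W S : ℕ) (B : ℝ),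
        ∃ φ ∈ reluSqClass D d (D + (k + 1) + 2) W S B,
          (W : ℝ) ≤ C * ε ^ (-((D : ℝ) / k)) ∧ (S : ℝ) ≤ C * ε ^ (-((D : ℝ) / k)) ∧
            B ≤ C * ε ^ (-(1 / (k : ℝ))) ∧ IsC1Close ε φ f := by
  obtain ⟨K, hK⟩ := exists_mem_reluSqClass_fderiv_sub_le D d k
  set E : ℝ := |2 ^ D * ((1 + 2 * D) * M)|
  refine ⟨max (K * (E + 3) ^ D) ((|M| + 8) * (E + 3)), fun f hf ε hε₀ hε₁ => ?_⟩
  obtain ⟨N, hN, hNε, hNr⟩ := exists_nat_mul_inv_pow_le hk (abs_nonneg _ : 0 ≤ E) hε₀ hε₁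
  obtain ⟨W, S, φ, hφ, hW, hS, hdiff, herr⟩ := hK M f hf N hN
  have hsmall : 2 ^ D * ((1 + 2 * D) * M) * (N : ℝ)⁻¹ ^ k ≤ ε :=
    (mul_le_mul_of_nonneg_right (le_abs_self _) (by positivity)).trans hNε
  have hsize : (K : ℝ) * ((N : ℝ) + 1) ^ D ≤
      max (K * (E + 3) ^ D) ((|M| + 8) * (E + 3)) * ε ^ (-((D : ℝ) / k)) :=
    calc (K : ℝ) * ((N : ℝ) + 1) ^ D ≤ K * ((E + 3) * ε ^ (-(1 / (k : ℝ)))) ^ D := by gcongr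
      _ = K * (E + 3) ^ D * ε ^ (-((D : ℝ) / k)) := by
          rw [mul_pow, ← Real.rpow_mul_natCast hε₀.le, mul_assoc]
          ring_nf
      _ ≤ _ := by gcongr; exact le_max_left _ _
  refine ⟨W, S, _, φ, hφ, le_trans (by exact_mod_cast hW) hsize,
    le_trans (by exact_mod_cast hS) hsize, ?_, hdiff, fun z hz => (herr z hz).1.trans hsmall,
    fun z hz => (herr z hz).2.trans hsmall⟩
  calc (|M| + 8) * (N : ℝ) ≤ (|M| + 8) * ((E + 3) * ε ^ (-(1 / (k : ℝ)))) := by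
        gcongr
        linarith
    _ = (|M| + 8) * (E + 3) * ε ^ (-(1 / (k : ℝ))) := (mul_assoc _ _ _).symm
    _ ≤ _ := by gcongr; exact le_max_right _ _

variable {φ f : (Fin (d + 1) → ℝ) → Fin d → ℝ}

/-- The field `f` with a push of strength `ε` towards the centre of the cube of positions, which
makes a field tangent to the faces point inwards. -/
def pushed (ε : ℝ) (f : (Fin (d + 1) → ℝ) → Fin d → ℝ) (z : Fin (d + 1) → ℝ) : Fin d → ℝ :=
  f z + ε • ((fun _ => 2) - (4 : ℝ) • space z)

lemma exists_ckBoundedOn_pushed (k : ℕ) (M : ℝ) :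
    ∃ M' : ℝ, ∀ f : (Fin (d + 1) → ℝ) → Fin d → ℝ, CkBoundedOn k M f (Icc 0 1) →
      ∀ ε ∈ Icc (0 : ℝ) 1, CkBoundedOn k M' (pushed ε f) (Icc 0 1) := by
  let I := {f : (Fin (d + 1) → ℝ) → Fin d → ℝ // CkBoundedOn k M f (Icc 0 1)} × Icc (0 : ℝ) 1
  have hu : UniqueDiffOn ℝ (Icc (0 : Fin (d + 1) → ℝ) 1) := uniqueDiffOn_cube
  have hf : UnifContDiffOn k (fun i : I => i.1.1) (Icc 0 1) := ⟨M, fun i => i.1.2⟩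
  have hpush : UnifContDiffOn k (fun (_ : I) (z : Fin (d + 1) → ℝ) =>
      (fun _ : Fin d => (2 : ℝ)) - (4 : ℝ) • space z) (Icc 0 1) :=
    .of_contDiffOn (by fun_prop) hu isCompact_Icc
  have hscalar : UnifContDiffOn k (fun (i : I) (_ : Fin (d + 1) → ℝ) => (i.2 : ℝ)) (Icc 0 1) :=
    .const _ (C := 1) fun i => (Real.norm_of_nonneg i.2.2.1).trans_le i.2.2.2
  obtain ⟨M', hM'⟩ := hf.add
    (UnifContDiffOn.bilinear (ContinuousLinearMap.lsmul ℝ ℝ) hscalar hpush hu) hu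
  exact ⟨M', fun f hf ε hε => hM' (⟨f, hf⟩, ⟨ε, hε⟩)⟩

lemma norm_pushed_sub_le (hε : 0 ≤ ε) {z : Fin (d + 1) → ℝ}
    (hz : z ∈ Icc (0 : Fin (d + 1) → ℝ) 1) : ‖pushed ε f z - f z‖ ≤ 2 * ε := by
  rw [pushed, add_sub_cancel_left, norm_smul, Real.norm_of_nonneg hε, mul_comm]
  refine mul_le_mul_of_nonneg_right ((pi_norm_le_iff_of_nonneg zero_le_two).2 fun j => ?_) hε
  have hj := apply_mem_Icc_of_mem_cube hz j.castSucc
  simp only [Pi.sub_apply, Pi.smul_apply, space_apply, smul_eq_mul, Real.norm_eq_abs, abs_le]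
  constructor <;> linarith [hj.1, hj.2]

lemma norm_space_le : ‖(space : (Fin (d + 1) → ℝ) →L[ℝ] Fin d → ℝ)‖ ≤ 1 :=
  ContinuousLinearMap.opNorm_le_bound _ zero_le_one fun z => by
    rw [one_mul]
    exact (pi_norm_le_iff_of_nonneg (norm_nonneg _)).2 fun j => norm_le_pi_norm z j.castSucc

lemma norm_withTime_one_le (v : Fin d → ℝ) : ‖withTime v 1‖ ≤ ‖v‖ + 1 := by
  refine (pi_norm_le_iff_of_nonneg (by positivity)).2 fun j => ?_
  cases j using Fin.lastCases with
  | last => simp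
  | cast j => simpa using (norm_le_pi_norm v j).trans (le_add_of_nonneg_right zero_le_one)

lemma fderivWithin_pushed {z : Fin (d + 1) → ℝ} (hz : z ∈ Icc (0 : Fin (d + 1) → ℝ) 1)
    (hf : DifferentiableWithinAt ℝ f (Icc 0 1) z) :
    fderivWithin ℝ (pushed ε f) (Icc 0 1) z =
      fderivWithin ℝ f (Icc 0 1) z - (ε * 4) • space := by
  have hpush := ((space (d := d)).hasFDerivWithinAt (s := Icc 0 1) (x := z)).const_smul (4 : ℝ)
    |>.const_sub (fun _ => 2) |>.const_smul ε
  have hadd : HasFDerivWithinAt (pushed ε f) _ (Icc 0 1) z := hf.hasFDerivWithinAt.add hpush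
  rw [hadd.fderivWithin (uniqueDiffOn_cube z hz)]
  module

namespace IsC1Close

lemma of_pushed (hφ : IsC1Close δ φ (pushed ε f)) (hf : DifferentiableOn ℝ f (Icc 0 1))
    (hε : 0 ≤ ε) : IsC1Close (δ + 4 * ε) φ f where
  differentiable := hφ.differentiable
  norm_sub_le z hz := by
    linarith [norm_sub_le_norm_sub_add_norm_sub (φ z) (pushed ε f z) (f z),
      hφ.norm_sub_le z hz, norm_pushed_sub_le (f := f) hε hz]
  norm_fderiv_sub_le z hz := by
    have hderiv := hφ.norm_fderiv_sub_le z hz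
    rw [fderivWithin_pushed hz (hf z hz)] at hderiv
    have hspace : ‖(ε * 4) • space (d := d)‖ ≤ 4 * ε := by
      rw [norm_smul, Real.norm_of_nonneg (by positivity), mul_comm ε]
      exact mul_le_of_le_one_right (by positivity) norm_space_le
    calc ‖fderiv ℝ φ z - fderivWithin ℝ f (Icc 0 1) z‖
        = ‖fderiv ℝ φ z - (fderivWithin ℝ f (Icc 0 1) z - (ε * 4) • space) -
            (ε * 4) • space‖ := by congr 1; abel
      _ ≤ δ + 4 * ε := (_root_.norm_sub_le _ _).trans (add_le_add hderiv hspace)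

lemma lipschitzOnWith (hφ : IsC1Close δ φ f) (hf : CkBoundedOn k M f (Icc 0 1)) (hk : 1 ≤ k) :
    LipschitzOnWith (M + δ).toNNReal φ (Icc 0 1) := by
  refine (convex_Icc _ _).lipschitzOnWith_of_nnnorm_fderiv_le (𝕜 := ℝ)
    (fun z _ => hφ.differentiable z) fun z hz => NNReal.le_toNNReal_of_coe_le ?_
  rw [coe_nnnorm]
  linarith [norm_sub_norm_le (fderiv ℝ φ z) (fderivWithin ℝ f (Icc 0 1) z),
    hφ.norm_fderiv_sub_le z hz, hf.norm_fderivWithin_le hk uniqueDiffOn_cube hz]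

lemma inward_of_pushed (hφ : IsC1Close δ φ (pushed ε f)) (hf : IsStraightField f)
    (hδ : δ < 2 * ε) {z : Fin (d + 1) → ℝ} (hz : z ∈ Icc (0 : Fin (d + 1) → ℝ) 1) (j : Fin d) :
    (z j.castSucc = 0 → 0 < φ z j) ∧ (z j.castSucc = 1 → φ z j < 0) := by
  have hclose := abs_le.1 ((norm_le_pi_norm (φ z - pushed ε f z) j).trans (hφ.norm_sub_le z hz))
  simp only [pushed, Pi.sub_apply, Pi.add_apply, Pi.smul_apply, space_apply, smul_eq_mul] at hclose
  constructor <;> intro hj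
  · rw [hf.face z hz j (.inl hj), hj] at hclose
    linarith [hclose.1]
  · rw [hf.face z hz j (.inr hj), hj] at hclose
    linarith [hclose.2]

lemma norm_fderiv_withTime_le (hφ : IsC1Close δ φ f) (hf : CkBoundedOn k M f (Icc 0 1))
    (hk : 1 ≤ k) (hstraight : IsStraightField f) {z : Fin (d + 1) → ℝ}
    (hz : z ∈ Icc (0 : Fin (d + 1) → ℝ) 1) :
    ‖fderiv ℝ φ z (withTime (φ z) 1)‖ ≤ (2 * M + δ + 1) * δ := by
  have hsplit : fderiv ℝ φ z (withTime (φ z) 1) =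
      (fderiv ℝ φ z - fderivWithin ℝ f (Icc 0 1) z) (withTime (φ z) 1) +
        fderivWithin ℝ f (Icc 0 1) z (withTime (φ z) 1 - withTime (f z) 1) := by
    rw [map_sub, hstraight.acceleration z hz, sub_zero, _root_.sub_apply, sub_add_cancel]
  have hdist : ‖withTime (φ z) 1 - withTime (f z) 1‖ ≤ δ := by
    simpa [dist_eq_norm] using
      ((lipschitzWith_withTime 1).dist_le_mul (φ z) (f z)).trans (by
        simpa [dist_eq_norm] using hφ.norm_sub_le z hz)
  have hφz : ‖φ z‖ ≤ M + δ := by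
    linarith [norm_sub_norm_le (φ z) (f z), hφ.norm_sub_le z hz, hf.norm_le hz]
  have hwithTime : ‖withTime (φ z) 1‖ ≤ M + δ + 1 :=
    (norm_withTime_one_le _).trans (add_le_add_left hφz 1)
  have hderiv := hf.norm_fderivWithin_le hk uniqueDiffOn_cube hz
  calc ‖fderiv ℝ φ z (withTime (φ z) 1)‖ ≤ δ * (M + δ + 1) + M * δ := by
        rw [hsplit]
        exact (norm_add_le _ _).trans (add_le_add
          (ContinuousLinearMap.le_of_opNorm_le_of_le _ (hφ.norm_fderiv_sub_le z hz) hwithTime)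
          (ContinuousLinearMap.le_of_opNorm_le_of_le _ hderiv hdist))
    _ = (2 * M + δ + 1) * δ := by ring

end IsC1Close

theorem exists_mem_reluSqClass_isInwardField (d : ℕ) (hk : k ≠ 0) (M : ℝ) :
    ∃ C : ℝ, ∀ f : (Fin (d + 1) → ℝ) → Fin d → ℝ, CkBoundedOn (k + 1) M f (Icc 0 1) →
      IsStraightField f → ∀ ε : ℝ, 0 < ε → ε ≤ 1 → ∃ (W S : ℕ) (B : ℝ),
        ∃ φ ∈ reluSqClass (d + 1) d (d + 1 + (k + 1) + 2) W S B,
          (W : ℝ) ≤ C * ε ^ (-(((d : ℝ) + 1) / k)) ∧ (S : ℝ) ≤ C * ε ^ (-(((d : ℝ) + 1) / k)) ∧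
            B ≤ C * ε ^ (-(1 / (k : ℝ))) ∧ IsC1Close (5 * ε) φ f ∧
              IsInwardField (M + 5 * ε).toNNReal φ := by
  obtain ⟨M', hM'⟩ := exists_ckBoundedOn_pushed (d := d) (k + 1) M
  obtain ⟨C, hC⟩ := exists_mem_reluSqClass_isC1Close (d + 1) d hk M'
  refine ⟨C, fun f hf hstraight ε hε₀ hε₁ => ?_⟩
  obtain ⟨W, S, B, φ, hφ, hW, hS, hB, hpushed⟩ := hC _ (hM' f hf ε ⟨hε₀.le, hε₁⟩) ε hε₀ hε₁
  have hclose : IsC1Close (5 * ε) φ f := by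
    convert hpushed.of_pushed (hf.contDiffOn.differentiableOn (by norm_cast)) hε₀.le using 1
    ring
  push_cast at hW hS
  exact ⟨W, S, B, φ, hφ, hW, hS, hB, hclose, hclose.lipschitzOnWith hf (by omega),
    fun z hz => hpushed.inward_of_pushed hstraight (by linarith) hz⟩

end ApproximateField

section Euclidean

variable {d k : ℕ}

/-- The identity map from the Euclidean to the maximum norm. -/
def toSup (d : ℕ) : EuclideanSpace ℝ (Fin d) →L[ℝ] Fin d → ℝ := EuclideanSpace.equiv (Fin d) ℝ

/-- The identity map from the maximum to the Euclidean norm. -/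
def fromSup (d : ℕ) : (Fin d → ℝ) →L[ℝ] EuclideanSpace ℝ (Fin d) :=
  (EuclideanSpace.equiv (Fin d) ℝ).symm

lemma mem_unitCube_iff {x : EuclideanSpace ℝ (Fin d)} :
    x ∈ unitCube d ↔ WithLp.ofLp x ∈ Icc (0 : Fin d → ℝ) 1 :=
  forall_and

lemma toSup_preimage_cube : toSup d ⁻¹' Icc 0 1 = unitCube d :=
  ext fun _ => mem_unitCube_iff.symm

lemma fromSup_preimage_unitCube : fromSup d ⁻¹' unitCube d = Icc 0 1 :=
  ext fun _ => mem_unitCube_iff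

lemma measurableSet_unitCube : MeasurableSet (unitCube d) :=
  toSup_preimage_cube (d := d) ▸ (toSup d).measurable measurableSet_Icc

lemma uniqueDiffOn_unitCube : UniqueDiffOn ℝ (unitCube d) := by
  rw [← toSup_preimage_cube]
  exact (EuclideanSpace.equiv (Fin d) ℝ).uniqueDiffOn_preimage_iff.2 uniqueDiffOn_cube

lemma volume_unitCube : volume (unitCube d) = 1 := by
  rw [← toSup_preimage_cube, ← volume_cube (n := d)]
  exact (PiLp.volume_preserving_ofLp (Fin d)).measure_preimage measurableSet_Icc.nullMeasurableSet

lemma norm_toLp_le (v : Fin d → ℝ) : ‖WithLp.toLp 2 v‖ ≤ ‖fromSup d‖ * ‖v‖ :=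
  (fromSup d).le_opNorm v

lemma map_ofLp_withDensity_unitCube (p : EuclideanSpace ℝ (Fin d) → ℝ) :
    ((volume.restrict (unitCube d)).withDensity fun x => ENNReal.ofReal (p x)).map WithLp.ofLp =
      cubeMeasure (p ∘ fromSup d) := by
  have hm : MeasurableEmbedding (WithLp.ofLp : EuclideanSpace ℝ (Fin d) → Fin d → ℝ) :=
    (MeasurableEquiv.toLp 2 (Fin d → ℝ)).symm.measurableEmbedding
  ext s hs
  rw [hm.map_apply, cubeMeasure, withDensity_apply _ (hm.measurable hs), withDensity_apply _ hs,
    Measure.restrict_restrict (hm.measurable hs), Measure.restrict_restrict hs,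
    ← toSup_preimage_cube]
  exact (PiLp.volume_preserving_ofLp (Fin d)).setLIntegral_comp_preimage_emb hm
    (fun x => ENNReal.ofReal (p (WithLp.toLp 2 x))) (s ∩ Icc 0 1)

namespace HasRegularDensity

variable {L₁ L₂ : ℝ} {μ : Measure (EuclideanSpace ℝ (Fin d))}

lemma absolutelyContinuous (h : HasRegularDensity d k L₁ L₂ μ) :
    μ ≪ volume.restrict (unitCube d) := by
  obtain ⟨p, -, -, -, rfl⟩ := h
  exact withDensity_absolutelyContinuous _ _

lemma exists_cubeDensity [IsProbabilityMeasure μ] (hL₁ : 0 ≤ L₁)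
    (h : HasRegularDensity d k L₁ L₂ μ) :
    ∃ q, CubeDensity k (L₁ * max 1 ‖fromSup d‖ ^ k) L₂ q ∧
      μ.map WithLp.ofLp = cubeMeasure q := by
  obtain ⟨p, hp, hnorm, hlower, hμ⟩ := h
  have hmap : μ.map WithLp.ofLp = cubeMeasure (p ∘ fromSup d) :=
    hμ ▸ map_ofLp_withDensity_unitCube p
  have hbound := (CkBoundedOn.of_ckNorm_le hL₁ hp hnorm).comp_continuousLinearMap
    uniqueDiffOn_unitCube (fromSup d) (fromSup_preimage_unitCube ▸ uniqueDiffOn_cube)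
  rw [fromSup_preimage_unitCube] at hbound
  refine ⟨p ∘ fromSup d, ⟨hbound, fun x hx => hlower _ (mem_unitCube_iff.2 hx), ?_⟩, hmap⟩
  exact hmap ▸ Measure.isProbabilityMeasure_map (toSup d).measurable.aemeasurable

end HasRegularDensity

lemma wassersteinDist_map_sq_le {E : Type*} [NormedAddCommGroup E] [MeasurableSpace E]
    [BorelSpace E] [SecondCountableTopology E] {π : Measure E} [IsProbabilityMeasure π]
    {T Y : E → E} (hT : AEMeasurable T π) (hY : AEMeasurable Y π) {δ : ℝ}
    (h : ∀ᵐ x ∂π, dist (T x) (Y x) ≤ δ) :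
    wassersteinDist 2 (π.map T) (π.map Y) ^ 2 ≤ ENNReal.ofReal (δ ^ 2) := by
  obtain ⟨x, hx⟩ := h.exists
  have hδ : 0 ≤ δ := dist_nonneg.trans hx
  have hTY := hT.prodMk hY
  have hcost : ∫⁻ z, edist z.1 z.2 ^ (2 : ℝ) ∂π.map (fun x => (T x, Y x)) ≤
      ENNReal.ofReal (δ ^ 2) := by
    rw [lintegral_map' (by fun_prop) hTY]
    calc ∫⁻ x, edist (T x) (Y x) ^ (2 : ℝ) ∂π ≤ ∫⁻ _, ENNReal.ofReal (δ ^ 2) ∂π := by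
          refine lintegral_mono_ae (h.mono fun x hx => ?_)
          rw [edist_dist, ENNReal.ofReal_pow hδ, ENNReal.rpow_two]
          gcongr
      _ = ENNReal.ofReal (δ ^ 2) := by simp
  rw [wassersteinDist, ← ENNReal.rpow_natCast, ← ENNReal.rpow_mul, Nat.cast_ofNat,
    one_div_mul_cancel two_ne_zero, ENNReal.rpow_one]
  exact (iInf₂_le _ ⟨AEMeasurable.map_map_of_aemeasurable measurable_fst.aemeasurable hTY,
    AEMeasurable.map_map_of_aemeasurable measurable_snd.aemeasurable hTY⟩).trans hcost

lemma IsTrajectory.hasDerivWithinAt_ofLp {φ : (Fin (d + 1) → ℝ) → Fin d → ℝ}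
    {x : EuclideanSpace ℝ (Fin d)} {γ : ℝ → EuclideanSpace ℝ (Fin d)}
    (h : IsTrajectory (toVelocity φ) x γ) : ∀ t ∈ Icc (0 : ℝ) 1,
      HasDerivWithinAt (fun s => WithLp.ofLp (γ s)) (φ (withTime (WithLp.ofLp (γ t)) t))
        (Icc 0 1) t := fun t ht =>
  (toSup d).hasFDerivAt.comp_hasDerivWithinAt t (h.2 t ht)

lemma HasUniqueTrajectory.isTrajectory_flowMap
    {f : EuclideanSpace ℝ (Fin d) → ℝ → EuclideanSpace ℝ (Fin d)}
    {x : EuclideanSpace ℝ (Fin d)} (h : HasUniqueTrajectory f x) :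
    IsTrajectory f x (flowMap f x) := by
  obtain ⟨γ, hγ, -⟩ := h
  have hexists : ∃ γ, IsTrajectory f x γ := ⟨γ, hγ⟩
  rw [show flowMap f x = hexists.choose from funext fun _ => dif_pos hexists]
  exact hexists.choose_spec

namespace IsInwardField

variable {K : ℝ≥0} {φ : (Fin (d + 1) → ℝ) → Fin d → ℝ} {x : EuclideanSpace ℝ (Fin d)}

lemma ofLp_trajectory_mem_cube (hφ : IsInwardField K φ) (hx : x ∈ unitCube d)
    {γ : ℝ → EuclideanSpace ℝ (Fin d)} (hγ : IsTrajectory (toVelocity φ) x γ) :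
    ∀ t ∈ Icc (0 : ℝ) 1, WithLp.ofLp (γ t) ∈ Icc (0 : Fin d → ℝ) 1 :=
  hφ.mem_cube (hγ.1 ▸ mem_unitCube_iff.1 hx) hγ.hasDerivWithinAt_ofLp

lemma eqOn_trajectory (hφ : IsInwardField K φ) (hx : x ∈ unitCube d)
    {γ γ' : ℝ → EuclideanSpace ℝ (Fin d)} (hγ : IsTrajectory (toVelocity φ) x γ)
    (hγ' : IsTrajectory (toVelocity φ) x γ') : EqOn γ γ' (Icc 0 1) := by
  have hsub : ∀ t ∈ Ico (0 : ℝ) 1, t ∈ Icc (0 : ℝ) 1 := fun _ ht => Ico_subset_Icc_self ht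
  have hd := hγ.hasDerivWithinAt_ofLp
  have hd' := hγ'.hasDerivWithinAt_ofLp
  intro t ht
  refine congrArg (WithLp.toLp 2) (ODE_solution_unique_of_mem_Icc_right
    (v := fun t y => φ (withTime y t)) (s := fun _ => Icc (0 : Fin d → ℝ) 1)
    (fun t ht => lipschitzOnWith_comp_withTime hφ.lipschitzOnWith (hsub t ht))
    (fun t ht => (hd t ht).continuousWithinAt)
    (fun t ht => (hd t (hsub t ht)).mono_of_mem_nhdsWithin (Icc_mem_nhdsGE_of_mem ht))
    (fun t ht => hφ.ofLp_trajectory_mem_cube hx hγ t (hsub t ht))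
    (fun t ht => (hd' t ht).continuousWithinAt)
    (fun t ht => (hd' t (hsub t ht)).mono_of_mem_nhdsWithin (Icc_mem_nhdsGE_of_mem ht))
    (fun t ht => hφ.ofLp_trajectory_mem_cube hx hγ' t (hsub t ht)) ?_ ht)
  rw [hγ.1, hγ'.1]

lemma hasUniqueTrajectory (hφ : IsInwardField K φ) (hx : x ∈ unitCube d) :
    HasUniqueTrajectory (toVelocity φ) x := by
  obtain ⟨γ, hγ₀, hγ⟩ := hφ.exists_trajectory (mem_unitCube_iff.1 hx)
  have htraj : IsTrajectory (toVelocity φ) x fun t => WithLp.toLp 2 (γ t) :=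
    ⟨congrArg (WithLp.toLp 2) hγ₀, fun t ht =>
      (fromSup d).hasFDerivAt.comp_hasDerivWithinAt t (hγ t ht)⟩
  exact ⟨_, htraj, fun γ' hγ' => hφ.eqOn_trajectory hx hγ' htraj⟩

lemma isTrajectory_flowMap (hφ : IsInwardField K φ) (hx : x ∈ unitCube d) :
    IsTrajectory (toVelocity φ) x (flowMap (toVelocity φ) x) :=
  (hφ.hasUniqueTrajectory hx).isTrajectory_flowMap

lemma ofLp_flowMap_mem_cube (hφ : IsInwardField K φ) (hx : x ∈ unitCube d) :
    ∀ t ∈ Icc (0 : ℝ) 1, WithLp.ofLp (flowMap (toVelocity φ) x t) ∈ Icc (0 : Fin d → ℝ) 1 :=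
  hφ.ofLp_trajectory_mem_cube hx (hφ.isTrajectory_flowMap hx)

lemma dist_ofLp_flowMap_le (hφ : IsInwardField K φ) {f : (Fin (d + 1) → ℝ) → Fin d → ℝ}
    {K' : ℝ≥0} (hf : LipschitzOnWith K' f (Icc 0 1)) {δ : ℝ}
    (hclose : ∀ z ∈ Icc (0 : Fin (d + 1) → ℝ) 1, dist (φ z) (f z) ≤ δ) {X : ℝ → Fin d → ℝ}
    (hX : ∀ t ∈ Icc (0 : ℝ) 1, HasDerivWithinAt X (f (withTime (X t) t)) (Icc 0 1) t)
    (hX_mem : ∀ t ∈ Icc (0 : ℝ) 1, X t ∈ Icc (0 : Fin d → ℝ) 1) (hx : x ∈ unitCube d) :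
    dist (X 1) (WithLp.ofLp (flowMap (toVelocity φ) x 1)) ≤
      (dist (X 0) (WithLp.ofLp x) + δ) * Real.exp K' := by
  have hflow := hφ.isTrajectory_flowMap hx
  simpa only [hflow.1] using dist_trajectory_le hf hclose hX hX_mem hflow.hasDerivWithinAt_ofLp
    (hφ.ofLp_flowMap_mem_cube hx)

lemma continuousOn_flowMap (hφ : IsInwardField K φ) :
    ContinuousOn (fun x => flowMap (toVelocity φ) x 1) (unitCube d) := by
  have hlip : LipschitzOnWith (Real.exp K).toNNReal
      (fun x => WithLp.ofLp (flowMap (toVelocity φ) (WithLp.toLp 2 x) 1))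
      (Icc (0 : Fin d → ℝ) 1) := by
    refine .of_dist_le_mul fun x hx y hy => ?_
    have hx' : WithLp.toLp 2 x ∈ unitCube d := mem_unitCube_iff.2 hx
    have hflow := hφ.isTrajectory_flowMap hx'
    have hdist := hφ.dist_ofLp_flowMap_le hφ.lipschitzOnWith (fun z _ => (dist_self (φ z)).le)
      hflow.hasDerivWithinAt_ofLp (hφ.ofLp_flowMap_mem_cube hx')
      (x := WithLp.toLp 2 y) (mem_unitCube_iff.2 hy)
    rw [Real.coe_toNNReal _ (Real.exp_pos _).le, mul_comm]
    simpa only [hflow.1, add_zero] using hdist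
  exact (fromSup d).continuous.comp_continuousOn
    (hlip.continuousOn.comp (toSup d).continuous.continuousOn fun x hx => mem_unitCube_iff.1 hx)

end IsInwardField

end Euclidean

section Objective

variable {d k : ℕ}

/-- The inclusion of space into space-time as the slice of time zero. -/
def timeZeroSlice : (Fin d → ℝ) →L[ℝ] Fin (d + 1) → ℝ :=
  ContinuousLinearMap.pi
    (Fin.snoc (α := fun _ => (Fin d → ℝ) →L[ℝ] ℝ) (fun j => ContinuousLinearMap.proj j) 0)

lemma timeZeroSlice_apply (v : Fin d → ℝ) : timeZeroSlice v = withTime v 0 := by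
  ext j
  cases j using Fin.lastCases <;> simp [timeZeroSlice]

lemma withTime_eq_add (v : Fin d → ℝ) (t : ℝ) : withTime v t = withTime v 0 + withTime 0 t := by
  ext j
  cases j using Fin.lastCases <;> simp

section Acceleration

variable {φ : (Fin (d + 1) → ℝ) → Fin d → ℝ} {x : EuclideanSpace ℝ (Fin d)} {t : ℝ}

lemma hasFDerivAt_toVelocity (hφ : DifferentiableAt ℝ φ (withTime (WithLp.ofLp x) t)) :
    HasFDerivAt (fun y => toVelocity φ y t)
      (fromSup d ∘L fderiv ℝ φ (withTime (WithLp.ofLp x) t) ∘L timeZeroSlice ∘L toSup d) x := by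
  have hslice : HasFDerivAt (fun y : EuclideanSpace ℝ (Fin d) => withTime (WithLp.ofLp y) t)
      (timeZeroSlice ∘L toSup d) x := by
    rw [show (fun y : EuclideanSpace ℝ (Fin d) => withTime (WithLp.ofLp y) t) =
      fun y => (timeZeroSlice ∘L toSup d) y + withTime 0 t from
        funext fun y => timeZeroSlice_apply (WithLp.ofLp y) ▸ withTime_eq_add _ t]
    exact (timeZeroSlice ∘L toSup d).hasFDerivAt.add_const _
  exact (fromSup d).hasFDerivAt.comp x (hφ.hasFDerivAt.comp x hslice)

lemma hasDerivAt_toVelocity (hφ : DifferentiableAt ℝ φ (withTime (WithLp.ofLp x) t)) :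
    HasDerivAt (fun s => toVelocity φ x s)
      (WithLp.toLp 2 (fderiv ℝ φ (withTime (WithLp.ofLp x) t) (withTime 0 1))) t := by
  have hslice : HasDerivAt (withTime (WithLp.ofLp x)) (withTime 0 1) t := by
    rw [← hasDerivWithinAt_univ]
    exact hasDerivWithinAt_withTime (hasDerivWithinAt_const t univ _)
  exact (fromSup d).hasFDerivAt.comp_hasDerivAt t (hφ.hasFDerivAt.comp_hasDerivAt t hslice)

lemma acceleration_toVelocity (hφ : DifferentiableAt ℝ φ (withTime (WithLp.ofLp x) t)) :
    acceleration (toVelocity φ) x t =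
      WithLp.toLp 2 (fderiv ℝ φ (withTime (WithLp.ofLp x) t)
        (withTime (φ (withTime (WithLp.ofLp x) t)) 1)) := by
  rw [acceleration, (hasFDerivAt_toVelocity hφ).fderiv, (hasDerivAt_toVelocity hφ).deriv,
    withTime_eq_add (φ _) 1, map_add, ← timeZeroSlice_apply]
  rfl

end Acceleration

lemma pathRegularizer_le {f : EuclideanSpace ℝ (Fin d) → ℝ → EuclideanSpace ℝ (Fin d)}
    {x : EuclideanSpace ℝ (Fin d)} {a : ℝ}
    (h : ∀ t ∈ Icc (0 : ℝ) 1, ‖acceleration f (flowMap f x t) t‖ ≤ a) :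
    pathRegularizer f x ≤ ENNReal.ofReal (a ^ 2) := by
  have ha : 0 ≤ a := (norm_nonneg _).trans (h 0 (left_mem_Icc.2 zero_le_one))
  calc pathRegularizer f x ≤ ∫⁻ _ in Icc (0 : ℝ) 1, ENNReal.ofReal (a ^ 2) := by
        refine setLIntegral_mono' measurableSet_Icc fun t ht => ?_
        rw [ENNReal.ofReal_pow ha, ← ofReal_norm]
        gcongr
        exact h t ht
    _ = ENNReal.ofReal (a ^ 2) := by simp

lemma regularizer_le {f : EuclideanSpace ℝ (Fin d) → ℝ → EuclideanSpace ℝ (Fin d)} {c : ℝ≥0∞}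
    (h : ∀ x ∈ unitCube d, pathRegularizer f x ≤ c) : regularizer f ≤ c :=
  calc regularizer f ≤ ∫⁻ _ in unitCube d, c := setLIntegral_mono' measurableSet_unitCube h
    _ = c := by simp [volume_unitCube]

lemma pathRegularizer_toVelocity_le {φ : (Fin (d + 1) → ℝ) → Fin d → ℝ} {K : ℝ≥0} {a : ℝ}
    (hφ : IsInwardField K φ) (hdiff : Differentiable ℝ φ)
    (h : ∀ z ∈ Icc (0 : Fin (d + 1) → ℝ) 1, ‖fderiv ℝ φ z (withTime (φ z) 1)‖ ≤ a)
    {x : EuclideanSpace ℝ (Fin d)} (hx : x ∈ unitCube d) :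
    pathRegularizer (toVelocity φ) x ≤ ENNReal.ofReal ((‖fromSup d‖ * a) ^ 2) := by
  refine pathRegularizer_le fun t ht => ?_
  rw [acceleration_toVelocity (hdiff _)]
  refine (norm_toLp_le _).trans ?_
  gcongr
  exact h _ (withTime_mem_cube.2 ⟨hφ.ofLp_flowMap_mem_cube hx t ht, ht⟩)

section Loss

variable {ρ π : Measure (EuclideanSpace ℝ (Fin d))} {T : (Fin d → ℝ) → Fin d → ℝ}

lemma map_toLp_comp_ofLp (hT : AEMeasurable T (π.map WithLp.ofLp))
    (hmap : (π.map WithLp.ofLp).map T = ρ.map WithLp.ofLp) :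
    π.map (fun x => WithLp.toLp 2 (T (WithLp.ofLp x))) = ρ := by
  have hofLp : Measurable (WithLp.ofLp : EuclideanSpace ℝ (Fin d) → Fin d → ℝ) :=
    (toSup d).measurable
  have htoLp : Measurable (WithLp.toLp 2 : (Fin d → ℝ) → EuclideanSpace ℝ (Fin d)) :=
    (fromSup d).measurable
  calc π.map (fun x => WithLp.toLp 2 (T (WithLp.ofLp x)))
      = ((π.map WithLp.ofLp).map T).map (WithLp.toLp 2) := by
        rw [AEMeasurable.map_map_of_aemeasurable hT hofLp.aemeasurable,
          AEMeasurable.map_map_of_aemeasurable htoLp.aemeasurable (hT.comp_measurable hofLp)]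
        rfl
    _ = (ρ.map WithLp.ofLp).map (WithLp.toLp 2) := by rw [hmap]
    _ = ρ := by
        rw [Measure.map_map htoLp hofLp]
        exact Measure.map_id

lemma map_ofLp_absolutelyContinuous (hπ : π ≪ volume.restrict (unitCube d)) :
    π.map WithLp.ofLp ≪ volume.restrict (Icc (0 : Fin d → ℝ) 1) := by
  have hmap := ((PiLp.volume_preserving_ofLp (Fin d)).restrict_preimage
    (measurableSet_Icc (a := (0 : Fin d → ℝ)) (b := 1))).map_eq
  rw [← hmap]
  exact toSup_preimage_cube (d := d) ▸ hπ.map (toSup d).measurable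

lemma wassersteinLoss_le_of_dist_le [IsProbabilityMeasure π] (hπ : π ≪ volume.restrict (unitCube d))
    (hT : AEMeasurable T (π.map WithLp.ofLp))
    (hmap : (π.map WithLp.ofLp).map T = ρ.map WithLp.ofLp)
    {g : EuclideanSpace ℝ (Fin d) → ℝ → EuclideanSpace ℝ (Fin d)}
    (hg : ContinuousOn (fun x => flowMap g x 1) (unitCube d)) {δ : ℝ}
    (h : ∀ x ∈ unitCube d, dist (T (WithLp.ofLp x)) (WithLp.ofLp (flowMap g x 1)) ≤ δ) :
    wassersteinLoss ρ π g ≤ ENNReal.ofReal ((‖fromSup d‖ * δ) ^ 2) := by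
  have hlift : AEMeasurable (fun x => WithLp.toLp 2 (T (WithLp.ofLp x))) π :=
    (fromSup d).measurable.comp_aemeasurable (hT.comp_measurable (toSup d).measurable)
  rw [wassersteinLoss, ← map_toLp_comp_ofLp hT hmap]
  refine wassersteinDist_map_sq_le hlift
    ((hg.aemeasurable measurableSet_unitCube).mono_ac hπ) ?_
  filter_upwards [hπ.ae_le (ae_restrict_mem measurableSet_unitCube)] with x hx
  rw [dist_eq_norm]
  refine (norm_toLp_le (T (WithLp.ofLp x) - WithLp.ofLp (flowMap g x 1))).trans ?_
  gcongr
  exact dist_eq_norm (T (WithLp.ofLp x)) _ ▸ h x hx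

lemma IsInwardField.wassersteinLoss_le {f φ : (Fin (d + 1) → ℝ) → Fin d → ℝ} {K K' : ℝ≥0} {δ : ℝ}
    (hφ : IsInwardField K φ) (hf : LipschitzOnWith K' f (Icc 0 1))
    (hclose : ∀ z ∈ Icc (0 : Fin (d + 1) → ℝ) 1, dist (φ z) (f z) ≤ δ) [IsProbabilityMeasure π]
    (hπ : π ≪ volume.restrict (unitCube d)) {X : (Fin d → ℝ) → ℝ → Fin d → ℝ}
    (hX : IsTransportFlow f X (π.map WithLp.ofLp) (ρ.map WithLp.ofLp)) :
    wassersteinLoss ρ π (toVelocity φ) ≤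
      ENNReal.ofReal ((‖fromSup d‖ * (δ * Real.exp K')) ^ 2) := by
  refine wassersteinLoss_le_of_dist_le hπ ((hX.continuousOn_one.aemeasurable
    measurableSet_Icc).mono_ac (map_ofLp_absolutelyContinuous hπ)) hX.map_one
    hφ.continuousOn_flowMap fun x hx => ?_
  have hx' := mem_unitCube_iff.1 hx
  simpa only [hX.apply_zero _ hx', dist_self, zero_add] using
    hφ.dist_ofLp_flowMap_le hf hclose (hX.hasDerivWithinAt _ hx') (hX.mem_cube _ hx') hx

end Loss

theorem exists_objectiveW_toVelocity_le (d : ℕ) (hk : 1 ≤ k) (M a : ℝ) :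
    ∃ C : ℝ, ∀ (δ : ℝ) (K : ℝ≥0) (f φ : (Fin (d + 1) → ℝ) → Fin d → ℝ)
      (X : (Fin d → ℝ) → ℝ → Fin d → ℝ) (ρ π : Measure (EuclideanSpace ℝ (Fin d)))
      [IsProbabilityMeasure π], δ ≤ a → π ≪ volume.restrict (unitCube d) →
      CkBoundedOn k M f (Icc 0 1) → IsStraightField f →
      IsTransportFlow f X (π.map WithLp.ofLp) (ρ.map WithLp.ofLp) →
      IsC1Close δ φ f → IsInwardField K φ →
        objectiveW ρ π (toVelocity φ) ≤ ENNReal.ofReal (C * δ ^ 2) ∧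
        ∀ x ∈ unitCube d, wassersteinLoss ρ π (toVelocity φ) + pathRegularizer (toVelocity φ) x ≤
          ENNReal.ofReal (C * δ ^ 2) := by
  refine ⟨(‖fromSup d‖ * Real.exp M.toNNReal) ^ 2 + (‖fromSup d‖ * (2 * M + a + 1)) ^ 2,
    fun δ K f φ X ρ π _ hδ hπ hf hstraight hX hclose hφ => ?_⟩
  have hδ₀ : 0 ≤ δ := (norm_nonneg _).trans (hclose.norm_sub_le 0 (left_mem_Icc.2 zero_le_one))
  have hloss := hφ.wassersteinLoss_le (hf.lipschitzOnWith hk uniqueDiffOn_cube (convex_Icc _ _))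
    (fun z hz => (dist_eq_norm _ _).trans_le (hclose.norm_sub_le z hz)) hπ hX
  have hpath : ∀ x ∈ unitCube d, pathRegularizer (toVelocity φ) x ≤
      ENNReal.ofReal ((‖fromSup d‖ * ((2 * M + a + 1) * δ)) ^ 2) := fun x hx =>
    pathRegularizer_toVelocity_le hφ hclose.differentiable (fun z hz =>
      (hclose.norm_fderiv_withTime_le hf hk hstraight hz).trans (by gcongr)) hx
  have hsum : ENNReal.ofReal ((‖fromSup d‖ * (δ * Real.exp M.toNNReal)) ^ 2) +
      ENNReal.ofReal ((‖fromSup d‖ * ((2 * M + a + 1) * δ)) ^ 2) = ENNReal.ofReal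
        (((‖fromSup d‖ * Real.exp M.toNNReal) ^ 2 + (‖fromSup d‖ * (2 * M + a + 1)) ^ 2) *
          δ ^ 2) := by
    rw [← ENNReal.ofReal_add (by positivity) (by positivity)]
    ring_nf
  exact ⟨hsum ▸ add_le_add hloss (regularizer_le hpath),
    fun x hx => hsum ▸ add_le_add hloss (hpath x hx)⟩

end Objective

end

theorem mainTheorem11 (d k : ℕ) (hd : 1 ≤ d) (hk : 2 ≤ k) :
    ∃ C₀ : ℝ, ∀ L₁ L₂ : ℝ, 1 < L₁ → 0 < L₂ →
      ∃ C' C : ℝ, ∀ ρ π : Measure (EuclideanSpace ℝ (Fin d)),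
        IsProbabilityMeasure ρ → IsProbabilityMeasure π →
        HasRegularDensity d k L₁ L₂ ρ → HasRegularDensity d k L₁ L₂ π →
        ∀ ε : ℝ, 0 < ε → ε ≤ 1 →
          ∃ (L W S : ℕ) (B : ℝ), ∃ φ ∈ reluSqClass (d + 1) d L W S B,
            (L : ℝ) ≤ C₀ ∧
            (W : ℝ) ≤ C' * ε ^ (-(((d : ℝ) + 1) / ((k : ℝ) - 1))) ∧
            (S : ℝ) ≤ C' * ε ^ (-(((d : ℝ) + 1) / ((k : ℝ) - 1))) ∧
            B ≤ C' * ε ^ (-(1 / ((k : ℝ) - 1))) ∧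
            (∀ x ∈ unitCube d, HasUniqueTrajectory (toVelocity φ) x) ∧
            objectiveW ρ π (toVelocity φ) ≤ ENNReal.ofReal (C * ε ^ 2) ∧
            ∀ x ∈ unitCube d,
              wassersteinLoss ρ π (toVelocity φ) + pathRegularizer (toVelocity φ) x
                ≤ ENNReal.ofReal (C * ε ^ 2) := by
  obtain ⟨k, rfl⟩ : ∃ m, k = m + 1 := ⟨k - 1, by omega⟩
  rw [show ((k + 1 : ℕ) : ℝ) - 1 = k by push_cast; ring]
  refine ⟨(d + 1 + (k + 1) + 2 : ℕ), fun L₁ L₂ hL₁ hL₂ => ?_⟩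
  obtain ⟨M, htransport⟩ := exists_straightField_transportFlow (d := d) (k := k + 1) (by omega)
    (L₁ * max 1 ‖fromSup d‖ ^ (k + 1)) hL₂
  obtain ⟨C', hnetwork⟩ := exists_mem_reluSqClass_isInwardField d (k := k) (by omega) M
  obtain ⟨C, hobjective⟩ := exists_objectiveW_toVelocity_le d (k := k + 1) (by omega) M 5
  refine ⟨C', C * 5 ^ 2, fun ρ π _ _ hρ hπ ε hε₀ hε₁ => ?_⟩
  obtain ⟨q₀, hq₀, hπq⟩ := hπ.exists_cubeDensity (by linarith)
  obtain ⟨q₁, hq₁, hρq⟩ := hρ.exists_cubeDensity (by linarith)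
  obtain ⟨f, X, hf, hstraight, hX⟩ := htransport q₀ q₁ hq₀ hq₁
  obtain ⟨W, S, B, φ, hφ, hW, hS, hB, hclose, hinward⟩ := hnetwork f hf hstraight ε hε₀ hε₁
  have hbound := hobjective (5 * ε) _ f φ X ρ π (by linarith) hπ.absolutelyContinuous hf hstraight
    (by rwa [hπq, hρq]) hclose hinward
  rw [mul_pow, ← mul_assoc] at hbound
  exact ⟨_, W, S, B, φ, hφ, le_rfl, hW, hS, hB, fun _ hx => hinward.hasUniqueTrajectory hx, hbound⟩
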